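/- Let $1<\beta<q$ be real numbers and use coordinates $(x,y,z,t)$ on $\mathbb R^4$. Let $$A=\{0\le t\le 1,\ |x|\le t^\beta,\ y=\pm t^q,\ z=0\}$$ be the $(q,\beta)$-bridge, and let $G\subset\{z=0,\ 0\le t\le 1\}$ be the surface which is the union of $A$ and of the four wings which, at each height $t\in[0,1]$, consist of the four straight segments joining $(\pm t^\beta,\pm t^q,0,t)$ to $(\pm t,\pm t,0,t)$ (with the same choice of signs at both ends). Thus $G$ contains $A$ and is bounded, for $t<1$, by the four straight line segments $\{0\le t\le1,\ x=\pm t,\ y=\pm t,\ z=0\}$, and $g=G\cap\{t=1\}=\{|x|\le 1,\ y=\pm1,\ z=0,\ t=1\}$. In the hyperplane $\{t=1\}\cong\mathbb R^3_{x,y,z}$ let $K_0$ be the planar closed polygon with consecutive vertices $$(-1,1,0),\ (1,1,0),\ (2,0,0),\ (1,-1,0),\ (-1,-1,0),\ (-2,0,0),$$ and let $L_0$ be the closed polygon with consecutive vertices $$(-1,1,0),\ (1,1,0),\ (3,-2,0),\ (1,-5,0),\ (0,-4,1),\ (-1,-3,0),\ (0,-2,-1),\ (1,-1,0),$$ $$(-1,-1,0),\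 (0,-2,1),\ (1,-3,0),\ (0,-4,-1),\ (-1,-5,0),\ (-3,-2,0).$$ Both are topologically trivial knots containing $g$; when the two segments of $g$ are replaced by the two segments $\{x=\pm1,\ |y|\le 1,\ z=0\}$, $K_0$ becomes a pair of unlinked circles and $L_0$ a pair of circles with linking number $\pm1$. Let $K$ and $L$ be any knots obtained from $K_0$ and $L_0$, respectively, by compactly supported bi-Lipschitz homeomorphisms of $\mathbb R^3$ which fix the square $\{|x|\le 1,\ |y|\le 1,\ z=0\}$ pointwise (for example $K=K_0$ and $L=L_0$). Let $X$ be the union of $G$ and the straight cone with vertex $0$ over $K\setminus g$, and let $Y$ be the union of $G$ and the straight cone with vertex $0$ over $L\setminus g$. Then the germs of $X$ and $Y$ at the origin are 1. outer Lipschitz equivalent: there is a homeomorphism between representatives of the two germs which fixes $0$ and is bi-Lipschitz for the Euclidean distance of $\mathbb R^4$; 2. topologically ambient equivalent: there are arbitrarily small closed balls centered at $0$ with a self-homeomorphism which fixes $0$ and maps $X$ to $Y$; 3. not ambient Lipschitz equivalent: there is no bi-Lipschitz homeomorphism $h$ between open neighborhoods of $0$ in $\mathbb R^4$ with $h(0)=0$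 which maps the germ of $X$ onto the germ of $Y$. -/

import Mathlib

open Set Topology
open scoped NNReal

/-- Euclidean space `ℝ³`, with coordinates `(x, y, z) = (p 0, p 1, p 2)`. -/
abbrev R3 : Type := EuclideanSpace ℝ (Fin 3)

/-- Euclidean space `ℝ⁴`, with coordinates `(x, y, z, t) = (v 0, v 1, v 2, v 3)`. -/
abbrev R4 : Type := EuclideanSpace ℝ (Fin 4)

namespace SurfaceGerm

section Equivalences

/-- The germs at the origin of `X` and `Y` are outer Lipschitz equivalent: there is a bijection
fixing the origin between representatives of the two germs which is bi-Lipschitz for the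
distance of the ambient space. -/
def OuterLipschitzEquivalent {n : ℕ} (X Y : Set (EuclideanSpace ℝ (Fin n))) : Prop :=
  ∃ (f : EuclideanSpace ℝ (Fin n) → EuclideanSpace ℝ (Fin n))
    (U V : Set (EuclideanSpace ℝ (Fin n))) (C : ℝ),
    IsOpen U ∧ IsOpen V ∧ 0 ∈ U ∧ 0 ∈ V ∧ 0 < C ∧ f 0 = 0 ∧ BijOn f (X ∩ U) (Y ∩ V) ∧
    ∀ p ∈ X ∩ U, ∀ p' ∈ X ∩ U,
      C⁻¹ * dist p p' ≤ dist (f p) (f p') ∧ dist (f p) (f p') ≤ C * dist p p'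

/-- The germs at the origin of `X` and `Y` are topologically ambient equivalent: there are
arbitrarily small closed balls centred at the origin with a self-homeomorphism that fixes the
origin and maps `X` to `Y`. -/
def TopologicallyAmbientEquivalent {n : ℕ} (X Y : Set (EuclideanSpace ℝ (Fin n))) : Prop :=
  ∀ δ : ℝ, 0 < δ → ∃ ε : ℝ, 0 < ε ∧ ε < δ ∧
    ∃ h : Metric.closedBall (0 : EuclideanSpace ℝ (Fin n)) ε ≃ₜ
        Metric.closedBall (0 : EuclideanSpace ℝ (Fin n)) ε,
      (∀ p : Metric.closedBall (0 : EuclideanSpace ℝ (Fin n)) ε,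
        (p : EuclideanSpace ℝ (Fin n)) = 0 → (h p : EuclideanSpace ℝ (Fin n)) = 0) ∧
      ∀ p : Metric.closedBall (0 : EuclideanSpace ℝ (Fin n)) ε,
        (p : EuclideanSpace ℝ (Fin n)) ∈ X ↔ (h p : EuclideanSpace ℝ (Fin n)) ∈ Y

/-- The germs at the origin of `X` and `Y` are ambient Lipschitz equivalent: there is a
bi-Lipschitz homeomorphism `h`, fixing the origin, between two open neighbourhoods of the
origin, which maps `X` to `Y`. -/
def AmbientLipschitzEquivalent {n : ℕ} (X Y : Set (EuclideanSpace ℝ (Fin n))) : Prop :=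
  ∃ (h : OpenPartialHomeomorph (EuclideanSpace ℝ (Fin n)) (EuclideanSpace ℝ (Fin n)))
    (C C' : ℝ≥0),
    0 ∈ h.source ∧ h 0 = 0 ∧ LipschitzOnWith C h h.source ∧ LipschitzOnWith C' h.symm h.target ∧
    h '' (X ∩ h.source) = Y ∩ h.target

end Equivalences

section Bridge

/-- The `(q, β)`-bridge `A = T₊ ∪ T₋`,
`T± = {0 ≤ t ≤ 1, -t^β ≤ x ≤ t^β, y = ±t^q, z = 0}`. -/
def bridge (q β : ℝ) : Set R4 :=
  {v | 0 ≤ v 3 ∧ v 3 ≤ 1 ∧ -((v 3) ^ β) ≤ v 0 ∧ v 0 ≤ (v 3) ^ β ∧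
    (v 1 = (v 3) ^ q ∨ v 1 = -((v 3) ^ q)) ∧ v 2 = 0}

/-- The four wings: at height `t`, the four planar segments which join the end
`(±t^β, ±t^q, 0)` of the bridge to the point `(±t, ±t, 0)` (with the same signs). -/
def wings (q β : ℝ) : Set R4 :=
  {v | 0 ≤ v 3 ∧ v 3 ≤ 1 ∧ v 2 = 0 ∧ ∃ s : ℝ, 0 ≤ s ∧ s ≤ 1 ∧
    |v 0| = (1 - s) * (v 3) ^ β + s * v 3 ∧ |v 1| = (1 - s) * (v 3) ^ q + s * v 3}

/-- The surface `G`, which contains the bridge and is bounded (over `0 ≤ t < 1`) by the four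
straight line segments `{0 ≤ t ≤ 1, x = ±t, y = ±t, z = 0}`. -/
def G (q β : ℝ) : Set R4 := bridge q β ∪ wings q β

/-- The copy of a point of `ℝ³` in the hyperplane `t = 1` of `ℝ⁴`. -/
noncomputable def lift (p : R3) : R4 := !₂[p 0, p 1, p 2, 1]

/-- The straight cone over `S` with vertex at the origin. -/
def cone (S : Set R4) : Set R4 := {v | ∃ t : ℝ, 0 ≤ t ∧ t ≤ 1 ∧ ∃ s ∈ S, v = t • s}

/-- For a knot `K` in the hyperplane `t = 1` which contains the curve `g = G ∩ {t = 1}`, the union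
of `G` and the straight cone over `K \ g`. -/
noncomputable def surface (q β : ℝ) (K : Set R3) : Set R4 :=
  G q β ∪ cone (lift '' K \ (G q β ∩ {v | v 3 = 1}))

end Bridge

section Knots

/-- The closed polygon with the given cyclically ordered vertices. -/
def closedPolygon {n : ℕ} [NeZero n] (v : Fin n → R3) : Set R3 :=
  ⋃ i : Fin n, segment ℝ (v i) (v (i + 1))

/-- The model of the knot `K`: a convex planar hexagon. It consists of the two segments
`{|x| ≤ 1, y = ±1, z = 0}` of `g` and of one arc on either side. -/
noncomputable def modelK : Set R3 :=
  closedPolygon ![!₂[-1, 1, 0], !₂[1, 1, 0], !₂[2, 0, 0], !₂[1, -1, 0], !₂[-1, -1, 0], !₂[-2, 0, 0]]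

/-- The model of the knot `L`: the two segments `{|x| ≤ 1, y = ±1, z = 0}` of `g` and two arcs,
one from `(1, 1, 0)` to `(1, -1, 0)` and one from `(-1, -1, 0)` to `(-1, 1, 0)`, which make one
full twist around each other about the `y`-axis, in the slab `-5 ≤ y ≤ -1`. -/
noncomputable def modelL : Set R3 :=
  closedPolygon ![!₂[-1, 1, 0], !₂[1, 1, 0], !₂[3, -2, 0],
    !₂[1, -5, 0], !₂[0, -4, 1], !₂[-1, -3, 0], !₂[0, -2, -1], !₂[1, -1, 0],
    !₂[-1, -1, 0], !₂[0, -2, 1], !₂[1, -3, 0], !₂[0, -4, -1], !₂[-1, -5, 0], !₂[-3, -2, 0]]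

/-- The planar square `|x| ≤ 1, |y| ≤ 1, z = 0`; for every `0 < t ≤ 1` it contains the section of
`G` at height `t`, scaled by `1 / t`. -/
def square : Set R3 := {p | |p 0| ≤ 1 ∧ |p 1| ≤ 1 ∧ p 2 = 0}

/-- `K` is obtained from `K₀` by a compactly supported bi-Lipschitz homeomorphism of `ℝ³` which
fixes the square pointwise: a knot of the same shape as `K₀`, and in the same position with
respect to the bridge. -/
def IsDeformation (K₀ K : Set R3) : Prop :=
  ∃ (Φ : R3 ≃ₜ R3) (C C' : ℝ≥0) (R : ℝ), LipschitzWith C Φ ∧ LipschitzWith C' Φ.symm ∧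
    (∀ p ∈ square, Φ p = p) ∧ (∀ p, R < ‖p‖ → Φ p = p) ∧ K = Φ '' K₀

end Knots

end SurfaceGerm

namespace SurfaceGerm

/-! Outer equivalence. Below height one, each surface lies in the cone over the union of its knot
and the square, and `G` lies in the cone over the square. A bi-Lipschitz map from `modelK ∪ square`
to `modelL ∪ square` which is the identity on the square therefore extends homogeneously to the
surfaces and fixes `G` pointwise, although `G` itself is not homogeneous. Such a map exists because
the arcs of both knots meet the square only at its corners and leave it at positive angles
(`outerPair_model`, `OuterPair.outerLipschitzEquivalent`).

Topological equivalence. Homogeneous homeomorphisms which fix the cone over the square, made norm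
preserving by `radial`, move `modelK` to a planar polygon with two parallel inner strands
(`ballEquivalent_unfurl`) and turn the inner strands of `modelL` into helices
(`ballEquivalent_rounding`). A full twist in the `(x, z)`-planes relates the two
(`ballEquivalent_rotate`). Its angle grows from `0` to `2π` along the strands and returns to `0` in
the gap between the two sheets of `G`, so `G` is fixed. Over the bridge this gap has width only `2
t^q`, while `|x|` reaches `t^β`: the twist is continuous, but not Lipschitz.

No ambient Lipschitz equivalence. Let `H` map the surface of `modelK` to that of `modelL`. Composed
with the inverse of the outer equivalence, it becomes a bi-Lipschitz self-map `g` of the surface of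
`modelK`. Two opposite points of the bridge are at distance `2 t^q`, yet every connected subset of
the surface joining them reaches a fold at distance of order `t`; close points not separated by the
bridge are joined by small connected sets. Hence `g` respects the bridge up to errors of order
`t^q`, negligible against `t^β` (`HexagonIso.exists_opposite`). The preimages of the right and of
the left edges of the bridge then lie on different sides `x > 0`, `x < 0`, and some side is mapped
into the complement of the left part (`HexagonIso.exists_side`).

The linking number enters through the continuous complex function `linkFun`. At each height its
zeros form a closed curve: the left half of the surface of `modelL`, closed by a segment between the
left edges of the bridge. On a convex box on the chosen side, `linkFun ∘ H` has no zeros, so it has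
a logarithm there. Take the preimages of the two right edges at a small height `s`. Along the
surface, the argument changes by `2π` up to an error below `π`, because the right half of `modelL`
winds once around the left half (`linkFun_mul_exp_re_pos`). Along the straight chord, of length of
order `s^q`, the real part stays positive, so the change is below `π`. This contradiction is
`not_germIso_model`; arbitrary deformations are reduced to the models by conjugation with
bi-Lipschitz cone maps (`exists_germIso`). -/

theorem R4.ext {v w : R4} (h0 : v 0 = w 0) (h1 : v 1 = w 1) (h2 : v 2 = w 2) (h3 : v 3 = w 3) :
    v = w := by
  ext i; fin_cases i <;> assumption

theorem R3.ext {v w : R3} (h0 : v 0 = w 0) (h1 : v 1 = w 1) (h2 : v 2 = w 2) : v = w := by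
  ext i; fin_cases i <;> assumption

/-- The central projection of the half space `t > 0` to the hyperplane `t = 1`. -/
noncomputable def proj (v : R4) : R3 := !₂[v 0 / v 3, v 1 / v 3, v 2 / v 3]

@[simp] theorem proj_zero (v : R4) : proj v 0 = v 0 / v 3 := rfl
@[simp] theorem proj_one (v : R4) : proj v 1 = v 1 / v 3 := rfl
@[simp] theorem proj_two (v : R4) : proj v 2 = v 2 / v 3 := rfl
@[simp] theorem lift_zero (p : R3) : lift p 0 = p 0 := rfl
@[simp] theorem lift_one (p : R3) : lift p 1 = p 1 := rfl
@[simp] theorem lift_two (p : R3) : lift p 2 = p 2 := rfl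
@[simp] theorem lift_three (p : R3) : lift p 3 = 1 := rfl

@[simp] theorem proj_lift (p : R3) : proj (lift p) = p := by
  apply R3.ext <;> simp

theorem smul_lift_proj {v : R4} (h : v 3 ≠ 0) : v 3 • lift (proj v) = v := by
  apply R4.ext <;> simp <;> field_simp

theorem proj_smul {c : ℝ} (hc : c ≠ 0) (v : R4) : proj (c • v) = proj v := by
  apply R3.ext <;> simp [mul_div_mul_left _ _ hc]

theorem lift_injective : Function.Injective lift :=
  Function.LeftInverse.injective proj_lift

theorem abs_coord_le {n : ℕ} (v : EuclideanSpace ℝ (Fin n)) (i : Fin n) : |v i| ≤ ‖v‖ := by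
  simpa using PiLp.norm_apply_le v i

theorem norm_le_sum4 (v : R4) : ‖v‖ ≤ |v 0| + |v 1| + |v 2| + |v 3| := by
  rw [EuclideanSpace.norm_eq, Real.sqrt_le_left (by positivity)]
  simp only [Fin.sum_univ_four, Real.norm_eq_abs]
  have := abs_nonneg (v 0); have := abs_nonneg (v 1)
  have := abs_nonneg (v 2); have := abs_nonneg (v 3)
  nlinarith [mul_nonneg (abs_nonneg (v 0)) (abs_nonneg (v 1)),
    mul_nonneg (abs_nonneg (v 0)) (abs_nonneg (v 2)),
    mul_nonneg (abs_nonneg (v 0)) (abs_nonneg (v 3)),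
    mul_nonneg (abs_nonneg (v 1)) (abs_nonneg (v 2)),
    mul_nonneg (abs_nonneg (v 1)) (abs_nonneg (v 3)),
    mul_nonneg (abs_nonneg (v 2)) (abs_nonneg (v 3))]

theorem norm_le_sum3 (v : R3) : ‖v‖ ≤ |v 0| + |v 1| + |v 2| := by
  rw [EuclideanSpace.norm_eq, Real.sqrt_le_left (by positivity)]
  simp only [Fin.sum_univ_three, Real.norm_eq_abs]
  have := abs_nonneg (v 0); have := abs_nonneg (v 1)
  have := abs_nonneg (v 2)
  nlinarith [mul_nonneg (abs_nonneg (v 0)) (abs_nonneg (v 1)),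
    mul_nonneg (abs_nonneg (v 0)) (abs_nonneg (v 2)),
    mul_nonneg (abs_nonneg (v 1)) (abs_nonneg (v 2))]

/-- The slope of the wings at height `t`. -/
noncomputable def slope (q β t : ℝ) : ℝ := (t - t ^ q) / (t - t ^ β)

/-- At height `t`, the surface `G` is the curve `|y| = profile q β t |x|`, `|x| ≤ t`. -/
noncomputable def profile (q β t a : ℝ) : ℝ := t ^ q + max 0 (a - t ^ β) * slope q β t

/-! ### The sections of `G` at a fixed height as graphs over the `x`-axis. -/

section Profile

variable {q β t : ℝ}

theorem rpow_lt_self_of_lt_one (hβ : 1 < β) (ht : 0 < t) (ht1 : t < 1) : t ^ β < t := by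
  simpa using Real.rpow_lt_rpow_of_exponent_gt ht ht1 hβ

theorem rpow_q_lt_rpow_β (hq : β < q) (ht : 0 < t) (ht1 : t < 1) : t ^ q < t ^ β :=
  Real.rpow_lt_rpow_of_exponent_gt ht ht1 hq

theorem one_le_slope (hβ : 1 < β) (hq : β < q) (ht : 0 < t) (ht1 : t < 1) : 1 ≤ slope q β t := by
  have h1 := rpow_lt_self_of_lt_one hβ ht ht1
  have h2 := rpow_q_lt_rpow_β hq ht ht1
  rw [slope, le_div_iff₀ (by linarith)]
  linarith

theorem slope_mul (hβ : 1 < β) (ht : 0 < t) (ht1 : t < 1) :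
    (t - t ^ β) * slope q β t = t - t ^ q := by
  have h1 := rpow_lt_self_of_lt_one hβ ht ht1
  rw [slope, mul_div_cancel₀ _ (by linarith)]

theorem rpow_le_profile (hβ : 1 < β) (hq : β < q) (ht : 0 < t) (ht1 : t < 1) (a : ℝ) :
    t ^ q ≤ profile q β t a := by
  have := one_le_slope hβ hq ht ht1
  have : 0 ≤ max 0 (a - t ^ β) * slope q β t := mul_nonneg (le_max_left _ _) (by linarith)
  rw [profile]; linarith

theorem profile_pos (hβ : 1 < β) (hq : β < q) (ht : 0 < t) (ht1 : t < 1) (a : ℝ) :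
    0 < profile q β t a :=
  (Real.rpow_pos_of_pos ht q).trans_le (rpow_le_profile hβ hq ht ht1 a)

theorem profile_of_le {a : ℝ} (h : a ≤ t ^ β) : profile q β t a = t ^ q := by
  simp [profile, h]

theorem profile_of_ge {a : ℝ} (h : t ^ β ≤ a) :
    profile q β t a = t ^ q + (a - t ^ β) * slope q β t := by
  rw [profile, max_eq_right (by linarith)]

theorem profile_self (hβ : 1 < β) (ht : 0 < t) (ht1 : t < 1) : profile q β t t = t := by
  rw [profile_of_ge (rpow_lt_self_of_lt_one hβ ht ht1).le, slope_mul hβ ht ht1]; ring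

theorem profile_mono (hβ : 1 < β) (hq : β < q) (ht : 0 < t) (ht1 : t < 1) :
    Monotone (profile q β t) := by
  intro a b h
  have := one_le_slope hβ hq ht ht1
  unfold profile
  gcongr

theorem profile_le (hβ : 1 < β) (hq : β < q) (ht : 0 < t) (ht1 : t < 1) {a : ℝ} (ha : a ≤ t) :
    profile q β t a ≤ t :=
  (profile_mono hβ hq ht ht1 ha).trans_eq (profile_self hβ ht ht1)

theorem sub_le_profile (hβ : 1 < β) (hq : β < q) (ht : 0 < t) (ht1 : t < 1) (a : ℝ) :
    t ^ q + (a - t ^ β) ≤ profile q β t a := by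
  have := one_le_slope hβ hq ht ht1
  have h0 := le_max_left 0 (a - t ^ β)
  have h1 := le_max_right 0 (a - t ^ β)
  unfold profile
  nlinarith

/-- The parameter `s` of a wing is eliminated by `(t - t^β) * slope = t - t^q`. Height one is
excluded because the denominator of `slope` vanishes there. -/
theorem mem_G_iff (hβ : 1 < β) (hq : β < q) {v : R4} (h0 : 0 < v 3) (h1 : v 3 < 1) :
    v ∈ G q β ↔ v 2 = 0 ∧ |v 0| ≤ v 3 ∧ |v 1| = profile q β (v 3) |v 0| := by
  have hb := rpow_lt_self_of_lt_one hβ h0 h1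
  have hqb := rpow_q_lt_rpow_β hq h0 h1
  have hq0 := Real.rpow_pos_of_pos h0 q
  constructor
  · rintro (⟨-, -, hx, hx', hy, hz⟩ | ⟨-, -, hz, s, hs0, hs1, hx, hy⟩)
    · have hx : |v 0| ≤ v 3 ^ β := abs_le.2 ⟨hx, hx'⟩
      refine ⟨hz, by linarith, ?_⟩
      rw [profile_of_le hx]
      rcases hy with hy | hy <;> rw [hy] <;> simp [abs_of_pos hq0]
    · refine ⟨hz, by rw [hx]; nlinarith, ?_⟩
      rw [hy, profile_of_ge (by rw [hx]; nlinarith), hx]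
      have : ((1 - s) * v 3 ^ β + s * v 3 - v 3 ^ β) * slope q β (v 3)
          = s * ((v 3 - v 3 ^ β) * slope q β (v 3)) := by ring
      rw [this, slope_mul hβ h0 h1]; ring
  · rintro ⟨hz, hx, hy⟩
    rcases le_total |v 0| (v 3 ^ β) with h | h
    · left
      rw [profile_of_le h] at hy
      exact ⟨h0.le, h1.le, (abs_le.1 h).1, (abs_le.1 h).2, eq_or_eq_neg_of_abs_eq hy, hz⟩
    · right
      rw [profile_of_ge h] at hy
      have hd : v 3 - v 3 ^ β ≠ 0 := by linarith
      refine ⟨h0.le, h1.le, hz, (|v 0| - v 3 ^ β) / (v 3 - v 3 ^ β), ?_, ?_, ?_, ?_⟩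
      · apply div_nonneg <;> linarith
      · rw [div_le_one (by linarith)]; linarith
      · field_simp; ring
      · rw [hy, slope]; field_simp; ring

theorem zero_mem_G (hβ : 1 < β) (hq : β < q) : (0 : R4) ∈ G q β := by
  left
  simp [bridge, Real.zero_rpow (by linarith : β ≠ 0)]
  exact Or.inr (Real.zero_rpow (by linarith : q ≠ 0))

theorem mem_G_height_zero (hβ : 1 < β) (hq : β < q) {v : R4} (h : v ∈ G q β) (h3 : v 3 = 0) :
    v = 0 := by
  have e1 : (0:ℝ) ^ β = 0 := Real.zero_rpow (by linarith : β ≠ 0)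
  have e2 : (0:ℝ) ^ q = 0 := Real.zero_rpow (by linarith : q ≠ 0)
  rcases h with ⟨-, -, hx, hx', hy, hz⟩ | ⟨-, -, hz, s, hs0, hs1, hx, hy⟩
  · rw [h3] at hx hx' hy
    simp only [e1, e2, neg_zero, or_self] at hx hx' hy
    exact R4.ext (le_antisymm hx' hx) hy hz h3
  · rw [h3] at hx hy
    simp only [e1, e2, mul_zero, add_zero, abs_eq_zero] at hx hy
    exact R4.ext hx hy hz h3

theorem mem_G_height_nonneg {v : R4} (h : v ∈ G q β) : 0 ≤ v 3 := by
  rcases h with h | h <;> exact h.1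

theorem lift_mem_G_iff {p : R3} :
    lift p ∈ G q β ↔ |p 0| ≤ 1 ∧ |p 1| = 1 ∧ p 2 = 0 := by
  simp only [G, bridge, wings, mem_union, mem_ofPred_eq, lift_zero, lift_one, lift_two, lift_three,
    Real.one_rpow]
  constructor
  · rintro (⟨-, -, hx, hx', hy, hz⟩ | ⟨-, -, hz, s, hs0, hs1, hx, hy⟩)
    · refine ⟨abs_le.2 ⟨hx, hx'⟩, ?_, hz⟩
      rcases hy with hy | hy <;> simp [hy]
    · exact ⟨by linarith, by linarith, hz⟩
  · rintro ⟨hx, hy, hz⟩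
    exact Or.inl ⟨by norm_num, le_rfl, (abs_le.1 hx).1, (abs_le.1 hx).2,
      eq_or_eq_neg_of_abs_eq hy, hz⟩

end Profile

/-- The part of `surface q β K` below the height `1` (see `mem_surface_iff`), in a form which is
invariant under scaling away from `G`. -/
def Surf (q β : ℝ) (K : Set R3) : Set R4 :=
  {v | v = 0 ∨ 0 < v 3 ∧ (v ∈ G q β ∨ proj v ∈ K \ square)}

/-- `K` meets the square exactly in the two segments of `g`. -/
def Framed (K : Set R3) : Prop := ∀ p ∈ square, p ∈ K ↔ |p 1| = 1

/-- For a framed knot, deleting `g` is the same as deleting the square. The restriction to heights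
below one is harmless for germs. -/
theorem mem_surface_iff {q β : ℝ} (hβ : 1 < β) (hq : β < q) {K : Set R3} (hK : Framed K) {v : R4}
    (h1 : v 3 < 1) : v ∈ surface q β K ↔ v ∈ Surf q β K := by
  constructor
  · rintro (h | ⟨t, ht0, ht1, -, ⟨⟨p, hp, rfl⟩, hg⟩, rfl⟩)
    · rcases (mem_G_height_nonneg h).eq_or_lt with h0 | h0
      · exact Or.inl (mem_G_height_zero hβ hq h h0.symm)
      · exact Or.inr ⟨h0, Or.inl h⟩
    · rcases ht0.eq_or_lt with rfl | ht0
      · left; simp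
      · refine Or.inr ⟨by simpa using ht0, Or.inr ?_⟩
        rw [proj_smul ht0.ne', proj_lift]
        refine ⟨hp, fun hs => hg ⟨?_, rfl⟩⟩
        rw [lift_mem_G_iff]
        exact ⟨hs.1, (hK p hs).1 hp, hs.2.2⟩
  · rintro (rfl | ⟨h0, h | h⟩)
    · exact Or.inl (zero_mem_G hβ hq)
    · exact Or.inl h
    · refine Or.inr ⟨v 3, h0.le, h1.le, lift (proj v), ⟨⟨_, h.1, rfl⟩, fun hg => h.2 ?_⟩,
        (smul_lift_proj h0.ne').symm⟩
      have := lift_mem_G_iff.1 hg.1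
      exact ⟨this.1, this.2.1.le, this.2.2⟩

/-- The cone over the square. -/
def squareCone : Set R4 := {v | |v 0| ≤ v 3 ∧ |v 1| ≤ v 3 ∧ v 2 = 0}

theorem proj_mem_square_iff {v : R4} (h0 : 0 < v 3) : proj v ∈ square ↔ v ∈ squareCone := by
  simp only [square, squareCone, mem_ofPred_eq, proj_zero, proj_one, proj_two, abs_div,
    abs_of_pos h0, div_le_one h0, div_eq_zero_iff, h0.ne', or_false]

theorem G_subset_squareCone {q β : ℝ} (hβ : 1 < β) (hq : β < q) {v : R4} (h0 : 0 < v 3)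
    (h1 : v 3 < 1) (h : v ∈ G q β) : v ∈ squareCone := by
  rw [mem_G_iff hβ hq h0 h1] at h
  exact ⟨h.2.1, h.2.2.trans_le (profile_le hβ hq h0 h1 h.2.1), h.1⟩

/-! ### Descriptions of the model knots -/

theorem mem_segment_iff {a b p : R3} :
    p ∈ segment ℝ a b ↔ ∃ θ : ℝ, 0 ≤ θ ∧ θ ≤ 1 ∧ p 0 = a 0 + θ * (b 0 - a 0) ∧
      p 1 = a 1 + θ * (b 1 - a 1) ∧ p 2 = a 2 + θ * (b 2 - a 2) := by
  rw [segment_eq_image']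
  constructor
  · rintro ⟨θ, ⟨h0, h1⟩, rfl⟩
    exact ⟨θ, h0, h1, by simp, by simp, by simp⟩
  · rintro ⟨θ, h0, h1, hx, hy, hz⟩
    exact ⟨θ, ⟨h0, h1⟩, R3.ext (by simp [hx]) (by simp [hy]) (by simp [hz])⟩

theorem mem_closedPolygon_iff {n : ℕ} [NeZero n] {v : Fin n → R3} {p : R3} :
    p ∈ closedPolygon v ↔ ∃ (i : Fin n) (θ : ℝ), 0 ≤ θ ∧ θ ≤ 1 ∧
      p 0 = v i 0 + θ * (v (i + 1) 0 - v i 0) ∧ p 1 = v i 1 + θ * (v (i + 1) 1 - v i 1) ∧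
      p 2 = v i 2 + θ * (v (i + 1) 2 - v i 2) := by
  simp only [closedPolygon, mem_iUnion, mem_segment_iff]

theorem mem_modelK_iff {p : R3} :
    p ∈ modelK ↔ p 2 = 0 ∧ |p 0| ≤ 2 ∧ |p 1| = min 1 (2 - |p 0|) := by
  rw [modelK, mem_closedPolygon_iff]
  constructor
  · rintro ⟨i, θ, h0, h1, hx, hy, hz⟩
    fin_cases i <;> simp at hx hy hz <;> refine ⟨hz, ?_⟩ <;>
      rcases abs_cases (p 0) with ⟨e, _⟩ | ⟨e, _⟩ <;>
      rcases abs_cases (p 1) with ⟨e', _⟩ | ⟨e', _⟩ <;>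
      rw [e, e'] <;> rcases min_cases 1 (2 - |p 0|) with ⟨e'', _⟩ | ⟨e'', _⟩ <;> rw [e] at e'' <;>
      rw [e''] <;> constructor <;> linarith
  · rintro ⟨hz, hx, hy⟩
    rcases le_total |p 0| 1 with h | h
    · rw [min_eq_left (by linarith)] at hy
      have := abs_le.1 h
      rcases eq_or_eq_neg_of_abs_eq hy with hy | hy
      · refine ⟨0, (p 0 + 1) / 2, by linarith, by linarith, ?_, ?_, ?_⟩ <;> simp [hy, hz]
        ring
      · refine ⟨3, (1 - p 0) / 2, by linarith, by linarith, ?_, ?_, ?_⟩ <;> simp [hy, hz]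
        ring
    · rw [min_eq_right (by linarith)] at hy
      rcases abs_cases (p 0) with ⟨e, _⟩ | ⟨e, _⟩ <;> rw [e] at hy h hx <;>
        rcases eq_or_eq_neg_of_abs_eq hy with hy | hy
      · refine ⟨1, p 0 - 1, by linarith, by linarith, ?_, ?_, ?_⟩ <;> simp [hy, hz] <;> ring
      · refine ⟨2, 2 - p 0, by linarith, by linarith, ?_, ?_, ?_⟩ <;> simp [hy, hz] <;> ring
      · refine ⟨5, p 0 + 2, by linarith, by linarith, ?_, ?_, ?_⟩ <;> simp [hy, hz] <;> ring
      · refine ⟨4, -1 - p 0, by linarith, by linarith, ?_, ?_, ?_⟩ <;> simp [hy, hz] <;> ring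

/-- The radius of the outer arcs of the model knot `L`. -/
noncomputable def outer (y : ℝ) : ℝ := 1 + 2 / 3 * max 0 (min (1 - y) (y + 5))

/-- The union of the two segments of `g`, the two outer arcs of the model knot `L`, and two
inner arcs over `-5 ≤ y ≤ -1` with `(x, z) = ± (c y, s y)`. -/
def strands (c s : ℝ → ℝ) : Set R3 :=
  {p | p 2 = 0 ∧ |p 0| ≤ 1 ∧ |p 1| = 1} ∪ {p | p 2 = 0 ∧ -5 ≤ p 1 ∧ p 1 ≤ 1 ∧ |p 0| = outer (p 1)}
    ∪ {p | -5 ≤ p 1 ∧ p 1 ≤ -1 ∧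
        (p 0 = c (p 1) ∧ p 2 = s (p 1) ∨ p 0 = -c (p 1) ∧ p 2 = -s (p 1))}

/-- The `x`-coordinate of an inner strand of the model knot `L`. -/
noncomputable def strandX (y : ℝ) : ℝ := |y + 3| - 1
/-- The `z`-coordinate of an inner strand of the model knot `L`. -/
noncomputable def strandZ (y : ℝ) : ℝ := 1 - |y + 4| + 2 * max 0 (y + 2)

theorem outer_of_ge {y : ℝ} (h : -2 ≤ y) (h1 : y ≤ 1) : outer y = 1 + 2 / 3 * (1 - y) := by
  rw [outer, min_eq_left (by linarith), max_eq_right (by linarith)]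

theorem outer_of_le {y : ℝ} (h : y ≤ -2) (h1 : -5 ≤ y) : outer y = 1 + 2 / 3 * (y + 5) := by
  rw [outer, min_eq_right (by linarith), max_eq_right (by linarith)]

theorem strandX_of_le {y : ℝ} (h : y ≤ -3) : strandX y = -4 - y := by
  rw [strandX, abs_of_nonpos (by linarith)]; ring

theorem strandX_of_ge {y : ℝ} (h : -3 ≤ y) : strandX y = y + 2 := by
  rw [strandX, abs_of_nonneg (by linarith)]; ring

theorem strandZ_of_le {y : ℝ} (h : y ≤ -4) : strandZ y = y + 5 := by
  rw [strandZ, abs_of_nonpos (by linarith), max_eq_left (by linarith)]; ring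

theorem strandZ_of_mem {y : ℝ} (h : -4 ≤ y) (h' : y ≤ -2) : strandZ y = -3 - y := by
  rw [strandZ, abs_of_nonneg (by linarith), max_eq_left (by linarith)]; ring

theorem strandZ_of_ge {y : ℝ} (h : -2 ≤ y) : strandZ y = y + 1 := by
  rw [strandZ, abs_of_nonneg (by linarith), max_eq_right (by linarith)]; ring

theorem mem_modelL_of_mem_strands {p : R3} (hp : p ∈ strands strandX strandZ) : p ∈ modelL := by
  rw [modelL, mem_closedPolygon_iff]
  -- In each case the witnesses are the index of an edge and the affine parameter on it, read off
  -- from `x` on the two segments of `g` (edges `0` and `7`) and from `y` on all other edges.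
  rcases hp with (⟨hz, hx, hy⟩ | ⟨hz, hy, hy', hx⟩) | ⟨hy, hy', hp⟩
  · have := abs_le.1 hx
    rcases eq_or_eq_neg_of_abs_eq hy with hy | hy
    · refine ⟨0, (p 0 + 1) / 2, by linarith, by linarith, ?_, ?_, ?_⟩ <;> simp [hy, hz]
      ring
    · refine ⟨7, (1 - p 0) / 2, by linarith, by linarith, ?_, ?_, ?_⟩ <;> simp [hy, hz]
      ring
  · rcases le_total (p 1) (-2) with h | h
    · rw [outer_of_le h hy] at hx
      rcases eq_or_eq_neg_of_abs_eq hx with hx | hx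
      · refine ⟨2, (-2 - p 1) / 3, by linarith, by linarith, ?_, ?_, ?_⟩ <;> simp [hx, hz] <;> ring
      · refine ⟨12, (p 1 + 5) / 3, by linarith, by linarith, ?_, ?_, ?_⟩ <;> simp [hx, hz] <;> ring
    · rw [outer_of_ge h hy'] at hx
      rcases eq_or_eq_neg_of_abs_eq hx with hx | hx
      · refine ⟨1, (1 - p 1) / 3, by linarith, by linarith, ?_, ?_, ?_⟩ <;> simp [hx, hz] <;> ring
      · refine ⟨13, (p 1 + 2) / 3, by linarith, by linarith, ?_, ?_, ?_⟩ <;> simp [hx, hz] <;> ring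
  · rcases le_total (p 1) (-4) with h4 | h4
    · rw [strandX_of_le (by linarith), strandZ_of_le h4] at hp
      rcases hp with ⟨hx, hz⟩ | ⟨hx, hz⟩
      · refine ⟨3, p 1 + 5, by linarith, by linarith, ?_, ?_, ?_⟩ <;> simp [hx, hz] <;> ring
      · refine ⟨11, -4 - p 1, by linarith, by linarith, ?_, ?_, ?_⟩ <;> simp [hx, hz] <;> ring
    rcases le_total (p 1) (-3) with h3 | h3
    · rw [strandX_of_le h3, strandZ_of_mem h4 (by linarith)] at hp
      rcases hp with ⟨hx, hz⟩ | ⟨hx, hz⟩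
      · refine ⟨4, p 1 + 4, by linarith, by linarith, ?_, ?_, ?_⟩ <;> simp [hx, hz] <;> ring
      · refine ⟨10, -3 - p 1, by linarith, by linarith, ?_, ?_, ?_⟩ <;> simp [hx, hz] <;> ring
    rcases le_total (p 1) (-2) with h2 | h2
    · rw [strandX_of_ge h3, strandZ_of_mem h4 h2] at hp
      rcases hp with ⟨hx, hz⟩ | ⟨hx, hz⟩
      · refine ⟨5, p 1 + 3, by linarith, by linarith, ?_, ?_, ?_⟩ <;> simp [hx, hz] <;> ring
      · refine ⟨9, -2 - p 1, by linarith, by linarith, ?_, ?_, ?_⟩ <;> simp [hx, hz] <;> ring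
    · rw [strandX_of_ge h3, strandZ_of_ge h2] at hp
      rcases hp with ⟨hx, hz⟩ | ⟨hx, hz⟩
      · refine ⟨6, p 1 + 2, by linarith, by linarith, ?_, ?_, ?_⟩ <;> simp [hx, hz] <;> ring
      · refine ⟨8, -1 - p 1, by linarith, by linarith, ?_, ?_, ?_⟩ <;> simp [hx, hz] <;> ring

theorem mem_strands_of_mem_modelL {p : R3} (hp : p ∈ modelL) : p ∈ strands strandX strandZ := by
  rw [modelL, mem_closedPolygon_iff] at hp
  obtain ⟨i, θ, h0, h1, hx, hy, hz⟩ := hp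
  fin_cases i <;> simp at hx hy hz
  · exact Or.inl (Or.inl ⟨hz, abs_le.2 ⟨by linarith, by linarith⟩, by simp [hy]⟩)
  · refine Or.inl (Or.inr ⟨hz, by linarith, by linarith, ?_⟩)
    rw [outer_of_ge (by linarith) (by linarith), abs_of_nonneg (by linarith)]; linarith
  · refine Or.inl (Or.inr ⟨hz, by linarith, by linarith, ?_⟩)
    rw [outer_of_le (by linarith) (by linarith), abs_of_nonneg (by linarith)]; linarith
  · refine Or.inr ⟨by linarith, by linarith, Or.inl ⟨?_, ?_⟩⟩
    · rw [strandX_of_le (by linarith)]; linarith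
    · rw [strandZ_of_le (by linarith)]; linarith
  · refine Or.inr ⟨by linarith, by linarith, Or.inl ⟨?_, ?_⟩⟩
    · rw [strandX_of_le (by linarith)]; linarith
    · rw [strandZ_of_mem (by linarith) (by linarith)]; linarith
  · refine Or.inr ⟨by linarith, by linarith, Or.inl ⟨?_, ?_⟩⟩
    · rw [strandX_of_ge (by linarith)]; linarith
    · rw [strandZ_of_mem (by linarith) (by linarith)]; linarith
  · refine Or.inr ⟨by linarith, by linarith, Or.inl ⟨?_, ?_⟩⟩
    · rw [strandX_of_ge (by linarith)]; linarith
    · rw [strandZ_of_ge (by linarith)]; linarith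
  · exact Or.inl (Or.inl ⟨hz, abs_le.2 ⟨by linarith, by linarith⟩, by simp [hy]⟩)
  · refine Or.inr ⟨by linarith, by linarith, Or.inr ⟨?_, ?_⟩⟩
    · rw [strandX_of_ge (by linarith)]; linarith
    · rw [strandZ_of_ge (by linarith)]; linarith
  · refine Or.inr ⟨by linarith, by linarith, Or.inr ⟨?_, ?_⟩⟩
    · rw [strandX_of_ge (by linarith)]; linarith
    · rw [strandZ_of_mem (by linarith) (by linarith)]; linarith
  · refine Or.inr ⟨by linarith, by linarith, Or.inr ⟨?_, ?_⟩⟩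
    · rw [strandX_of_le (by linarith)]; linarith
    · rw [strandZ_of_mem (by linarith) (by linarith)]; linarith
  · refine Or.inr ⟨by linarith, by linarith, Or.inr ⟨?_, ?_⟩⟩
    · rw [strandX_of_le (by linarith)]; linarith
    · rw [strandZ_of_le (by linarith)]; linarith
  · refine Or.inl (Or.inr ⟨hz, by linarith, by linarith, ?_⟩)
    rw [outer_of_le (by linarith) (by linarith), abs_of_nonpos (by linarith)]; linarith
  · refine Or.inl (Or.inr ⟨hz, by linarith, by linarith, ?_⟩)
    rw [outer_of_ge (by linarith) (by linarith), abs_of_nonpos (by linarith)]; linarith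

theorem modelL_eq : modelL = strands strandX strandZ :=
  Set.ext fun _ => ⟨mem_strands_of_mem_modelL, mem_modelL_of_mem_strands⟩

theorem framed_modelK : Framed modelK := by
  intro p hp
  rw [mem_modelK_iff, min_eq_left (by linarith [hp.1])]
  exact ⟨fun h => h.2.2, fun h => ⟨hp.2.2, by linarith [hp.1], h⟩⟩

theorem one_le_outer (y : ℝ) : 1 ≤ outer y := by
  rw [outer]; linarith [le_max_left 0 (min (1 - y) (y + 5))]

theorem outer_le (y : ℝ) : outer y ≤ 3 := by
  have : min (1 - y) (y + 5) ≤ 3 := by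
    rcases le_total y (-2) with h | h
    · exact (min_le_right _ _).trans (by linarith)
    · exact (min_le_left _ _).trans (by linarith)
  rw [outer]; linarith [max_le (by norm_num : (0:ℝ) ≤ 3) this]

/-- No condition on `c` and `s` is needed: an inner strand lies over `y ≤ -1`, so it can enter the
square only at `y = -1`, where `|y| = 1` anyway. An outer arc has `|x| = 1` for `y ≥ -1` only at `y
= 1`. -/
theorem framed_strands {c s : ℝ → ℝ} : Framed (strands c s) := by
  intro p hp
  constructor
  · rintro ((h | ⟨hz, hy, hy', hx⟩) | ⟨hy, hy', h⟩)
    · exact h.2.2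
    · have h1 := abs_le.1 hp.2.1
      have := outer_of_ge (y := p 1) (by linarith) hy'
      have h3 : p 1 = 1 := by linarith [hp.1]
      simp [h3]
    · have h1 := abs_le.1 hp.2.1
      have h3 : p 1 = -1 := by linarith
      simp [h3]
  · intro h
    exact Or.inl (Or.inl ⟨hp.2.2, hp.1, h⟩)

/-- By injectivity, a map which fixes the square pointwise sends no outside point into it. -/
theorem IsDeformation.framed {K₀ K : Set R3} (h : IsDeformation K₀ K) (h₀ : Framed K₀) :
    Framed K := by
  obtain ⟨Φ, C, C', R, -, -, hs, -, rfl⟩ := h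
  intro p hp
  rw [← h₀ p hp]
  constructor
  · rintro ⟨p', hp', he⟩
    have : p' = p := Φ.injective (he.trans (hs p hp).symm)
    rwa [← this]
  · exact fun h => ⟨p, h, hs p hp⟩

/-! ### Maps of cones -/

/-- The extension of a map of `{t = 1}` to the half space `t > 0` which is homogeneous of degree
one. -/
noncomputable def coneMap (J : R3 → R3) (v : R4) : R4 :=
  if 0 < v 3 then v 3 • lift (J (proj v)) else v

theorem coneMap_of_pos {J : R3 → R3} {v : R4} (h : 0 < v 3) :
    coneMap J v = v 3 • lift (J (proj v)) := if_pos h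

theorem coneMap_of_nonpos {J : R3 → R3} {v : R4} (h : v 3 ≤ 0) : coneMap J v = v :=
  if_neg h.not_gt

@[simp] theorem coneMap_zero (J : R3 → R3) : coneMap J 0 = 0 := coneMap_of_nonpos (by simp)

@[simp] theorem coneMap_three (J : R3 → R3) (v : R4) : coneMap J v 3 = v 3 := by
  rcases lt_or_ge 0 (v 3) with h | h
  · simp [coneMap_of_pos h]
  · rw [coneMap_of_nonpos h]

theorem proj_coneMap {J : R3 → R3} {v : R4} (h : 0 < v 3) : proj (coneMap J v) = J (proj v) := by
  rw [coneMap_of_pos h, proj_smul h.ne', proj_lift]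

theorem coneMap_coneMap {J J' : R3 → R3} {v : R4} (h : 0 < v 3 → J' (J (proj v)) = proj v) :
    coneMap J' (coneMap J v) = v := by
  rcases lt_or_ge 0 (v 3) with h0 | h0
  · rw [coneMap_of_pos (by simpa using h0), proj_coneMap h0, h h0, coneMap_three,
      smul_lift_proj h0.ne']
  · rw [coneMap_of_nonpos h0, coneMap_of_nonpos h0]

theorem coneMap_eq_self {J : R3 → R3} {v : R4} (h : 0 < v 3 → J (proj v) = proj v) :
    coneMap J v = v := by
  rcases lt_or_ge 0 (v 3) with h0 | h0
  · rw [coneMap_of_pos h0, h h0, smul_lift_proj h0.ne']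
  · rw [coneMap_of_nonpos h0]

theorem dist_lift (p p' : R3) : dist (lift p) (lift p') = dist p p' := by
  simp [EuclideanSpace.dist_eq, Fin.sum_univ_four, Fin.sum_univ_three]

theorem norm_lift_le (p : R3) : ‖lift p‖ ≤ ‖p‖ + 1 := by
  have h : ‖lift 0‖ = 1 := by simp [EuclideanSpace.norm_eq, Fin.sum_univ_four]
  have := dist_lift p 0
  rw [dist_eq_norm, dist_zero_right] at this
  linarith [norm_le_norm_sub_add (lift p) (lift 0)]

theorem abs_height_sub_le (v w : R4) : |v 3 - w 3| ≤ dist v w := by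
  rw [dist_eq_norm]; simpa using abs_coord_le (v - w) 3

/-- Slide `v` along its ray to the height of `w`. This costs `|v 3 - w 3| * ‖lift (proj v)‖`, and at
equal heights the projection is a similarity. -/
theorem height_mul_dist_proj_le {v w : R4} (hv : 0 < v 3) (hw : 0 < w 3) :
    w 3 * dist (proj v) (proj w) ≤ (‖proj v‖ + 2) * dist v w := by
  have ht := abs_height_sub_le v w
  have h1 := smul_lift_proj hv.ne'
  have h2 := smul_lift_proj hw.ne'
  have h3 : v - w = v 3 • lift (proj v) - w := by rw [h1]
  have e : w 3 • (lift (proj v) - lift (proj w)) = (w 3 - v 3) • lift (proj v) + (v - w) := by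
    rw [smul_sub, h2, h3]
    module
  calc w 3 * dist (proj v) (proj w) = ‖w 3 • (lift (proj v) - lift (proj w))‖ := by
        rw [norm_smul, Real.norm_of_nonneg hw.le, ← dist_eq_norm, dist_lift]
    _ ≤ ‖(w 3 - v 3) • lift (proj v)‖ + ‖v - w‖ := by rw [e]; exact norm_add_le _ _
    _ ≤ dist v w * (‖proj v‖ + 1) + dist v w := by
        rw [norm_smul, Real.norm_eq_abs, abs_sub_comm, ← dist_eq_norm]
        gcongr
        exact norm_lift_le _
    _ = _ := by ring

/-- The homogeneous extension of a Lipschitz map of a bounded set is Lipschitz. -/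
theorem dist_coneMap_le {J : R3 → R3} {S : Set R3} {C : ℝ≥0} {R : ℝ} (hR : 0 ≤ R)
    (hJ : LipschitzOnWith C J S) (hS : ∀ p ∈ S, ‖p‖ ≤ R) (hJS : ∀ p ∈ S, ‖J p‖ ≤ R) {v w : R4}
    (hv : v = 0 ∨ 0 < v 3 ∧ proj v ∈ S) (hw : w = 0 ∨ 0 < w 3 ∧ proj w ∈ S) :
    dist (coneMap J v) (coneMap J w) ≤ ((R + 1) + C * (R + 2)) * dist v w := by
  -- Comparison with the vertex, where the central projection is of no use, needs a separate
  -- estimate.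
  have key : ∀ v : R4, 0 < v 3 ∧ proj v ∈ S →
      ‖coneMap J v‖ ≤ ((R + 1) + C * (R + 2)) * ‖v‖ := by
    intro v ⟨h0, h⟩
    rw [coneMap_of_pos h0, norm_smul, Real.norm_of_nonneg h0.le]
    have h1 := abs_coord_le v 3
    rw [abs_of_pos h0] at h1
    have h2 := (norm_lift_le (J (proj v))).trans (add_le_add_left (hJS _ h) 1)
    have h3 : 0 ≤ C * (R + 2) := by positivity
    calc v 3 * ‖lift (J (proj v))‖ ≤ ‖v‖ * (R + 1) := by gcongr
      _ ≤ _ := by nlinarith [norm_nonneg v]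
  rcases hv with rfl | hv <;> rcases hw with rfl | hw
  · simp
  · simpa using key w hw
  · simpa using key v hv
  obtain ⟨hv0, hv⟩ := hv
  obtain ⟨hw0, hw⟩ := hw
  have ht := abs_height_sub_le v w
  set p := proj v
  set p' := proj w
  have e1 : coneMap J v - coneMap J w =
      (v 3 - w 3) • lift (J p) + w 3 • (lift (J p) - lift (J p')) := by
    rw [coneMap_of_pos hv0, coneMap_of_pos hw0]; module
  have h3 : w 3 * dist p p' ≤ (R + 2) * dist v w :=
    (height_mul_dist_proj_le hv0 hw0).trans (by gcongr; exact hS p hv)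
  rw [dist_eq_norm, e1]
  calc _ ≤ ‖(v 3 - w 3) • lift (J p)‖ + ‖w 3 • (lift (J p) - lift (J p'))‖ := norm_add_le _ _
    _ ≤ dist v w * (R + 1) + w 3 * (C * dist p p') := by
      rw [norm_smul, norm_smul, Real.norm_eq_abs, Real.norm_of_nonneg hw0.le, ← dist_eq_norm,
        dist_lift]
      gcongr
      · exact (norm_lift_le _).trans (by linarith [hJS p hv])
      · exact hJ.dist_le_mul _ hv _ hw
    _ = (R + 1) * dist v w + C * (w 3 * dist p p') := by ring
    _ ≤ (R + 1) * dist v w + C * ((R + 2) * dist v w) := by gcongr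
    _ = _ := by ring

/-! ### Outer equivalence of framed knots -/

/-- `J` is a bi-Lipschitz map from `K ∪ square` to `K' ∪ square` with inverse `J'`, which fixes the
square. -/
structure OuterPair (K K' : Set R3) (J J' : R3 → R3) (C : ℝ≥0) (R : ℝ) : Prop where
  lip : LipschitzOnWith C J (K ∪ square)
  lip' : LipschitzOnWith C J' (K' ∪ square)
  maps : MapsTo J (K ∪ square) (K' ∪ square)
  maps' : MapsTo J' (K' ∪ square) (K ∪ square)
  left_inv : ∀ p ∈ K ∪ square, J' (J p) = p
  right_inv : ∀ p ∈ K' ∪ square, J (J' p) = p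
  fix : ∀ p ∈ square, J p = p
  bdd : ∀ p ∈ K ∪ square, ‖p‖ ≤ R
  bdd' : ∀ p ∈ K' ∪ square, ‖p‖ ≤ R

namespace OuterPair

variable {K K' K'' : Set R3} {J J' I I' : R3 → R3} {C D : ℝ≥0} {R R' : ℝ}

theorem fix' (h : OuterPair K K' J J' C R) : ∀ p ∈ square, J' p = p := fun p hp => by
  conv_lhs => rw [← h.fix p hp]
  exact h.left_inv p (Or.inr hp)

theorem symm (h : OuterPair K K' J J' C R) : OuterPair K' K J' J C R :=
  ⟨h.lip', h.lip, h.maps', h.maps, h.right_inv, h.left_inv, h.fix', h.bdd', h.bdd⟩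

theorem trans (h : OuterPair K K' J J' C R) (h' : OuterPair K' K'' I I' D R') :
    OuterPair K K'' (I ∘ J) (J' ∘ I') (D * C) (max R R') where
  lip := h'.lip.comp h.lip h.maps
  lip' := by rw [mul_comm]; exact h.lip'.comp h'.lip' h'.maps'
  maps := h'.maps.comp h.maps
  maps' := h.maps'.comp h'.maps'
  left_inv p hp := by simp [h'.left_inv _ (h.maps hp), h.left_inv _ hp]
  right_inv p hp := by simp [h.right_inv _ (h'.maps' hp), h'.right_inv _ hp]
  fix p hp := by simp [h.fix p hp, h'.fix p hp]
  bdd p hp := (h.bdd p hp).trans (le_max_left _ _)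
  bdd' p hp := (h'.bdd' p hp).trans (le_max_right _ _)

theorem nonneg (h : OuterPair K K' J J' C R) : 0 ≤ R :=
  (norm_nonneg _).trans (h.bdd 0 (Or.inr (by simp [square])))

/-- If `J p` were in the square, then `J'` would fix it, and `p = J' (J p)` would be in the square
as well. -/
theorem maps_diff (h : OuterPair K K' J J' C R) : MapsTo J (K \ square) (K' \ square) := by
  intro p hp
  have h1 : J p ∉ square := fun hs => hp.2 <| by
    have := h.fix' _ hs
    rw [h.left_inv p (Or.inl hp.1)] at this
    rwa [← this] at hs
  exact ⟨(h.maps (Or.inl hp.1)).resolve_right h1, h1⟩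

end OuterPair

section Cone

variable {q β : ℝ} {K K' : Set R3} {J J' : R3 → R3} {C : ℝ≥0} {R : ℝ}

theorem proj_mem_of_mem_Surf (hβ : 1 < β) (hq : β < q) {v : R4} (hv : v ∈ Surf q β K)
    (h1 : v 3 < 1) : v = 0 ∨ 0 < v 3 ∧ proj v ∈ K ∪ square := by
  rcases hv with h | ⟨h0, h | h⟩
  · exact Or.inl h
  · exact Or.inr ⟨h0, Or.inr ((proj_mem_square_iff h0).2 (G_subset_squareCone hβ hq h0 h1 h))⟩
  · exact Or.inr ⟨h0, Or.inl h.1⟩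

theorem coneMap_of_mem_squareCone (hJ : ∀ p ∈ square, J p = p) {v : R4} (hv : v ∈ squareCone) :
    coneMap J v = v :=
  coneMap_eq_self fun h0 => hJ _ ((proj_mem_square_iff h0).2 hv)

/-- `G` is not invariant under scaling, so a homogeneous map can preserve it only by fixing it: this
is why `J` has to be the identity on the whole square and not just on `g`. -/
theorem coneMap_mem_Surf (hβ : 1 < β) (hq : β < q) (hJ : ∀ p ∈ square, J p = p)
    (hm : MapsTo J (K \ square) (K' \ square)) {v : R4} (hv : v ∈ Surf q β K) (h1 : v 3 < 1) :
    coneMap J v ∈ Surf q β K' := by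
  rcases hv with rfl | ⟨h0, h | h⟩
  · simp [Surf]
  · rw [coneMap_of_mem_squareCone hJ (G_subset_squareCone hβ hq h0 h1 h)]
    exact Or.inr ⟨h0, Or.inl h⟩
  · refine Or.inr ⟨by simpa using h0, Or.inr ?_⟩
    rw [proj_coneMap h0]
    exact hm h

theorem OuterPair.coneMap_coneMap (h : OuterPair K K' J J' C R) (hβ : 1 < β) (hq : β < q) {v : R4}
    (hv : v ∈ Surf q β K) (h1 : v 3 < 1) : coneMap J' (coneMap J v) = v := by
  rcases proj_mem_of_mem_Surf hβ hq hv h1 with rfl | hv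
  · simp
  · exact SurfaceGerm.coneMap_coneMap fun _ => h.left_inv _ hv.2

theorem OuterPair.dist_coneMap_le (h : OuterPair K K' J J' C R) (hβ : 1 < β) (hq : β < q)
    {v w : R4} (hv : v ∈ Surf q β K) (h1 : v 3 < 1) (hw : w ∈ Surf q β K) (h1' : w 3 < 1) :
    dist (coneMap J v) (coneMap J w) ≤ ((R + 1) + C * (R + 2)) * dist v w :=
  SurfaceGerm.dist_coneMap_le h.nonneg h.lip h.bdd (fun p hp => h.bdd' _ (h.maps hp))
    (proj_mem_of_mem_Surf hβ hq hv h1) (proj_mem_of_mem_Surf hβ hq hw h1')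

theorem OuterPair.outerLipschitzEquivalent (h : OuterPair K K' J J' C R) (hβ : 1 < β) (hq : β < q)
    (hK : Framed K) (hK' : Framed K') :
    OuterLipschitzEquivalent (surface q β K) (surface q β K') := by
  have hR := h.nonneg
  have hopen : IsOpen {v : R4 | v 3 < 1} := isOpen_lt (by fun_prop) continuous_const
  have e : ∀ {K : Set R3}, Framed K → ∀ {v : R4}, v ∈ surface q β K ∩ {v | v 3 < 1} ↔
      v ∈ Surf q β K ∧ v 3 < 1 := fun hK v =>
    and_congr_left fun h => mem_surface_iff hβ hq hK h
  have hC : 0 < (R + 1) + C * (R + 2) := by positivity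
  refine ⟨coneMap J, {v | v 3 < 1}, {v | v 3 < 1}, (R + 1) + C * (R + 2), hopen, hopen, by simp,
    by simp, hC, by simp, ⟨?_, ?_, ?_⟩, ?_⟩
  · intro v hv
    rw [e hK] at hv
    rw [e hK', coneMap_three]
    exact ⟨coneMap_mem_Surf hβ hq h.fix h.maps_diff hv.1 hv.2, hv.2⟩
  · intro v hv w hw he
    rw [e hK] at hv hw
    rw [← h.coneMap_coneMap hβ hq hv.1 hv.2, he, h.coneMap_coneMap hβ hq hw.1 hw.2]
  · intro v hv
    rw [e hK'] at hv
    refine ⟨coneMap J' v, ?_, h.symm.coneMap_coneMap hβ hq hv.1 hv.2⟩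
    rw [e hK, coneMap_three]
    exact ⟨coneMap_mem_Surf hβ hq h.fix' h.symm.maps_diff hv.1 hv.2, hv.2⟩
  · intro v hv w hw
    rw [e hK] at hv hw
    refine ⟨?_, h.dist_coneMap_le hβ hq hv.1 hv.2 hw.1 hw.2⟩
    -- The lower bound is the Lipschitz bound for the inverse cone map, which has the same
    -- constants.
    rw [inv_mul_le_iff₀ hC]
    have := h.symm.dist_coneMap_le hβ hq (coneMap_mem_Surf hβ hq h.fix h.maps_diff hv.1 hv.2)
      (by simpa using hv.2) (coneMap_mem_Surf hβ hq h.fix h.maps_diff hw.1 hw.2)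
        (by simpa using hw.2)
    rwa [h.coneMap_coneMap hβ hq hv.1 hv.2, h.coneMap_coneMap hβ hq hw.1 hw.2] at this

/-- A deformation of a bounded framed knot is outer equivalent to it. -/
theorem IsDeformation.outerPair {K₀ K : Set R3} (h : IsDeformation K₀ K)
    (hb : ∃ R, ∀ p ∈ K₀, ‖p‖ ≤ R) : ∃ J J' C R, OuterPair K₀ K J J' C R := by
  obtain ⟨Φ, C, C', R, hC, hC', hs, -, rfl⟩ := h
  obtain ⟨R₀, hR₀⟩ := hb
  have hsq : ∀ p ∈ square, ‖p‖ ≤ 2 := fun p hp =>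
    (norm_le_sum3 p).trans (by rw [hp.2.2]; simp; linarith [hp.1, hp.2.1])
  have hb0 : ∀ p ∈ K₀ ∪ square, ‖p‖ ≤ max R₀ 2 := fun p hp => hp.elim
    (fun h => (hR₀ p h).trans (le_max_left _ _)) fun h => (hsq p h).trans (le_max_right _ _)
  have hm : MapsTo Φ (K₀ ∪ square) (Φ '' K₀ ∪ square) := fun p hp => hp.elim
    (fun h => Or.inl ⟨p, h, rfl⟩) fun h => Or.inr (by rwa [hs p h])
  have hm' : MapsTo Φ.symm (Φ '' K₀ ∪ square) (K₀ ∪ square) := by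
    rintro _ (⟨p, hp, rfl⟩ | hp)
    · exact Or.inl (by simpa using hp)
    · right
      rwa [← hs _ hp, Φ.symm_apply_apply]
  refine ⟨Φ, Φ.symm, max C C', max R₀ 2 + (C * (max R₀ 2) + ‖Φ 0‖),
    ⟨(hC.weaken (le_max_left _ _)).lipschitzOnWith, (hC'.weaken (le_max_right _ _)).lipschitzOnWith,
    hm, hm', fun p _ => Φ.symm_apply_apply p, fun p _ => Φ.apply_symm_apply p, hs, ?_, ?_⟩⟩
  · intro p hp
    have : 0 ≤ C * (max R₀ 2) + ‖Φ 0‖ := by positivity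
    linarith [hb0 p hp]
  · intro p hp
    have h1 := hb0 _ (hm' hp)
    have h2 := hC.dist_le_mul (Φ.symm p) 0
    rw [Φ.apply_symm_apply, dist_zero_right, dist_eq_norm] at h2
    have h3 : (C:ℝ) * ‖Φ.symm p‖ ≤ C * max R₀ 2 := by gcongr
    have h4 := norm_le_norm_sub_add p (Φ 0)
    have h5 : 0 ≤ max R₀ 2 := by positivity
    linarith

end Cone

/-! ### The outer equivalence of the model knots -/

/-- `f` is Lipschitz between `A` and `B` with respect to the distance pulled back by `g`. -/
def LipBetween (f g : R3 → R3) (A B : Set R3) : Prop :=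
  ∃ C : ℝ, 0 ≤ C ∧ ∀ p ∈ A, ∀ p' ∈ B, dist (f p) (f p') ≤ C * dist (g p) (g p')

namespace LipBetween

variable {f g : R3 → R3} {A B A' : Set R3}

theorem symm (h : LipBetween f g A B) : LipBetween f g B A := by
  obtain ⟨C, h0, h⟩ := h
  exact ⟨C, h0, fun p hp p' hp' => by rw [dist_comm, dist_comm (g p)]; exact h _ hp' _ hp⟩

theorem union_left (h : LipBetween f g A B) (h' : LipBetween f g A' B) :
    LipBetween f g (A ∪ A') B := by
  obtain ⟨C, h0, h⟩ := h
  obtain ⟨C', h0', h'⟩ := h'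
  refine ⟨max C C', le_max_of_le_left h0, ?_⟩
  rintro p (hp | hp) p' hp'
  · exact (h p hp p' hp').trans (by gcongr; exact le_max_left _ _)
  · exact (h' p hp p' hp').trans (by gcongr; exact le_max_right _ _)

theorem union_right (h : LipBetween f g B A) (h' : LipBetween f g B A') :
    LipBetween f g B (A ∪ A') :=
  (h.symm.union_left h'.symm).symm

theorem union (hA : LipBetween f g A A) (hB : LipBetween f g B B) (h : LipBetween f g A B) :
    LipBetween f g (A ∪ B) (A ∪ B) :=
  (hA.union_right h).union_left (h.symm.union_right hB)

/-- Two pieces are in good relative position if close points are close to a common point. -/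
theorem of_hub (hA : LipBetween f g A A) (hB : LipBetween f g B B) {M δ D : ℝ}
    (hM : ∀ p, p ∈ A ∨ p ∈ B → ‖f p‖ ≤ M) (hδ : 0 < δ)
    (h : ∀ a ∈ A, ∀ b ∈ B, δ ≤ dist (g a) (g b) ∨
      ∃ c, c ∈ A ∧ c ∈ B ∧ dist (g a) (g c) ≤ D * dist (g a) (g b)) :
    LipBetween f g A B := by
  obtain ⟨C, h0, hA⟩ := hA
  obtain ⟨C', h0', hB⟩ := hB
  -- Pairs at distance at least `δ` are controlled by the bound `M` alone; the other pairs are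
  -- compared through the common point `c`.
  refine ⟨max (2 * |M| / δ) (C * D + C' * (D + 1)), le_max_of_le_left (by positivity),
      fun a ha b hb => ?_⟩
  rcases h a ha b hb with h | ⟨c, hc, hc', h⟩
  · calc dist (f a) (f b) ≤ ‖f a‖ + ‖f b‖ := dist_le_norm_add_norm _ _
      _ ≤ |M| + |M| := add_le_add ((hM a (Or.inl ha)).trans (le_abs_self _))
        ((hM b (Or.inr hb)).trans (le_abs_self _))
      _ = 2 * |M| / δ * δ := by field_simp; ring
      _ ≤ 2 * |M| / δ * dist (g a) (g b) := by gcongr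
      _ ≤ _ := by gcongr; exact le_max_left _ _
  · have h1 := hA a ha c hc
    have h2 := hB c hc' b hb
    have h3 : dist (g c) (g b) ≤ (D + 1) * dist (g a) (g b) := by
      linarith [dist_triangle (g c) (g a) (g b), dist_comm (g a) (g c)]
    calc dist (f a) (f b) ≤ dist (f a) (f c) + dist (f c) (f b) := dist_triangle _ _ _
      _ ≤ C * (D * dist (g a) (g b)) + C' * ((D + 1) * dist (g a) (g b)) := by
        refine add_le_add (h1.trans ?_) (h2.trans ?_) <;> gcongr
      _ = (C * D + C' * (D + 1)) * dist (g a) (g b) := by ring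
      _ ≤ _ := by gcongr; exact le_max_right _ _

end LipBetween

@[simp] theorem vec3_zero (a b c : ℝ) : (!₂[a, b, c] : R3) 0 = a := rfl
@[simp] theorem vec3_one (a b c : ℝ) : (!₂[a, b, c] : R3) 1 = b := rfl
@[simp] theorem vec3_two (a b c : ℝ) : (!₂[a, b, c] : R3) 2 = c := rfl

theorem dist_le_sum3 (p p' : R3) : dist p p' ≤ |p 0 - p' 0| + |p 1 - p' 1| + |p 2 - p' 2| := by
  rw [dist_eq_norm]; simpa using norm_le_sum3 (p - p')

theorem dist_vec3_le (a b c a' b' c' : ℝ) :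
    dist (!₂[a, b, c] : R3) !₂[a', b', c'] ≤ |a - a'| + |b - b'| + |c - c'| :=
  dist_le_sum3 _ _

theorem abs_sub_coord_le {n : ℕ} (p p' : EuclideanSpace ℝ (Fin n)) (i : Fin n) :
    |p i - p' i| ≤ dist p p' := by
  rw [dist_eq_norm]; simpa using abs_coord_le (p - p') i

theorem LipBetween.mono {f g : R3 → R3} {A A' : Set R3} (h : LipBetween f g A A) (hs : A' ⊆ A) :
    LipBetween f g A' A' := by
  obtain ⟨C, h0, h⟩ := h
  exact ⟨C, h0, fun p hp p' hp' => h p (hs hp) p' (hs hp')⟩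

theorem abs_max_sub_le (a b c : ℝ) : |max c a - max c b| ≤ |a - b| := by
  simpa [abs_nonneg] using abs_max_sub_max_le_max c a c b

theorem abs_min_sub_le (a b c : ℝ) : |min c a - min c b| ≤ |a - b| := by
  simpa [abs_nonneg] using abs_min_sub_min_le_max c a c b

theorem abs_outer_sub_le (a b : ℝ) : |outer a - outer b| ≤ |a - b| := by
  have h1 := abs_max_sub_le (min (1 - a) (a + 5)) (min (1 - b) (b + 5)) 0
  have h2 := abs_min_sub_min_le_max (1 - a) (a + 5) (1 - b) (b + 5)
  rw [show 1 - a - (1 - b) = -(a - b) by ring, show a + 5 - (b + 5) = a - b by ring, abs_neg,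
    max_self] at h2
  rw [outer, outer, show ∀ u v : ℝ, 1 + 2 / 3 * u - (1 + 2 / 3 * v) = 2 / 3 * (u - v) by
    intros; ring, abs_mul, abs_of_pos (by norm_num : (0:ℝ) < 2 / 3)]
  linarith [abs_nonneg (a - b)]

theorem abs_strandX_sub_le (a b : ℝ) : |strandX a - strandX b| ≤ |a - b| := by
  have h := abs_abs_sub_abs_le (a + 3) (b + 3)
  rw [strandX, strandX]
  rwa [show a + 3 - (b + 3) = a - b by ring, show |a + 3| - |b + 3| = |a + 3| - 1 - (|b + 3| - 1)
    by ring] at h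

theorem abs_strandZ_sub_le (a b : ℝ) : |strandZ a - strandZ b| ≤ 3 * |a - b| := by
  have h := abs_abs_sub_abs_le (b + 4) (a + 4)
  have h' := abs_max_sub_le (a + 2) (b + 2) 0
  rw [show b + 4 - (a + 4) = -(a - b) by ring, abs_neg] at h
  rw [show a + 2 - (b + 2) = a - b by ring] at h'
  rw [strandZ, strandZ, abs_le]
  constructor <;> linarith [abs_le.1 h, abs_le.1 h']

/-- The arc of the model knot `K` on the side of the sign `ε`, parametrized by `y`. -/
noncomputable def kArc (ε y : ℝ) : R3 := !₂[ε * (2 - |y|), y, 0]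

/-- The arc of the model knot `L` on the side of the sign `ε`: the outer arc over `0 ≤ y ≤ 1` and
the inner arc over `-1 ≤ y ≤ 0`. -/
noncomputable def lArc (ε y : ℝ) : R3 :=
  !₂[ε * (outer (6 * max 0 y - 5) + strandX (-5 - 4 * min 0 y) - 1),
    6 * max 0 y - 5 - 4 * min 0 y, ε * strandZ (-5 - 4 * min 0 y)]

theorem lArc_of_nonneg {ε y : ℝ} (h : 0 ≤ y) :
    lArc ε y = !₂[ε * outer (6 * y - 5), 6 * y - 5, 0] := by
  rw [lArc, max_eq_right h, min_eq_left h, strandX_of_le (by linarith), strandZ_of_le (by linarith)]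
  refine R3.ext ?_ ?_ ?_ <;> simp <;> ring_nf <;> simp

theorem lArc_of_nonpos {ε y : ℝ} (h : y ≤ 0) :
    lArc ε y = !₂[ε * strandX (-5 - 4 * y), -5 - 4 * y, ε * strandZ (-5 - 4 * y)] := by
  rw [lArc, max_eq_left h, min_eq_right h, outer_of_le (by linarith) (by linarith)]
  apply R3.ext <;> simp

/-- The three coordinates contribute `10`, `10` and `12`. -/
theorem dist_lArc_le {ε : ℝ} (hε : |ε| = 1) (y y' : ℝ) :
    dist (lArc ε y) (lArc ε y') ≤ 32 * |y - y'| := by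
  have h1 := abs_max_sub_le y y' 0
  have h2 := abs_min_sub_le y y' 0
  have e1 : |6 * max 0 y - 5 - (6 * max 0 y' - 5)| ≤ 6 * |y - y'| := by
    rw [show 6 * max 0 y - 5 - (6 * max 0 y' - 5) = 6 * (max 0 y - max 0 y') by ring, abs_mul]
    norm_num; linarith
  have e2 : |-5 - 4 * min 0 y - (-5 - 4 * min 0 y')| ≤ 4 * |y - y'| := by
    rw [show -5 - 4 * min 0 y - (-5 - 4 * min 0 y') = -4 * (min 0 y - min 0 y') by ring, abs_mul]
    norm_num; linarith
  have h3 := abs_le.1 ((abs_outer_sub_le _ _).trans e1)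
  have h4 := abs_le.1 ((abs_strandX_sub_le _ _).trans e2)
  have h5 := (abs_strandZ_sub_le (-5 - 4 * min 0 y) (-5 - 4 * min 0 y'))
  refine (dist_vec3_le _ _ _ _ _ _).trans ?_
  simp only [← mul_sub, abs_mul, hε, one_mul]
  have a1 : |outer (6 * max 0 y - 5) + strandX (-5 - 4 * min 0 y) - 1 -
      (outer (6 * max 0 y' - 5) + strandX (-5 - 4 * min 0 y') - 1)| ≤ 10 * |y - y'| :=
    abs_le.2 ⟨by linarith, by linarith⟩
  have a2 : |6 * max 0 y - 5 - 4 * min 0 y - (6 * max 0 y' - 5 - 4 * min 0 y')| ≤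
      10 * |y - y'| := by
    have := abs_le.1 e1; have := abs_le.1 e2
    exact abs_le.2 ⟨by linarith, by linarith⟩
  linarith

theorem dist_kArc_le {ε : ℝ} (hε : |ε| = 1) (y y' : ℝ) :
    dist (kArc ε y) (kArc ε y') ≤ 2 * |y - y'| := by
  refine (dist_le_sum3 _ _).trans ?_
  have := abs_abs_sub_abs_le y' y
  simp only [kArc, vec3_zero, vec3_one, vec3_two, ← mul_sub, abs_mul, hε, one_mul]
  rw [abs_sub_comm y' y] at this
  rw [show 2 - |y| - (2 - |y'|) = |y'| - |y| by ring]
  simp; linarith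

open Classical in
/-- The outer equivalence from the model knot `K` to the model knot `L`. -/
noncomputable def modelMap (p : R3) : R3 :=
  if p ∈ square then p else lArc (if 0 < p 0 then 1 else -1) (p 1)

theorem modelMap_of_mem {p : R3} (h : p ∈ square) : modelMap p = p := if_pos h

theorem modelMap_kArc {ε y : ℝ} (hε : ε = 1 ∨ ε = -1) (h : |y| ≤ 1) :
    modelMap (kArc ε y) = lArc ε y := by
  rcases h.eq_or_lt with h | h
  · rw [modelMap_of_mem]
    · rcases eq_or_eq_neg_of_abs_eq h with rfl | rfl
      · rw [lArc_of_nonneg (by norm_num), outer_of_ge (by norm_num) (by norm_num)]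
        apply R3.ext <;> simp [kArc] <;> norm_num
      · rw [lArc_of_nonpos (by norm_num), strandX_of_ge (by norm_num), strandZ_of_ge (by norm_num)]
        apply R3.ext <;> simp [kArc] <;> norm_num
    · rcases hε with rfl | rfl <;> refine ⟨?_, ?_, ?_⟩ <;> simp [kArc, h] <;> norm_num
  · have : kArc ε y ∉ square := by
      rintro ⟨h1, -⟩
      rcases hε with rfl | rfl <;> simp [kArc] at h1 <;> linarith [abs_le.1 h1]
    rw [modelMap, if_neg this]
    congr 1
    rcases hε with rfl | rfl
    · exact if_pos (by simp [kArc]; linarith)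
    · exact if_neg (by simp [kArc]; linarith)

theorem mem_modelK_union_square_iff {p : R3} : p ∈ modelK ∪ square ↔
    p ∈ square ∨ ∃ ε y, (ε = 1 ∨ ε = -1) ∧ |y| ≤ 1 ∧ p = kArc ε y := by
  constructor
  · rintro (h | h)
    · rw [mem_modelK_iff] at h
      obtain ⟨hz, hx, hy⟩ := h
      rcases le_total |p 0| 1 with h | h
      · exact Or.inl ⟨h, by rw [hy]; exact min_le_left _ _, hz⟩
      · rw [min_eq_right (by linarith)] at hy
        right
        rcases abs_cases (p 0) with ⟨e, _⟩ | ⟨e, _⟩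
        · exact ⟨1, p 1, Or.inl rfl, by linarith, R3.ext (by simp [kArc, hy, e]) rfl hz⟩
        · exact ⟨-1, p 1, Or.inr rfl, by linarith, R3.ext (by simp [kArc, hy, e]) rfl hz⟩
    · exact Or.inl h
  · rintro (h | ⟨ε, y, hε, hy, rfl⟩)
    · exact Or.inr h
    · left
      rw [mem_modelK_iff]
      have : |kArc ε y 0| = 2 - |y| := by
        rcases hε with rfl | rfl <;> simp [kArc, abs_of_nonneg (show 0 ≤ 2 - |y| by linarith)]
        rw [abs_sub_comm, abs_of_nonneg (by linarith)]
      rw [this]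
      exact ⟨rfl, by linarith [abs_nonneg y], by rw [min_eq_right (by linarith)]; simp [kArc]⟩

theorem mem_modelL_union_square_iff {p : R3} : p ∈ modelL ∪ square ↔
    p ∈ square ∨ ∃ ε y, (ε = 1 ∨ ε = -1) ∧ |y| ≤ 1 ∧ p = lArc ε y := by
  rw [modelL_eq]
  constructor
  · rintro (((⟨hz, hx, hy⟩ | ⟨hz, hy, hy', hx⟩) | ⟨hy, hy', hp⟩) | h)
    · exact Or.inl ⟨hx, hy.le, hz⟩
    · right
      rcases eq_or_eq_neg_of_abs_eq hx with e | e
      · refine ⟨1, (p 1 + 5) / 6, Or.inl rfl, abs_le.2 ⟨by linarith, by linarith⟩, ?_⟩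
        rw [lArc_of_nonneg (by linarith), show 6 * ((p 1 + 5) / 6) - 5 = p 1 by ring]
        exact R3.ext (by simp [e]) rfl hz
      · refine ⟨-1, (p 1 + 5) / 6, Or.inr rfl, abs_le.2 ⟨by linarith, by linarith⟩, ?_⟩
        rw [lArc_of_nonneg (by linarith), show 6 * ((p 1 + 5) / 6) - 5 = p 1 by ring]
        exact R3.ext (by simp [e]) rfl hz
    · right
      rcases hp with ⟨e, e'⟩ | ⟨e, e'⟩
      · refine ⟨1, -(p 1 + 5) / 4, Or.inl rfl, abs_le.2 ⟨by linarith, by linarith⟩, ?_⟩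
        rw [lArc_of_nonpos (by linarith), show -5 - 4 * (-(p 1 + 5) / 4) = p 1 by ring]
        exact R3.ext (by simp [e]) rfl (by simp [e'])
      · refine ⟨-1, -(p 1 + 5) / 4, Or.inr rfl, abs_le.2 ⟨by linarith, by linarith⟩, ?_⟩
        rw [lArc_of_nonpos (by linarith), show -5 - 4 * (-(p 1 + 5) / 4) = p 1 by ring]
        exact R3.ext (by simp [e]) rfl (by simp [e'])
    · exact Or.inl h
  · rintro (h | ⟨ε, y, hε, hy, rfl⟩)
    · exact Or.inr h
    · left
      have := abs_le.1 hy
      rcases le_total 0 y with h | h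
      · rw [lArc_of_nonneg h]
        refine Or.inl (Or.inr ⟨rfl, ?_, ?_, ?_⟩) <;> simp
        · linarith
        · linarith
        · rcases hε with rfl | rfl <;> simp [abs_of_nonneg (zero_le_one.trans (one_le_outer _))]
      · rw [lArc_of_nonpos h]
        refine Or.inr ⟨?_, ?_, ?_⟩ <;> simp
        · linarith
        · linarith
        · rcases hε with rfl | rfl <;> simp

theorem abs_of_sign {ε : ℝ} (hε : ε = 1 ∨ ε = -1) : |ε| = 1 := by
  rcases hε with rfl | rfl <;> simp

theorem sub_le_of_sign {ε a b d : ℝ} (hε : ε = 1 ∨ ε = -1) (h : |ε * a - b| ≤ d) :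
    a - ε * b ≤ d := by
  have := abs_le.1 h
  rcases hε with rfl | rfl <;> linarith

theorem norm_kArc_le {ε y : ℝ} (hε : ε = 1 ∨ ε = -1) (hy : |y| ≤ 1) : ‖kArc ε y‖ ≤ 3 := by
  refine (norm_le_sum3 _).trans ?_
  have h2 : 0 ≤ 2 - |y| := by linarith
  simp only [kArc, vec3_zero, vec3_one, vec3_two, abs_mul, abs_of_sign hε, abs_of_nonneg h2]
  simp; linarith

theorem norm_square_le {p : R3} (hp : p ∈ square) : ‖p‖ ≤ 2 :=
  (norm_le_sum3 p).trans (by rw [hp.2.2]; simp; linarith [hp.1, hp.2.1])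

theorem norm_lArc_le {ε y : ℝ} (hε : ε = 1 ∨ ε = -1) (hy : |y| ≤ 1) : ‖lArc ε y‖ ≤ 66 := by
  have h := dist_lArc_le (abs_of_sign hε) y 1
  have h1 : lArc ε 1 ∈ square := by
    rw [lArc_of_nonneg (by norm_num), outer_of_ge (by norm_num) (by norm_num)]
    refine ⟨?_, ?_, ?_⟩ <;> simp [abs_of_sign hε] <;> norm_num [abs_of_sign hε]
  rw [dist_eq_norm] at h
  have h2 : |y - 1| ≤ 2 := abs_le.2 ⟨by linarith [abs_le.1 hy], by linarith [abs_le.1 hy]⟩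
  linarith [norm_square_le h1, norm_le_norm_sub_add (lArc ε y) (lArc ε 1)]

/-- The part of the arc of the model knot `K` on the side `ε` over an interval. -/
def kPart (ε a b : ℝ) : Set R3 := kArc ε '' Icc a b

section

variable {ε a b : ℝ} (hε : ε = 1 ∨ ε = -1) (ha : -1 ≤ a) (hb : b ≤ 1)

theorem norm_modelMap_le {p : R3} (hp : p ∈ modelK ∪ square) : ‖modelMap p‖ ≤ 66 := by
  rcases mem_modelK_union_square_iff.1 hp with hp | ⟨ε, y, hε, hy, rfl⟩
  · rw [modelMap_of_mem hp]; linarith [norm_square_le hp]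
  · rw [modelMap_kArc hε hy]; exact norm_lArc_le hε hy

theorem norm_le_of_mem {p : R3} (hp : p ∈ modelK ∪ square) : ‖p‖ ≤ 3 := by
  rcases mem_modelK_union_square_iff.1 hp with hp | ⟨ε, y, hε, hy, rfl⟩
  · linarith [norm_square_le hp]
  · exact norm_kArc_le hε hy

include hε ha hb

theorem kPart_subset : kPart ε a b ⊆ modelK ∪ square := by
  rintro _ ⟨y, hy, rfl⟩
  exact mem_modelK_union_square_iff.2 (Or.inr ⟨ε, y, hε, abs_le.2 ⟨by linarith [hy.1],
    by linarith [hy.2]⟩, rfl⟩)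

/-- The parameter of `kArc` is its own `y`-coordinate, so it is bounded by the ambient distance. -/
theorem modelMap_upper_self : LipBetween modelMap id (kPart ε a b) (kPart ε a b) := by
  refine ⟨32, by norm_num, ?_⟩
  rintro _ ⟨y, hy, rfl⟩ _ ⟨y', hy', rfl⟩
  rw [modelMap_kArc hε (abs_le.2 ⟨by linarith [hy.1], by linarith [hy.2]⟩),
    modelMap_kArc hε (abs_le.2 ⟨by linarith [hy'.1], by linarith [hy'.2]⟩)]
  have := abs_sub_coord_le (kArc ε y) (kArc ε y') 1
  simp only [kArc, vec3_one] at this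
  exact (dist_lArc_le (abs_of_sign hε) y y').trans (by simp only [id]; gcongr; exact this)

end

theorem modelMap_upper_square : LipBetween modelMap id square square :=
  ⟨1, zero_le_one, fun p hp p' hp' => by simp [modelMap_of_mem hp, modelMap_of_mem hp']⟩

theorem modelMap_lower_square : LipBetween id modelMap square square :=
  ⟨1, zero_le_one, fun p hp p' hp' => by simp [modelMap_of_mem hp, modelMap_of_mem hp']⟩

theorem kArc_mem_square {ε y : ℝ} (hε : ε = 1 ∨ ε = -1) (hy : |y| = 1) : kArc ε y ∈ square := by
  refine ⟨?_, ?_, ?_⟩ <;> simp [kArc, hy, abs_of_sign hε]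
  norm_num [abs_of_sign hε]

/-- The two arcs and the square are glued by `LipBetween.of_hub`. Opposite arcs differ by at least
`2` in `x`. The distance from `kArc ε y` to the square is at least `1 - |y|`, which is comparable
with the distance to the nearer end of the arc, so that end serves as common point. -/
theorem modelMap_upper :
    LipBetween modelMap id (modelK ∪ square) (modelK ∪ square) := by
  have hs : ∀ {ε : ℝ}, ε = 1 ∨ ε = -1 → LipBetween modelMap id (kPart ε (-1) 1) square := by
    intro ε hε
    refine LipBetween.of_hub (modelMap_upper_self hε le_rfl le_rfl) modelMap_upper_square (M := 66)
      (δ := 1) (D := 2) (fun p hp => norm_modelMap_le (hp.elim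
        (fun h => kPart_subset hε le_rfl le_rfl h) Or.inr)) one_pos ?_
    rintro _ ⟨y, hy, rfl⟩ p hp
    right
    have h1 : 1 - |y| ≤ dist (kArc ε y) p := by
      have := sub_le_of_sign hε (abs_sub_coord_le (kArc ε y) p 0)
      have h2 : ε * p 0 ≤ 1 :=
        (le_abs_self _).trans (by rw [abs_mul, abs_of_sign hε]; linarith [hp.1])
      linarith
    rcases le_total 0 y with h | h
    · refine ⟨kArc ε 1, ⟨1, by simp, rfl⟩, kArc_mem_square hε (by simp), ?_⟩
      refine (dist_kArc_le (abs_of_sign hε) y 1).trans ?_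
      rw [abs_of_nonneg h] at h1
      rw [abs_sub_comm, abs_of_nonneg (by linarith [hy.2])]
      exact mul_le_mul_of_nonneg_left h1 (by norm_num)
    · refine ⟨kArc ε (-1), ⟨-1, by simp, rfl⟩, kArc_mem_square hε (by simp), ?_⟩
      refine (dist_kArc_le (abs_of_sign hε) y (-1)).trans ?_
      rw [abs_of_nonpos h] at h1
      rw [abs_of_nonneg (by linarith [hy.1])]
      exact mul_le_mul_of_nonneg_left (by linarith : y - -1 ≤ dist (kArc ε y) p) (by norm_num)
  have hp : LipBetween modelMap id (kPart 1 (-1) 1) (kPart (-1) (-1) 1) := by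
    refine LipBetween.of_hub (modelMap_upper_self (Or.inl rfl) le_rfl le_rfl)
      (modelMap_upper_self (Or.inr rfl) le_rfl le_rfl) (M := 66)
      (δ := 2) (D := 2) (fun p hp => norm_modelMap_le (hp.elim
        (fun h => kPart_subset (Or.inl rfl) le_rfl le_rfl h)
        (fun h => kPart_subset (Or.inr rfl) le_rfl le_rfl h))) two_pos ?_
    rintro _ ⟨y, hy, rfl⟩ _ ⟨y', hy', rfl⟩
    left
    have h1 := abs_le.1 (abs_sub_coord_le (kArc 1 y) (kArc (-1) y') 0)
    have h2 := abs_le.2 hy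
    have h3 := abs_le.2 hy'
    simp only [kArc, vec3_zero] at h1
    simp only [id, kArc]
    linarith
  refine (((modelMap_upper_self (Or.inl rfl) le_rfl le_rfl).union
    (modelMap_upper_self (Or.inr rfl) le_rfl le_rfl) hp).union modelMap_upper_square
    ((hs (Or.inl rfl)).union_left (hs (Or.inr rfl)))).mono ?_
  intro p hp
  rcases mem_modelK_union_square_iff.1 hp with hp | ⟨ε, y, rfl | rfl, hy, rfl⟩
  · exact Or.inr hp
  · exact Or.inl (Or.inl ⟨y, abs_le.1 hy, rfl⟩)
  · exact Or.inl (Or.inr ⟨y, abs_le.1 hy, rfl⟩)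

theorem one_sub_le_strandX (y : ℝ) : -4 - y ≤ strandX y := by
  rw [strandX]; linarith [neg_abs_le (y + 3)]

theorem abs_strandX_le {y : ℝ} (h : -5 ≤ y) (h' : y ≤ -1) : |strandX y| ≤ 1 := by
  rcases le_total y (-3) with h3 | h3
  · rw [strandX_of_le h3, abs_le]; constructor <;> linarith
  · rw [strandX_of_ge h3, abs_le]; constructor <;> linarith

/-- The inner strands run along the boundary of the unit ball of the norm `|x| + |z|`. This keeps
them apart from each other and allows them to be rounded to helices. -/
theorem abs_strand_add {y : ℝ} (h : -5 ≤ y) (h' : y ≤ -1) : |strandX y| + |strandZ y| = 1 := by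
  rcases le_total y (-4) with h4 | h4
  · rw [strandX_of_le (by linarith), strandZ_of_le h4, abs_of_nonneg (by linarith),
      abs_of_nonneg (by linarith)]; ring
  rcases le_total y (-3) with h3 | h3
  · rw [strandX_of_le h3, strandZ_of_mem h4 (by linarith), abs_of_nonpos (by linarith),
      abs_of_nonneg (by linarith)]; ring
  rcases le_total y (-2) with h2 | h2
  · rw [strandX_of_ge h3, strandZ_of_mem h4 h2, abs_of_nonpos (by linarith),
      abs_of_nonpos (by linarith)]; ring
  · rw [strandX_of_ge h3, strandZ_of_ge h2, abs_of_nonneg (by linarith),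
      abs_of_nonpos (by linarith)]; ring

section

variable {ε ε' : ℝ} (hε : ε = 1 ∨ ε = -1) (hε' : ε' = 1 ∨ ε' = -1)
include hε

theorem modelMap_outer {y : ℝ} (hy : y ∈ Icc (0:ℝ) 1) :
    modelMap (kArc ε y) = !₂[ε * outer (6 * y - 5), 6 * y - 5, 0] := by
  rw [modelMap_kArc hε (abs_le.2 ⟨by linarith [hy.1], hy.2⟩), lArc_of_nonneg hy.1]

theorem modelMap_inner {y : ℝ} (hy : y ∈ Icc (-1:ℝ) 0) : modelMap (kArc ε y) =
    !₂[ε * strandX (-5 - 4 * y), -5 - 4 * y, ε * strandZ (-5 - 4 * y)] := by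
  rw [modelMap_kArc hε (abs_le.2 ⟨hy.1, by linarith [hy.2]⟩), lArc_of_nonpos hy.2]

theorem modelMap_lower_outer : LipBetween id modelMap (kPart ε 0 1) (kPart ε 0 1) := by
  refine ⟨2, by norm_num, ?_⟩
  rintro _ ⟨y, hy, rfl⟩ _ ⟨y', hy', rfl⟩
  have h := abs_sub_coord_le (modelMap (kArc ε y)) (modelMap (kArc ε y')) 1
  refine (dist_kArc_le (abs_of_sign hε) y y').trans (mul_le_mul_of_nonneg_left (le_trans ?_ h)
    (by norm_num))
  rw [modelMap_outer hε hy, modelMap_outer hε hy', vec3_one, vec3_one,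
    show 6 * y - 5 - (6 * y' - 5) = 6 * (y - y') by ring, abs_mul]
  norm_num; linarith [abs_nonneg (y - y')]

theorem modelMap_lower_inner : LipBetween id modelMap (kPart ε (-1) 0) (kPart ε (-1) 0) := by
  refine ⟨2, by norm_num, ?_⟩
  rintro _ ⟨y, hy, rfl⟩ _ ⟨y', hy', rfl⟩
  have h := abs_sub_coord_le (modelMap (kArc ε y)) (modelMap (kArc ε y')) 1
  refine (dist_kArc_le (abs_of_sign hε) y y').trans (mul_le_mul_of_nonneg_left (le_trans ?_ h)
    (by norm_num))
  rw [modelMap_inner hε hy, modelMap_inner hε hy', vec3_one, vec3_one,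
    show -5 - 4 * y - (-5 - 4 * y') = -4 * (y - y') by ring, abs_mul]
  norm_num; linarith [abs_nonneg (y - y')]

theorem modelMap_lower_outer_square : LipBetween id modelMap (kPart ε 0 1) square := by
  -- For `y ≥ -2` the outer arc is `2/3 * (1 - y)` beyond the square in the direction of `x`, and
  -- its distance to the corner is at most `5/3 * (1 - y)`; the quotient is `D = 5/2`. For `y ≤ -2`
  -- the level alone gives distance `1`.
  refine LipBetween.of_hub (modelMap_lower_outer hε) modelMap_lower_square (M := 3)
    (δ := 1) (D := 5 / 2) (fun p hp => norm_le_of_mem (hp.elim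
      (fun h => kPart_subset hε (by norm_num) le_rfl h) Or.inr)) one_pos ?_
  rintro _ ⟨y, hy, rfl⟩ p hp
  have h0 := abs_sub_coord_le (modelMap (kArc ε y)) (modelMap p) 0
  rw [show modelMap (kArc ε y) 0 = ε * outer (6 * y - 5) by rw [modelMap_outer hε hy]; rfl] at h0
  have h0 := sub_le_of_sign hε h0
  have h1 := abs_le.1 (abs_sub_coord_le (modelMap (kArc ε y)) (modelMap p) 1)
  rw [modelMap_of_mem hp] at h0 h1 ⊢
  have h2 : ε * p 0 ≤ 1 := (le_abs_self _).trans (by rw [abs_mul, abs_of_sign hε]; linarith [hp.1])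
  have h3 := abs_le.1 hp.2.1
  set d := dist (modelMap (kArc ε y)) p
  rw [modelMap_outer hε hy, vec3_one] at h1
  rcases le_total (6 * y - 5) (-2) with h | h
  · left; linarith
  · right
    refine ⟨kArc ε 1, ⟨1, by simp, rfl⟩, kArc_mem_square hε (by simp), ?_⟩
    rw [outer_of_ge h (by linarith [hy.2])] at h0
    rw [modelMap_outer hε hy, modelMap_outer hε ⟨by norm_num, le_rfl⟩]
    refine (dist_vec3_le _ _ _ _ _ _).trans ?_
    simp only [← mul_sub, abs_mul, abs_of_sign hε, one_mul]
    rw [outer_of_ge h (by linarith [hy.2]), outer_of_ge (by norm_num) (by norm_num),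
      abs_of_nonneg (by linarith [hy.2]), abs_of_nonpos (by linarith [hy.2])]
    norm_num
    linarith

theorem modelMap_lower_inner_square : LipBetween id modelMap (kPart ε (-1) 0) square := by
  -- `D = 5 = 1 + 1 + 3` is the sum of the Lipschitz constants of the three coordinates in `y`; the
  -- square has `y ≥ -1`, so the distance to the corner in `y` is bounded by the distance to the
  -- square.
  refine LipBetween.of_hub (modelMap_lower_inner hε) modelMap_lower_square (M := 3)
    (δ := 1) (D := 5) (fun p hp => norm_le_of_mem (hp.elim
      (fun h => kPart_subset hε le_rfl (by norm_num) h) Or.inr)) one_pos ?_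
  rintro _ ⟨y, hy, rfl⟩ p hp
  have h1 := abs_le.1 (abs_sub_coord_le (modelMap (kArc ε y)) (modelMap p) 1)
  rw [modelMap_of_mem hp] at h1 ⊢
  have h3 := abs_le.1 hp.2.1
  set d := dist (modelMap (kArc ε y)) p
  rw [modelMap_inner hε hy, vec3_one] at h1
  right
  refine ⟨kArc ε (-1), ⟨-1, by simp, rfl⟩, kArc_mem_square hε (by simp), ?_⟩
  rw [modelMap_inner hε hy, modelMap_inner hε ⟨le_rfl, by norm_num⟩]
  refine (dist_vec3_le _ _ _ _ _ _).trans ?_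
  simp only [← mul_sub, abs_mul, abs_of_sign hε, one_mul]
  have a1 := abs_strandX_sub_le (-5 - 4 * y) (-5 - 4 * (-1))
  have a2 := abs_strandZ_sub_le (-5 - 4 * y) (-5 - 4 * (-1))
  rw [abs_of_nonpos (a := -5 - 4 * y - (-5 - 4 * (-1))) (by linarith [hy.1])] at a1 a2 ⊢
  linarith

theorem modelMap_lower_outer_inner : LipBetween id modelMap (kPart ε 0 1) (kPart ε (-1) 0) := by
  -- The common point is the lower end `(ε, -5, 0)`, the image of `kArc ε 0`. Since the inner strand
  -- has `|x| ≤ 1`, the excess `2/3 * (y + 5)` of the outer arc controls the distance to that end.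
  -- For `y ≥ -2` the differences in `x` and in `y` cannot both be small.
  refine LipBetween.of_hub (modelMap_lower_outer hε) (modelMap_lower_inner hε) (M := 3)
    (δ := 2 / 3) (D := 5 / 2) (fun p hp => norm_le_of_mem (hp.elim
      (fun h => kPart_subset hε (by norm_num) le_rfl h)
      (fun h => kPart_subset hε le_rfl (by norm_num) h))) (by norm_num) ?_
  rintro _ ⟨y, hy, rfl⟩ _ ⟨y', hy', rfl⟩
  have h0 := abs_sub_coord_le (modelMap (kArc ε y)) (modelMap (kArc ε y')) 0
  have h1 := abs_le.1 (abs_sub_coord_le (modelMap (kArc ε y)) (modelMap (kArc ε y')) 1)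
  set d := dist (modelMap (kArc ε y)) (modelMap (kArc ε y'))
  rw [modelMap_outer hε hy, modelMap_inner hε hy'] at h0 h1
  simp only [Matrix.cons_val_zero, Matrix.cons_val_one, ← mul_sub, abs_mul, abs_of_sign hε,
      one_mul] at h0 h1
  have h0 := (abs_le.1 h0).2
  have h2 := (abs_le.1 (abs_strandX_le (y := -5 - 4 * y') (by linarith [hy'.2])
    (by linarith [hy'.1]))).2
  obtain ⟨hy0, hy1⟩ := hy
  obtain ⟨hy0', hy1'⟩ := hy'
  rcases le_total (6 * y - 5) (-2) with h | h
  · right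
    refine ⟨kArc ε 0, ⟨0, by simp, rfl⟩, ⟨0, by simp, rfl⟩, ?_⟩
    rw [outer_of_le h (by linarith)] at h0
    rw [modelMap_outer hε ⟨hy0, hy1⟩, modelMap_outer hε ⟨le_rfl, by norm_num⟩]
    refine (dist_vec3_le _ _ _ _ _ _).trans ?_
    simp only [← mul_sub, abs_mul, abs_of_sign hε, one_mul]
    rw [outer_of_le h (by linarith), outer_of_le (by norm_num) (by norm_num),
      abs_of_nonneg (by linarith), abs_of_nonneg (by linarith)]
    norm_num
    linarith
  · left
    rw [outer_of_ge h (by linarith)] at h0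
    linarith

include hε'

/-- The two pieces are disjoint: the opposite inner strand reaches `ε x = 1` only at `y = -3`, where
the outer arc is at `7/3`. The bounds make this quantitative, so only the first alternative of
`LipBetween.of_hub` occurs. -/
theorem modelMap_lower_opposite_outer_inner (hne : ε * ε' = -1) :
    LipBetween id modelMap (kPart ε 0 1) (kPart ε' (-1) 0) := by
  refine LipBetween.of_hub (modelMap_lower_outer hε) (modelMap_lower_inner hε') (M := 3)
    (δ := 1 / 3) (D := 1) (fun p hp => norm_le_of_mem (hp.elim
      (fun h => kPart_subset hε (by norm_num) le_rfl h)
      (fun h => kPart_subset hε' le_rfl (by norm_num) h))) (by norm_num) ?_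
  rintro _ ⟨y, hy, rfl⟩ _ ⟨y', hy', rfl⟩
  have h0 := abs_sub_coord_le (modelMap (kArc ε y)) (modelMap (kArc ε' y')) 0
  have h1 := abs_le.1 (abs_sub_coord_le (modelMap (kArc ε y)) (modelMap (kArc ε' y')) 1)
  set d := dist (modelMap (kArc ε y)) (modelMap (kArc ε' y'))
  rw [modelMap_outer hε hy, modelMap_inner hε' hy'] at h0 h1
  simp only [Matrix.cons_val_zero, Matrix.cons_val_one] at h0 h1
  have h0 := sub_le_of_sign hε h0
  rw [← mul_assoc, hne] at h0
  have h2 := one_sub_le_strandX (-5 - 4 * y')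
  have h3 := (abs_le.1 (abs_strandX_le (y := -5 - 4 * y') (by linarith [hy'.2])
    (by linarith [hy'.1]))).1
  obtain ⟨hy0, hy1⟩ := hy
  obtain ⟨hy0', hy1'⟩ := hy'
  left
  rcases le_total (6 * y - 5) (-2) with h | h
  · rw [outer_of_le h (by linarith)] at h0
    linarith
  · rw [outer_of_ge h (by linarith)] at h0
    rcases le_total y' (-1 / 2) with h' | h' <;> linarith

end

theorem modelMap_lower_outer_outer :
    LipBetween id modelMap (kPart 1 0 1) (kPart (-1) 0 1) := by
  refine LipBetween.of_hub (modelMap_lower_outer (Or.inl rfl)) (modelMap_lower_outer (Or.inr rfl))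
    (M := 3) (δ := 2) (D := 1) (fun p hp => norm_le_of_mem (hp.elim
      (fun h => kPart_subset (Or.inl rfl) (by norm_num) le_rfl h)
      (fun h => kPart_subset (Or.inr rfl) (by norm_num) le_rfl h))) (by norm_num) ?_
  rintro _ ⟨y, hy, rfl⟩ _ ⟨y', hy', rfl⟩
  have h0 := abs_le.1 (abs_sub_coord_le (modelMap (kArc 1 y)) (modelMap (kArc (-1) y')) 0)
  set d := dist (modelMap (kArc 1 y)) (modelMap (kArc (-1) y'))
  rw [modelMap_outer (Or.inl rfl) hy, modelMap_outer (Or.inr rfl) hy'] at h0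
  simp only [Matrix.cons_val_zero] at h0
  left
  linarith [one_le_outer (6 * y - 5), one_le_outer (6 * y' - 5)]

/-- At equal levels the two strands are antipodal on `|x| + |z| = 1`; a difference of levels is
absorbed by the Lipschitz constants `1` and `3` of the strand coordinates. -/
theorem modelMap_lower_inner_inner :
    LipBetween id modelMap (kPart 1 (-1) 0) (kPart (-1) (-1) 0) := by
  refine LipBetween.of_hub (modelMap_lower_inner (Or.inl rfl)) (modelMap_lower_inner (Or.inr rfl))
    (M := 3) (δ := 1 / 16) (D := 1) (fun p hp => norm_le_of_mem (hp.elim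
      (fun h => kPart_subset (Or.inl rfl) le_rfl (by norm_num) h)
      (fun h => kPart_subset (Or.inr rfl) le_rfl (by norm_num) h))) (by norm_num) ?_
  rintro _ ⟨y, hy, rfl⟩ _ ⟨y', hy', rfl⟩
  have h0 := abs_le.1 (abs_sub_coord_le (modelMap (kArc 1 y)) (modelMap (kArc (-1) y')) 0)
  have h1 := abs_sub_coord_le (modelMap (kArc 1 y)) (modelMap (kArc (-1) y')) 1
  have h2 := abs_le.1 (abs_sub_coord_le (modelMap (kArc 1 y)) (modelMap (kArc (-1) y')) 2)
  set d := dist (modelMap (kArc 1 y)) (modelMap (kArc (-1) y'))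
  rw [modelMap_inner (Or.inl rfl) hy, modelMap_inner (Or.inr rfl) hy'] at h0 h1 h2
  simp only [Matrix.cons_val_zero, Matrix.cons_val_one, Matrix.cons_val] at h0 h1 h2
  left
  have a1 := abs_le.1 (abs_strandX_sub_le (-5 - 4 * y) (-5 - 4 * y'))
  have a2 := abs_le.1 (abs_strandZ_sub_le (-5 - 4 * y) (-5 - 4 * y'))
  have a3 := abs_strand_add (y := -5 - 4 * y) (by linarith [hy.2]) (by linarith [hy.1])
  rcases abs_cases (strandX (-5 - 4 * y)) with ⟨e, _⟩ | ⟨e, _⟩ <;>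
    rcases abs_cases (strandZ (-5 - 4 * y)) with ⟨e', _⟩ | ⟨e', _⟩ <;> linarith

theorem modelMap_lower :
    LipBetween id modelMap (modelK ∪ square) (modelK ∪ square) := by
  have h1 : (1:ℝ) = 1 ∨ (1:ℝ) = -1 := Or.inl rfl
  have h2 : (-1:ℝ) = 1 ∨ (-1:ℝ) = -1 := Or.inr rfl
  have a : ∀ {ε : ℝ}, ε = 1 ∨ ε = -1 → LipBetween id modelMap (kPart ε 0 1 ∪ kPart ε (-1) 0)
      (kPart ε 0 1 ∪ kPart ε (-1) 0) := fun h =>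
    (modelMap_lower_outer h).union (modelMap_lower_inner h) (modelMap_lower_outer_inner h)
  have b : ∀ {ε : ℝ}, ε = 1 ∨ ε = -1 → LipBetween id modelMap (kPart ε 0 1 ∪ kPart ε (-1) 0)
      square := fun h =>
    (modelMap_lower_outer_square h).union_left (modelMap_lower_inner_square h)
  refine (((a h1).union (a h2) ?_).union modelMap_lower_square ((b h1).union_left (b h2))).mono ?_
  · exact (modelMap_lower_outer_outer.union_right
      (modelMap_lower_opposite_outer_inner h1 h2 (by norm_num))).union_left
      ((modelMap_lower_opposite_outer_inner h2 h1 (by norm_num)).symm.union_right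
        modelMap_lower_inner_inner)
  intro p hp
  have key : ∀ {ε y : ℝ}, |y| ≤ 1 → kArc ε y ∈ kPart ε 0 1 ∪ kPart ε (-1) 0 := by
    intro ε y hy
    rcases le_total 0 y with h | h
    · exact Or.inl ⟨y, ⟨h, (abs_le.1 hy).2⟩, rfl⟩
    · exact Or.inr ⟨y, ⟨(abs_le.1 hy).1, h⟩, rfl⟩
  rcases mem_modelK_union_square_iff.1 hp with hp | ⟨ε, y, rfl | rfl, hy, rfl⟩
  · exact Or.inr hp
  · exact Or.inl (Or.inl (key hy))
  · exact Or.inl (Or.inr (key hy))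

theorem mapsTo_modelMap : MapsTo modelMap (modelK ∪ square) (modelL ∪ square) := by
  intro p hp
  rw [mem_modelK_union_square_iff] at hp
  rw [mem_modelL_union_square_iff]
  rcases hp with hp | ⟨ε, y, hε, hy, rfl⟩
  · left; rwa [modelMap_of_mem hp]
  · exact Or.inr ⟨ε, y, hε, hy, modelMap_kArc hε hy⟩

theorem surjOn_modelMap : SurjOn modelMap (modelK ∪ square) (modelL ∪ square) := by
  intro p hp
  rw [mem_modelL_union_square_iff] at hp
  rcases hp with hp | ⟨ε, y, hε, hy, rfl⟩
  · exact ⟨p, Or.inr hp, modelMap_of_mem hp⟩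
  · exact ⟨kArc ε y, mem_modelK_union_square_iff.2 (Or.inr ⟨ε, y, hε, hy, rfl⟩),
      modelMap_kArc hε hy⟩

/-- The inverse of the outer equivalence `modelMap`. -/
noncomputable def modelInv : R3 → R3 := Function.invFunOn modelMap (modelK ∪ square)

theorem outerPair_model : ∃ C R, OuterPair modelK modelL modelMap modelInv C R := by
  obtain ⟨C, h0, h⟩ := modelMap_upper
  obtain ⟨C', h0', h'⟩ := modelMap_lower
  have hinj : InjOn modelMap (modelK ∪ square) := fun p hp p' hp' he => by
    have := h' p hp p' hp'
    rw [he, dist_self, mul_zero] at this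
    exact dist_le_zero.1 this
  have hm : MapsTo modelInv (modelL ∪ square) (modelK ∪ square) := surjOn_modelMap.mapsTo_invFunOn
  have hr : ∀ p ∈ modelL ∪ square, modelMap (modelInv p) = p :=
    fun p hp => surjOn_modelMap.rightInvOn_invFunOn hp
  refine ⟨max ⟨C, h0⟩ ⟨C', h0'⟩, 66, ?_, ?_, mapsTo_modelMap, hm, fun p hp => ?_, hr,
    fun p hp => modelMap_of_mem hp, ?_, ?_⟩
  · exact (LipschitzOnWith.of_dist_le_mul (K := ⟨C, h0⟩) h).weaken (le_max_left _ _)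
  · refine (LipschitzOnWith.of_dist_le_mul (K := ⟨C', h0'⟩) fun p hp p' hp' => ?_).weaken
      (le_max_right _ _)
    have := h' _ (hm hp) _ (hm hp')
    rwa [hr p hp, hr p' hp'] at this
  · exact hinj (hm (mapsTo_modelMap hp)) hp (hr _ (mapsTo_modelMap hp))
  · intro p hp
    rcases mem_modelK_union_square_iff.1 hp with hp | ⟨ε, y, hε, hy, rfl⟩
    · linarith [norm_square_le hp]
    · linarith [norm_kArc_le hε hy]
  · intro p hp
    rcases mem_modelL_union_square_iff.1 hp with hp | ⟨ε, y, hε, hy, rfl⟩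
    · linarith [norm_square_le hp]
    · exact norm_lArc_le hε hy

/-! ### Cones over compactly supported homeomorphisms -/

theorem coneMap_smul (J : R3 → R3) {c : ℝ} (hc : 0 < c) (v : R4) :
    coneMap J (c • v) = c • coneMap J v := by
  rcases lt_or_ge 0 (v 3) with h | h
  · rw [coneMap_of_pos h, coneMap_of_pos (by simp; positivity), proj_smul hc.ne', smul_smul]
    simp
  · rw [coneMap_of_nonpos h, coneMap_of_nonpos]
    simpa using mul_nonpos_of_nonneg_of_nonpos hc.le h

/-- The projection estimate is useless far out, near the hyperplane `t = 0`. The displacement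
`coneMap Φ v - v`, however, vanishes for `t ≤ 0` and outside the cone over the ball of radius `R`,
so at least one of two points to be compared may be assumed in that cone. -/
theorem exists_dist_coneMap_le {Φ : R3 → R3} {C : ℝ≥0} (hΦ : LipschitzWith C Φ) {R : ℝ}
    (hR : ∀ p, R < ‖p‖ → Φ p = p) : ∃ D : ℝ≥0, LipschitzWith D (coneMap Φ) := by
  obtain ⟨M, hM0, hM⟩ : ∃ M : ℝ, 0 ≤ M ∧ ∀ p, dist (Φ p) p ≤ M := by
    refine ⟨C * |R| + ‖Φ 0‖ + |R|, by positivity, fun p => ?_⟩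
    rcases lt_or_ge R ‖p‖ with h | h
    · rw [hR p h, dist_self]; positivity
    · have h1 := hΦ.dist_le_mul p 0
      have h2 := dist_triangle (Φ p) (Φ 0) p
      have h3 : dist (Φ 0) p ≤ ‖Φ 0‖ + ‖p‖ := dist_le_norm_add_norm _ _
      have h4 : ‖p‖ ≤ |R| := h.trans (le_abs_self R)
      rw [dist_zero_right] at h1
      have : C * ‖p‖ ≤ C * |R| := by gcongr
      linarith
  set D : ℝ := M + (C + 1) * (|R| + 2) with hD
  have hD0 : 0 ≤ D := by positivity
  have hMD : M ≤ D := by rw [hD]; linarith [show 0 ≤ (C + 1 : ℝ) * (|R| + 2) by positivity]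
  set E : R4 → R4 := fun v => coneMap Φ v - v with hE
  have hEpos : ∀ v : R4, 0 < v 3 → E v = v 3 • (lift (Φ (proj v)) - lift (proj v)) := by
    intro v hv
    rw [hE, smul_sub, smul_lift_proj hv.ne']
    simp only [coneMap_of_pos hv]
  have hEneg : ∀ v : R4, v 3 ≤ 0 → E v = 0 := fun v hv => by simp [hE, coneMap_of_nonpos hv]
  have h1 : ∀ v w : R4, 0 < v 3 → w 3 ≤ 0 → ‖E v - E w‖ ≤ D * dist v w := by
    intro v w hv hw
    rw [hEneg w hw, sub_zero, hEpos v hv, norm_smul, ← dist_eq_norm, dist_lift,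
      Real.norm_of_nonneg hv.le]
    have := (abs_le.1 (abs_height_sub_le v w)).2
    calc v 3 * dist (Φ (proj v)) (proj v) ≤ dist v w * D := by
          gcongr
          · linarith
          · exact (hM _).trans hMD
      _ = _ := mul_comm _ _
  have h2 : ∀ v w : R4, 0 < v 3 → 0 < w 3 → ‖proj v‖ ≤ R → ‖E v - E w‖ ≤ D * dist v w := by
    intro v w hv hw hp
    set a := lift (Φ (proj v)) - lift (proj v) with ha
    set b := lift (Φ (proj w)) - lift (proj w) with hb
    have e : E v - E w = (v 3 - w 3) • a + w 3 • (a - b) := by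
      rw [hEpos v hv, hEpos w hw]; module
    have ha' : ‖a‖ ≤ M := by rw [ha, ← dist_eq_norm, dist_lift]; exact hM _
    have hab : ‖a - b‖ ≤ (C + 1) * dist (proj v) (proj w) := by
      have : a - b = (lift (Φ (proj v)) - lift (Φ (proj w))) - (lift (proj v) - lift (proj w)) := by
        rw [ha, hb]; abel
      rw [this]
      refine (norm_sub_le _ _).trans ?_
      rw [← dist_eq_norm, ← dist_eq_norm, dist_lift, dist_lift]
      linarith [hΦ.dist_le_mul (proj v) (proj w)]
    have h3 : w 3 * dist (proj v) (proj w) ≤ (|R| + 2) * dist v w :=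
      (height_mul_dist_proj_le hv hw).trans (by gcongr; exact hp.trans (le_abs_self R))
    rw [e]
    calc _ ≤ ‖(v 3 - w 3) • a‖ + ‖w 3 • (a - b)‖ := norm_add_le _ _
      _ ≤ dist v w * M + w 3 * ((C + 1) * dist (proj v) (proj w)) := by
        rw [norm_smul, norm_smul, Real.norm_of_nonneg hw.le, Real.norm_eq_abs]
        gcongr
        exact abs_height_sub_le v w
      _ = dist v w * M + (C + 1) * (w 3 * dist (proj v) (proj w)) := by ring
      _ ≤ dist v w * M + (C + 1) * ((|R| + 2) * dist v w) := by gcongr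
      _ = _ := by rw [hD]; ring
  have h3 : ∀ v w : R4, ‖E v - E w‖ ≤ D * dist v w := by
    intro v w
    rcases lt_or_ge 0 (v 3) with hv | hv <;> rcases lt_or_ge 0 (w 3) with hw | hw
    · rcases le_or_gt ‖proj v‖ R with hp | hp
      · exact h2 v w hv hw hp
      rcases le_or_gt ‖proj w‖ R with hp' | hp'
      · rw [norm_sub_rev, dist_comm]; exact h2 w v hw hv hp'
      · rw [hEpos v hv, hEpos w hw, hR _ hp, hR _ hp']; simp; positivity
    · exact h1 v w hv hw
    · rw [norm_sub_rev, dist_comm]; exact h1 w v hw hv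
    · rw [hEneg v hv, hEneg w hw]; simp; positivity
  refine ⟨⟨D + 1, by positivity⟩, LipschitzWith.of_dist_le_mul fun v w => ?_⟩
  have e : coneMap Φ v - coneMap Φ w = (E v - E w) + (v - w) := by
    simp only [hE]; abel
  rw [dist_eq_norm, e]
  refine (norm_add_le _ _).trans ?_
  rw [← dist_eq_norm v w]
  change _ ≤ (D + 1) * _
  linarith [h3 v w]

/-! ### Ambient topological equivalence -/

/-- The unit ball has a norm preserving self-homeomorphism which maps `X` to `Y`. -/
def BallEquivalent (X Y : Set R4) : Prop :=
  ∃ f g : R4 → R4, ContinuousOn f (Metric.ball 0 1) ∧ ContinuousOn g (Metric.ball 0 1) ∧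
    (∀ v ∈ Metric.ball (0 : R4) 1, ‖f v‖ = ‖v‖ ∧ ‖g v‖ = ‖v‖ ∧ g (f v) = v ∧ f (g v) = v) ∧
    ∀ v ∈ Metric.ball (0 : R4) 1, v ∈ X ↔ f v ∈ Y

namespace BallEquivalent

variable {X Y Z : Set R4}

theorem symm (h : BallEquivalent X Y) : BallEquivalent Y X := by
  obtain ⟨f, g, hf, hg, h, hXY⟩ := h
  refine ⟨g, f, hg, hf, fun v hv => ?_, fun v hv => ?_⟩
  · obtain ⟨h1, h2, h3, h4⟩ := h v hv
    exact ⟨h2, h1, h4, h3⟩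
  · obtain ⟨h1, h2, h3, h4⟩ := h v hv
    rw [hXY (g v) (by simpa [h2] using hv), h4]

theorem trans (h : BallEquivalent X Y) (h' : BallEquivalent Y Z) : BallEquivalent X Z := by
  obtain ⟨f, g, hf, hg, h, hXY⟩ := h
  obtain ⟨f', g', hf', hg', h', hYZ⟩ := h'
  have m : MapsTo f (Metric.ball 0 1) (Metric.ball 0 1) := fun v hv => by
    simpa [(h v hv).1] using hv
  have m' : MapsTo g' (Metric.ball 0 1) (Metric.ball 0 1) := fun v hv => by
    simpa [(h' v hv).2.1] using hv
  refine ⟨f' ∘ f, g ∘ g', hf'.comp hf m, hg.comp hg' m', fun v hv => ⟨?_, ?_, ?_, ?_⟩,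
    fun v hv => ?_⟩
  · exact (h' _ (m hv)).1.trans (h v hv).1
  · exact (h _ (m' hv)).2.1.trans (h' v hv).2.1
  · simp [(h' _ (m hv)).2.2.1, (h v hv).2.2.1]
  · simp [(h _ (m' hv)).2.2.2, (h' v hv).2.2.2]
  · rw [hXY v hv, hYZ _ (m hv)]; rfl

theorem topologicallyAmbientEquivalent (h : BallEquivalent X Y) {X' Y' : Set R4}
    (hX : ∀ v ∈ Metric.ball (0 : R4) 1, v ∈ X' ↔ v ∈ X)
    (hY : ∀ v ∈ Metric.ball (0 : R4) 1, v ∈ Y' ↔ v ∈ Y) :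
    TopologicallyAmbientEquivalent X' Y' := by
  obtain ⟨f, g, hf, hg, h, hXY⟩ := h
  intro δ hδ
  have h1 : min δ 1 / 2 < 1 := by linarith [min_le_right δ 1]
  have hs : Metric.closedBall (0 : R4) (min δ 1 / 2) ⊆ Metric.ball 0 1 :=
    Metric.closedBall_subset_ball h1
  have hfm : ∀ v : Metric.closedBall (0 : R4) (min δ 1 / 2),
      f v ∈ Metric.closedBall (0 : R4) (min δ 1 / 2) := fun v => by
    have := v.2
    rw [mem_closedBall_zero_iff] at this ⊢
    rwa [(h v (hs v.2)).1]
  have hgm : ∀ v : Metric.closedBall (0 : R4) (min δ 1 / 2),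
      g v ∈ Metric.closedBall (0 : R4) (min δ 1 / 2) := fun v => by
    have := v.2
    rw [mem_closedBall_zero_iff] at this ⊢
    rwa [(h v (hs v.2)).2.1]
  refine ⟨min δ 1 / 2, by positivity, by linarith [min_le_left δ 1],
    { toFun := fun v => ⟨f v, hfm v⟩
      invFun := fun v => ⟨g v, hgm v⟩
      left_inv := fun v => Subtype.ext (h v (hs v.2)).2.2.1
      right_inv := fun v => Subtype.ext (h v (hs v.2)).2.2.2
      continuous_toFun := ?_
      continuous_invFun := ?_ }, ?_, ?_⟩
  · exact Continuous.subtype_mk ((hf.mono hs).comp_continuous continuous_subtype_val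
      fun v => v.2) _
  · exact Continuous.subtype_mk ((hg.mono hs).comp_continuous continuous_subtype_val
      fun v => v.2) _
  · intro p hp
    have := (h p (hs p.2)).1
    rw [hp, norm_zero, norm_eq_zero] at this
    simpa [hp] using this
  · intro p
    exact (hX p (hs p.2)).trans ((hXY p (hs p.2)).trans (hY _ (hs (hfm p))).symm)

end BallEquivalent

/-- The norm preserving map on the same rays as `f`. -/
noncomputable def radial (f : R4 → R4) (v : R4) : R4 := (‖v‖ / ‖f v‖) • f v

/-! ### Norm preserving versions of homogeneous homeomorphisms. -/

section Radial

variable {f g : R4 → R4}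

theorem map_zero_of_homogeneous (hf : ∀ (c : ℝ) (v : R4), 0 < c → f (c • v) = c • f v) :
    f 0 = 0 := by
  have := hf 2 0 two_pos
  rw [smul_zero, two_smul] at this
  simpa using this

theorem norm_radial (h0 : ∀ v, f v = 0 → v = 0) (v : R4) : ‖radial f v‖ = ‖v‖ := by
  rw [radial, norm_smul, norm_div, norm_norm, norm_norm]
  rcases eq_or_ne (f v) 0 with h | h
  · simp [h0 v h]
  · rw [div_mul_cancel₀ _ (norm_ne_zero_iff.2 h)]

/-- At the origin, where the quotient of norms is undefined, continuity follows from the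
preservation of the norm. -/
theorem continuous_radial (hf : Continuous f) (h0 : ∀ v, f v = 0 → v = 0) :
    Continuous (radial f) := by
  rw [continuous_iff_continuousAt]
  intro v
  rcases eq_or_ne v 0 with rfl | hv
  · have : radial f 0 = 0 := by simp [radial]
    rw [ContinuousAt, this, tendsto_zero_iff_norm_tendsto_zero]
    simp only [norm_radial h0]
    simpa using (continuous_norm (E := R4)).tendsto 0
  · have : ‖f v‖ ≠ 0 := norm_ne_zero_iff.2 fun h => hv (h0 v h)
    unfold radial
    exact (continuousAt_id.norm.div hf.continuousAt.norm this).smul hf.continuousAt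

/-- Homogeneous maps permute the rays from the origin, and on a ray the norm determines the point.
-/
theorem radial_radial
    (hg : ∀ (c : ℝ) (v : R4), 0 < c → g (c • v) = c • g v) (hgf : ∀ v, g (f v) = v)
    (h0 : ∀ v, f v = 0 → v = 0) (v : R4) : radial g (radial f v) = v := by
  rcases eq_or_ne v 0 with rfl | hv
  · simp [radial, map_zero_of_homogeneous hg]
  · have h1 : 0 < ‖v‖ := norm_pos_iff.2 hv
    have h2 : 0 < ‖f v‖ := norm_pos_iff.2 fun h => hv (h0 v h)
    have hc : 0 < ‖v‖ / ‖f v‖ := by positivity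
    rw [radial, norm_radial h0, radial, hg _ _ hc, hgf, norm_smul, Real.norm_of_nonneg hc.le,
      smul_smul]
    convert one_smul ℝ v using 2
    field_simp

end Radial

/-- A homeomorphism of `ℝ⁴`, homogeneous of degree one, which preserves the height and fixes the
cone over the square, gives an ambient equivalence of the surfaces. -/
theorem ballEquivalent_of_homogeneous {q β : ℝ} (hβ : 1 < β) (hq : β < q) {K K' : Set R3}
    {f g : R4 → R4} (hfc : Continuous f) (hgc : Continuous g) (hgf : ∀ v, g (f v) = v)
    (hfg : ∀ v, f (g v) = v) (hf : ∀ (c : ℝ) (v : R4), 0 < c → f (c • v) = c • f v)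
    (ht : ∀ v, f v 3 = v 3) (hs : ∀ p ∈ square, f (lift p) = lift p)
    (hK : ∀ p ∈ K, ∃ p' ∈ K', f (lift p) = lift p')
    (hK' : ∀ p' ∈ K', ∃ p ∈ K, f (lift p) = lift p') :
    BallEquivalent (Surf q β K) (Surf q β K') := by
  have hg : ∀ (c : ℝ) (v : R4), 0 < c → g (c • v) = c • g v := fun c v hc => by
    conv_lhs => rw [← hfg v, ← hf _ _ hc, hgf]
  have h0 : ∀ v, f v = 0 → v = 0 := fun v hv => by
    rw [← hgf v, hv, map_zero_of_homogeneous hg]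
  have h0' : ∀ v, g v = 0 → v = 0 := fun v hv => by
    rw [← hfg v, hv, map_zero_of_homogeneous hf]
  have hsq : ∀ p, f (lift p) = lift (proj (f (lift p))) := fun p => by
    have := smul_lift_proj (v := f (lift p)) (by simp [ht])
    rwa [ht, lift_three, one_smul, eq_comm] at this
  have hKiff : ∀ p, p ∈ K \ square ↔ proj (f (lift p)) ∈ K' \ square := by
    intro p
    have hss : proj (f (lift p)) ∈ square → p ∈ square := fun h => by
      have h1 := hs _ h
      rw [← hsq] at h1
      have h2 := congrArg g h1
      rw [hgf, hgf] at h2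
      rw [h2] at h
      rwa [proj_lift] at h
    have hss' : p ∈ square → proj (f (lift p)) ∈ square := fun h => by rwa [hs p h, proj_lift]
    refine and_congr ⟨fun h => ?_, fun h => ?_⟩ (not_congr ⟨hss', hss⟩)
    · obtain ⟨p', hp', e⟩ := hK p h
      rwa [e, proj_lift]
    · obtain ⟨p₁, hp₁, e⟩ := hK' _ h
      rw [← hsq] at e
      have h2 := congrArg g e
      rw [hgf, hgf] at h2
      rwa [← lift_injective h2]
  refine ⟨radial f, radial g, (continuous_radial hfc h0).continuousOn,
    (continuous_radial hgc h0').continuousOn, fun v _ => ⟨norm_radial h0 v, norm_radial h0' v,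
    radial_radial hg hgf h0 v, radial_radial hf hfg h0' v⟩, fun v hv => ?_⟩
  rcases eq_or_ne v 0 with rfl | hv0
  · simp [radial, Surf]
  have h1 : 0 < ‖v‖ := norm_pos_iff.2 hv0
  have h2 : 0 < ‖f v‖ := norm_pos_iff.2 fun h => hv0 (h0 v h)
  have hc : 0 < ‖v‖ / ‖f v‖ := by positivity
  have hr0 : radial f v ≠ 0 := by
    rw [← norm_pos_iff, norm_radial h0]; exact h1
  simp only [Surf, mem_ofPred_eq, hv0, hr0, false_or]
  have h3 : 0 < radial f v 3 ↔ 0 < v 3 := by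
    rw [radial]; simp [ht, hc]
  rw [h3]
  refine and_congr_right fun hv3 => ?_
  have hv1 : v 3 < 1 :=
    ((le_abs_self _).trans (abs_coord_le v 3)).trans_lt (mem_ball_zero_iff.1 hv)
  have hv' : radial f v 3 < 1 := by
    refine ((le_abs_self _).trans (abs_coord_le _ 3)).trans_lt ?_
    rw [norm_radial h0]; exact mem_ball_zero_iff.1 hv
  have hfv : f v = v 3 • f (lift (proj v)) := by rw [← hf _ _ hv3, smul_lift_proj hv3.ne']
  have hproj : proj (radial f v) = proj (f (lift (proj v))) := by
    rw [radial, proj_smul hc.ne', hfv, proj_smul hv3.ne']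
  -- In the cone over the square `f` is the identity and needs no rescaling, so `G` is preserved.
  -- Outside, membership depends only on the ray.
  by_cases hsv : v ∈ squareCone
  · have e : f v = v := by
      rw [hfv, hs _ ((proj_mem_square_iff hv3).2 hsv), smul_lift_proj hv3.ne']
    have e' : radial f v = v := by
      rw [radial, e, div_self h1.ne', one_smul]
    have hp := (proj_mem_square_iff hv3).2 hsv
    rw [e']
    simp [hp]
  · rw [hproj, ← hKiff]
    have h5 : v ∉ G q β := fun h => hsv (G_subset_squareCone hβ hq hv3 hv1 h)
    have h6 : radial f v ∉ G q β := fun h => by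
      have h7 := (proj_mem_square_iff (h3.2 hv3)).2 (G_subset_squareCone hβ hq (h3.2 hv3) hv' h)
      rw [hproj] at h7
      have h8 := hs _ h7
      rw [← hsq] at h8
      have h9 := congrArg g h8
      rw [hgf, hgf] at h9
      rw [h9, proj_lift, proj_mem_square_iff hv3] at h7
      exact hsv h7
    simp [h5, h6]

theorem IsDeformation.exists_coneMap {K₀ K : Set R3} (h : IsDeformation K₀ K) :
    ∃ (Φ : R3 ≃ₜ R3) (C C' : ℝ≥0), LipschitzWith C (coneMap Φ) ∧
      LipschitzWith C' (coneMap Φ.symm) ∧ (∀ p ∈ square, Φ p = p) ∧ K = Φ '' K₀ := by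
  obtain ⟨Φ, C, C', R, hC, hC', hs, hR, rfl⟩ := h
  obtain ⟨D, hD⟩ := exists_dist_coneMap_le hC hR
  obtain ⟨D', hD'⟩ := exists_dist_coneMap_le hC' (R := R) fun p hp => by
    conv_lhs => rw [← hR p hp]
    exact Φ.symm_apply_apply p
  exact ⟨Φ, D, D', hD, hD', hs, rfl⟩

theorem IsDeformation.ballEquivalent {q β : ℝ} (hβ : 1 < β) (hq : β < q) {K₀ K : Set R3}
    (h : IsDeformation K₀ K) : BallEquivalent (Surf q β K₀) (Surf q β K) := by
  obtain ⟨Φ, C, C', hC, hC', hs, rfl⟩ := h.exists_coneMap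
  have e : ∀ p, coneMap Φ (lift p) = lift (Φ p) := fun p => by
    rw [coneMap_of_pos (by simp), proj_lift, lift_three, one_smul]
  refine ballEquivalent_of_homogeneous hβ hq hC.continuous hC'.continuous
    (fun v => coneMap_coneMap fun _ => Φ.symm_apply_apply _)
    (fun v => coneMap_coneMap fun _ => Φ.apply_symm_apply _)
    (fun c v hc => coneMap_smul Φ hc v) (coneMap_three Φ) (fun p hp => by rw [e, hs p hp])
    (fun p hp => ⟨Φ p, ⟨p, hp, rfl⟩, e p⟩) ?_
  rintro _ ⟨p, hp, rfl⟩
  exact ⟨p, hp, e p⟩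

@[simp] theorem vec4_zero (a b c d : ℝ) : (!₂[a, b, c, d] : R4) 0 = a := rfl
@[simp] theorem vec4_one (a b c d : ℝ) : (!₂[a, b, c, d] : R4) 1 = b := rfl
@[simp] theorem vec4_two (a b c d : ℝ) : (!₂[a, b, c, d] : R4) 2 = c := rfl
@[simp] theorem vec4_three (a b c d : ℝ) : (!₂[a, b, c, d] : R4) 3 = d := rfl

theorem continuous_vec4 {X : Type*} [TopologicalSpace X] {a b c d : X → ℝ} (ha : Continuous a)
    (hb : Continuous b) (hc : Continuous c) (hd : Continuous d) :
    Continuous fun v => (!₂[a v, b v, c v, d v] : R4) := by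
  refine (PiLp.continuous_toLp 2 _).comp (continuous_pi fun i => ?_)
  fin_cases i <;> assumption

theorem continuousAt_vec4 {X : Type*} [TopologicalSpace X] {a b c d : X → ℝ} {x : X}
    (ha : ContinuousAt a x) (hb : ContinuousAt b x) (hc : ContinuousAt c x)
    (hd : ContinuousAt d x) : ContinuousAt (fun v => (!₂[a v, b v, c v, d v] : R4)) x := by
  refine (PiLp.continuous_toLp 2 _).continuousAt.comp (continuousAt_pi.2 fun i => ?_)
  fin_cases i <;> assumption

/-! ### Pulling the arcs of the model knot `K` to planar arcs -/

/-- `x` truncated to `[-t, t]`. -/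
noncomputable def trunc (t x : ℝ) : ℝ := max (-max 0 t) (min (max 0 t) x)

theorem trunc_cases (t x : ℝ) : (trunc t x = x ∧ |x| ≤ max 0 t) ∨
    (trunc t x = max 0 t ∧ max 0 t ≤ x) ∨ (trunc t x = -max 0 t ∧ x ≤ -max 0 t) := by
  have h0 := le_max_left 0 t
  rw [trunc]
  rcases le_total x (-max 0 t) with h | h
  · right; right
    exact ⟨by rw [min_eq_right (by linarith), max_eq_left h], h⟩
  rcases le_total x (max 0 t) with h' | h'
  · left
    exact ⟨by rw [min_eq_right h', max_eq_right h], abs_le.2 ⟨h, h'⟩⟩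
  · right; left
    exact ⟨by rw [min_eq_left h', max_eq_right (by linarith)], h'⟩

theorem trunc_mul (t x : ℝ) {c : ℝ} (hc : 0 < c) : trunc (c * t) (c * x) = c * trunc t x := by
  simp only [trunc, mul_max_of_nonneg _ _ hc.le, mul_min_of_nonneg _ _ hc.le, mul_neg, mul_zero]

/-- The homeomorphism which is `(x, y) ↦ (2 x - t, y - 2 (x - t))` for `x ≥ t`. -/
noncomputable def stretch (v : R4) : R4 :=
  !₂[2 * v 0 - trunc (v 3) (v 0), v 1 - 2 * max 0 (|v 0| - max 0 (v 3)), v 2, v 3]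

/-- The inverse of `stretch`. -/
noncomputable def stretchInv (v : R4) : R4 :=
  !₂[(v 0 + trunc (v 3) (v 0)) / 2, v 1 + max 0 (|v 0| - max 0 (v 3)), v 2, v 3]

theorem stretchInv_stretch (v : R4) : stretchInv (stretch v) = v := by
  have h0 := le_max_left 0 (v 3)
  refine R4.ext ?_ ?_ rfl rfl <;>
    simp only [stretch, stretchInv, vec4_zero, vec4_one,
        Matrix.cons_val, vec4_three]
  · rcases trunc_cases (v 3) (v 0) with ⟨h, h'⟩ | ⟨h, h'⟩ | ⟨h, h'⟩ <;>
      rcases trunc_cases (v 3) (2 * v 0 - trunc (v 3) (v 0)) with ⟨e, e'⟩ | ⟨e, e'⟩ | ⟨e, e'⟩ <;>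
      rw [e] <;> rw [h] at * <;> first | linarith | (rw [abs_le] at *; linarith)
  · rcases trunc_cases (v 3) (v 0) with ⟨h, h'⟩ | ⟨h, h'⟩ | ⟨h, h'⟩ <;>
      rw [h] <;> clear h <;> revert h0 h' <;> generalize max 0 (v 3) = m <;> intro h0 h'
    · rw [show 2 * v 0 - v 0 = v 0 by ring, max_eq_left (by linarith)]; ring
    · rw [abs_of_nonneg (by linarith), abs_of_nonneg (by linarith), max_eq_right (by linarith),
        max_eq_right (by linarith)]; ring
    · rw [abs_of_nonpos (by linarith), abs_of_nonpos (by linarith), max_eq_right (by linarith),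
        max_eq_right (by linarith)]; ring

theorem stretch_stretchInv (v : R4) : stretch (stretchInv v) = v := by
  have h0 := le_max_left 0 (v 3)
  refine R4.ext ?_ ?_ rfl rfl <;>
    simp only [stretch, stretchInv, vec4_zero, vec4_one,
        Matrix.cons_val, vec4_three]
  · rcases trunc_cases (v 3) (v 0) with ⟨h, h'⟩ | ⟨h, h'⟩ | ⟨h, h'⟩ <;>
      rcases trunc_cases (v 3) ((v 0 + trunc (v 3) (v 0)) / 2) with ⟨e, e'⟩ | ⟨e, e'⟩ | ⟨e, e'⟩ <;>
      rw [e] <;> rw [h] at * <;> first | linarith | (rw [abs_le] at *; linarith)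
  · rcases trunc_cases (v 3) (v 0) with ⟨h, h'⟩ | ⟨h, h'⟩ | ⟨h, h'⟩ <;>
      rw [h] <;> clear h <;> revert h0 h' <;> generalize max 0 (v 3) = m <;> intro h0 h'
    · rw [show (v 0 + v 0) / 2 = v 0 by ring, max_eq_left (by linarith)]; ring
    · rw [abs_of_nonneg (by linarith), abs_of_nonneg (by linarith), max_eq_right (by linarith),
        max_eq_right (by linarith)]; ring
    · rw [abs_of_nonpos (by linarith), abs_of_nonpos (by linarith), max_eq_right (by linarith),
        max_eq_right (by linarith)]; ring

theorem continuous_stretch : Continuous stretch := by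
  unfold stretch trunc
  apply continuous_vec4 <;> fun_prop

theorem continuous_stretchInv : Continuous stretchInv := by
  unfold stretchInv trunc
  apply continuous_vec4 <;> fun_prop

theorem stretch_smul (c : ℝ) (v : R4) (hc : 0 < c) : stretch (c • v) = c • stretch v := by
  refine R4.ext ?_ ?_ rfl rfl <;> simp [stretch, trunc_mul _ _ hc, abs_mul, abs_of_pos hc]
  · ring
  · have e : max 0 (c * v 3) = c * max 0 (v 3) := by rw [mul_max_of_nonneg _ _ hc.le, mul_zero]
    have e' : max 0 (c * |v 0| - c * max 0 (v 3)) = c * max 0 (|v 0| - max 0 (v 3)) := by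
      rw [mul_max_of_nonneg 0 (_ - _) hc.le, mul_zero, mul_sub]
    rw [e, e']; ring

theorem stretch_of_le {v : R4} (h : |v 0| ≤ v 3) : stretch v = v := by
  have h0 : 0 ≤ v 3 := (abs_nonneg _).trans h
  have := abs_le.1 h
  refine R4.ext ?_ ?_ rfl rfl <;> simp only [stretch, trunc, vec4_zero, vec4_one]
  · rw [max_eq_right h0, min_eq_right this.2, max_eq_right this.1]; ring
  · rw [max_eq_right h0, max_eq_left (by linarith)]; ring

/-- The height of the tent over the segment from `(1, -1)` to `(3, -2)`. -/
noncomputable def tent (v : R4) : ℝ := v 3 - |7 * v 0 - 2 * v 1 - 17 * v 3| / 8 - |v 2|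

/-- The coordinate in direction `(-1, -7/2)` from the line through `(1, -1)` and `(3, -2)`. -/
noncomputable def depth (v : R4) : ℝ := -(v 0 + 2 * v 1 + v 3) / 8

/-- The homeomorphism which pushes the segment from `(3, -2)` to `(1, -1)` to the two segments from
`(3, -2)` to `(1, -5)` and on to `(1, -1)`. -/
noncomputable def push (v : R4) : R4 :=
  let b := max 0 (min (tent v + 5 * depth v) (tent v - 2 / 3 * depth v))
  !₂[v 0 - b, v 1 - 7 / 2 * b, v 2, v 3]

/-- The inverse of `push`. -/
noncomputable def pushInv (v : R4) : R4 :=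
  let b := max 0 (min ((tent v + 5 * depth v) / 6) (3 * tent v - 2 * depth v))
  !₂[v 0 + b, v 1 + 7 / 2 * b, v 2, v 3]

theorem tent_add (v : R4) (b : ℝ) : tent !₂[v 0 + b, v 1 + 7 / 2 * b, v 2, v 3] = tent v := by
  simp only [tent, Matrix.cons_val_zero, Matrix.cons_val_one, Matrix.cons_val]
  rw [show 7 * (v 0 + b) - 2 * (v 1 + 7 / 2 * b) - 17 * v 3 = 7 * v 0 - 2 * v 1 - 17 * v 3 by ring]

theorem depth_add (v : R4) (b : ℝ) :
    depth !₂[v 0 + b, v 1 + 7 / 2 * b, v 2, v 3] = depth v - b := by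
  simp only [depth, Matrix.cons_val_zero, Matrix.cons_val_one, Matrix.cons_val]; ring

theorem push_eq (v : R4) : push v = !₂[
    v 0 + -max 0 (min (tent v + 5 * depth v) (tent v - 2 / 3 * depth v)),
    v 1 + 7 / 2 * -max 0 (min (tent v + 5 * depth v) (tent v - 2 / 3 * depth v)), v 2, v 3] := by
  refine R4.ext ?_ ?_ rfl rfl <;> simp only [push, vec4_zero, vec4_one, Matrix.cons_val_zero,
      Matrix.cons_val_one] <;> ring

/-- `push` is a shear along a direction in which `tent` is constant and `depth` is translated. It
thus reduces to the map `h ↦ h + max 0 (min (τ + 5 h) (τ - 2/3 h))` of one variable. For `τ > 0`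
this has slope `6` on `[-τ/5, 0]` and `1/3` on `[0, 3τ/2]`, and is the identity elsewhere; inverting
the two linear pieces gives the formula in `pushInv`. -/
theorem bump_inv (τ h : ℝ) :
    max 0 (min ((τ + 5 * (h + max 0 (min (τ + 5 * h) (τ - 2 / 3 * h)))) / 6)
      (3 * τ - 2 * (h + max 0 (min (τ + 5 * h) (τ - 2 / 3 * h))))) =
    max 0 (min (τ + 5 * h) (τ - 2 / 3 * h)) := by
  rcases max_cases 0 (min (τ + 5 * h) (τ - 2 / 3 * h)) with ⟨e, e'⟩ | ⟨e, e'⟩ <;> rw [e]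
  · rw [max_eq_left]
    rcases min_le_iff.1 e' with h' | h'
    · exact min_le_of_left_le (by linarith)
    · exact min_le_of_right_le (by linarith)
  · rcases le_total h 0 with h0 | h0
    · have m := min_eq_left (a := τ + 5 * h) (b := τ - 2 / 3 * h) (by linarith)
      rw [m] at e' ⊢
      rw [min_eq_left (by linarith), max_eq_right (by linarith)]; ring
    · have m := min_eq_right (a := τ + 5 * h) (b := τ - 2 / 3 * h) (by linarith)
      rw [m] at e' ⊢
      rw [min_eq_right (by linarith), max_eq_right (by linarith)]; ring

theorem bump_inv' (τ h : ℝ) :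
    max 0 (min (τ + 5 * (h - max 0 (min ((τ + 5 * h) / 6) (3 * τ - 2 * h))))
      (τ - 2 / 3 * (h - max 0 (min ((τ + 5 * h) / 6) (3 * τ - 2 * h))))) =
    max 0 (min ((τ + 5 * h) / 6) (3 * τ - 2 * h)) := by
  rcases max_cases 0 (min ((τ + 5 * h) / 6) (3 * τ - 2 * h)) with ⟨e, e'⟩ | ⟨e, e'⟩ <;> rw [e]
  · rw [max_eq_left]
    rcases min_le_iff.1 e' with h' | h'
    · exact min_le_of_left_le (by linarith)
    · exact min_le_of_right_le (by linarith)
  · rcases le_total h τ with h0 | h0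
    · have m := min_eq_left (a := (τ + 5 * h) / 6) (b := 3 * τ - 2 * h) (by linarith)
      rw [m] at e' ⊢
      rw [min_eq_left (by linarith), max_eq_right (by linarith)]; ring
    · have m := min_eq_right (a := (τ + 5 * h) / 6) (b := 3 * τ - 2 * h) (by linarith)
      rw [m] at e' ⊢
      rw [min_eq_right (by linarith), max_eq_right (by linarith)]; ring

theorem pushInv_push (v : R4) : pushInv (push v) = v := by
  rw [push_eq]
  set b := max 0 (min (tent v + 5 * depth v) (tent v - 2 / 3 * depth v)) with hb
  have := bump_inv (tent v) (depth v)
  rw [← hb] at this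
  refine R4.ext ?_ ?_ rfl rfl <;>
    simp only [pushInv, tent_add, depth_add, sub_neg_eq_add, this, vec4_zero, vec4_one,
        Matrix.cons_val_zero, Matrix.cons_val_one, Matrix.cons_val] <;> ring

theorem push_pushInv (v : R4) : push (pushInv v) = v := by
  rw [pushInv]
  set b := max 0 (min ((tent v + 5 * depth v) / 6) (3 * tent v - 2 * depth v)) with hb
  have := bump_inv' (tent v) (depth v)
  rw [← hb] at this
  refine R4.ext ?_ ?_ rfl rfl <;>
    simp only [push, tent_add, depth_add, this, vec4_zero, vec4_one, Matrix.cons_val_zero,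
        Matrix.cons_val_one, Matrix.cons_val] <;> ring

theorem continuous_push : Continuous push := by
  unfold push tent depth
  apply continuous_vec4 <;> fun_prop

theorem continuous_pushInv : Continuous pushInv := by
  unfold pushInv tent depth
  apply continuous_vec4 <;> fun_prop

theorem push_smul (c : ℝ) (v : R4) (hc : 0 < c) : push (c • v) = c • push v := by
  have h1 : tent (c • v) = c * tent v := by
    simp only [tent, PiLp.smul_apply, smul_eq_mul, abs_mul, abs_of_pos hc]
    rw [show 7 * (c * v 0) - 2 * (c * v 1) - 17 * (c * v 3) =
      c * (7 * v 0 - 2 * v 1 - 17 * v 3) by ring, abs_mul, abs_of_pos hc]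
    ring
  have h2 : depth (c • v) = c * depth v := by
    simp only [depth, PiLp.smul_apply, smul_eq_mul]; ring
  have h3 : max 0 (min (tent (c • v) + 5 * depth (c • v)) (tent (c • v) - 2 / 3 * depth (c • v))) =
      c * max 0 (min (tent v + 5 * depth v) (tent v - 2 / 3 * depth v)) := by
    rw [h1, h2, mul_max_of_nonneg _ _ hc.le, mul_min_of_nonneg _ _ hc.le, mul_zero]
    congr 2 <;> ring
  refine R4.ext ?_ ?_ rfl rfl <;> simp only [push, h3, vec4_zero, vec4_one, Matrix.cons_val_zero,
      Matrix.cons_val_one, PiLp.smul_apply,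
    smul_eq_mul] <;> ring

theorem push_eq_self {v : R4}
    (h : min (tent v + 5 * depth v) (tent v - 2 / 3 * depth v) ≤ 0) : push v = v := by
  refine R4.ext ?_ ?_ rfl rfl <;> simp only [push, max_eq_left h, vec4_zero, vec4_one] <;> ring

/-- The support of `push` stays in `x > t / 2`, so the push on one side and its mirror image do not
interfere. -/
theorem push_of_le_half {v : R4} (h : v 0 ≤ v 3 / 2) : push v = v := by
  refine push_eq_self (min_le_of_right_le ?_)
  simp only [tent, depth]
  have := abs_nonneg (v 2)
  rcases abs_cases (7 * v 0 - 2 * v 1 - 17 * v 3) with ⟨e, _⟩ | ⟨e, _⟩ <;> rw [e] <;> linarith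

theorem push_of_mem {v : R4} (h : v 0 ≤ v 3) (h' : -v 3 ≤ v 1) : push v = v := by
  have h1 : tent v ≤ 0 := by
    simp only [tent]
    have := abs_nonneg (v 2)
    linarith [neg_abs_le (7 * v 0 - 2 * v 1 - 17 * v 3)]
  refine push_eq_self ?_
  rcases le_total 0 (depth v) with h2 | h2
  · exact min_le_of_right_le (by linarith)
  · exact min_le_of_left_le (by linarith)

/-- The reflection in `x`. -/
noncomputable def reflect (v : R4) : R4 := !₂[-v 0, v 1, v 2, v 3]

@[simp] theorem reflect_reflect (v : R4) : reflect (reflect v) = v :=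
  R4.ext (by simp [reflect]) rfl rfl rfl

theorem continuous_reflect : Continuous reflect := by
  unfold reflect
  apply continuous_vec4 <;> fun_prop

theorem reflect_smul (c : ℝ) (v : R4) : reflect (c • v) = c • reflect v :=
  R4.ext (by simp [reflect]) rfl rfl rfl

/-- The homeomorphism from the cone over the model knot `K` to the cone over a planar polygon in
the position of the model knot `L`. -/
noncomputable def unfurl (v : R4) : R4 := reflect (push (reflect (push (stretch v))))

/-- The inverse of `unfurl`. -/
noncomputable def unfurlInv (v : R4) : R4 :=
  stretchInv (pushInv (reflect (pushInv (reflect v))))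

theorem reflect_lift (p : R3) : reflect (lift p) = lift !₂[-p 0, p 1, p 2] :=
  R4.ext rfl rfl rfl rfl

/-- The tip `(2, 0)` of the arc goes to `(3, -2)` and the ends `(1, ±1)` stay: the upper half of the
arc is already the first edge of the outer arc of the model knot `L`. -/
theorem stretch_kArc {ε y : ℝ} (hε : ε = 1 ∨ ε = -1) (hy : |y| ≤ 1) :
    stretch (lift (kArc ε y)) = lift !₂[ε * (3 - 2 * |y|), y - 2 * (1 - |y|), 0] := by
  refine R4.ext ?_ ?_ rfl rfl <;> simp only [stretch, kArc, lift_zero, lift_one, lift_three,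
    Matrix.cons_val_zero, Matrix.cons_val_one, vec4_zero,
      vec4_one, Matrix.cons_val_zero, Matrix.cons_val_one, abs_mul, abs_of_sign hε,
      max_eq_right zero_le_one]
  · rcases hε with rfl | rfl
    · rw [trunc, max_eq_right zero_le_one, min_eq_left (by linarith), max_eq_right (by norm_num)]
      ring
    · rw [trunc, max_eq_right zero_le_one, min_eq_right (by linarith), max_eq_left (by linarith)]
      ring
  · rw [abs_of_nonneg (by linarith : 0 ≤ 2 - |y|), max_eq_right (by linarith)]; ring

/-- The slope `5` of the bump is chosen so that `tent + 5 * depth ≤ 0` on this line, with equality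
near the tip `y = 0`: the edge runs along the boundary of the support. -/
theorem push_upper (y : ℝ) :
    push (lift !₂[3 - 2 * y, 3 * y - 2, 0]) = lift !₂[3 - 2 * y, 3 * y - 2, 0] := by
  refine push_eq_self (min_le_of_left_le ?_)
  simp only [tent, depth, lift_zero, lift_one, lift_two, lift_three,
      Matrix.cons_val_zero, Matrix.cons_val_one, Matrix.cons_val,
    abs_zero]
  rcases abs_cases (7 * (3 - 2 * y) - 2 * (3 * y - 2) - 17 * 1) with ⟨e, _⟩ | ⟨e, _⟩ <;> rw [e] <;>
    linarith

/-- Here `depth = 0`, so the bump equals `tent`. The midpoint `(2, -3/2)` of the edge moves to `(1,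
-5)`, which makes the outer arc and a straight inner strand out of one edge. -/
theorem push_lower {y : ℝ} (hy : -1 ≤ y) (hy1 : y ≤ 0) :
    push (lift !₂[3 + 2 * y, -y - 2, 0]) =
      lift !₂[3 + 2 * y - (1 - |1 + 2 * y|), -y - 2 - 7 / 2 * (1 - |1 + 2 * y|), 0] := by
  have h1 : tent (lift !₂[3 + 2 * y, -y - 2, 0]) = 1 - |1 + 2 * y| := by
    simp only [tent, lift_zero, lift_one, lift_two, lift_three,
        Matrix.cons_val_zero, Matrix.cons_val_one, Matrix.cons_val,
      abs_zero]
    rw [show 7 * (3 + 2 * y) - 2 * (-y - 2) - 17 * 1 = 8 * (1 + 2 * y) by ring, abs_mul]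
    norm_num
  have h2 : depth (lift !₂[3 + 2 * y, -y - 2, 0]) = 0 := by
    simp only [depth, lift_zero, lift_one, lift_three, Matrix.cons_val_zero,
        Matrix.cons_val_one]; ring
  have h3 : |1 + 2 * y| ≤ 1 := abs_le.2 ⟨by linarith, by linarith⟩
  refine R4.ext ?_ ?_ rfl rfl <;> simp only [push, h1, h2, mul_zero, add_zero, sub_zero, min_self,
    max_eq_right (sub_nonneg.2 h3), vec4_zero, vec4_one, Matrix.cons_val_zero, Matrix.cons_val_one,
      lift_zero, lift_one, Matrix.cons_val_zero,
      Matrix.cons_val_one]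

theorem unfurl_of_push {ε : ℝ} (hε : ε = 1 ∨ ε = -1) {v : R4} {x y x' y' : ℝ}
    (h : stretch v = lift !₂[ε * x, y, 0]) (hx : 1 ≤ x) (hx' : 1 ≤ x')
    (hp : push (lift !₂[x, y, 0]) = lift !₂[x', y', 0]) : unfurl v = lift !₂[ε * x', y', 0] := by
  rw [unfurl, h]
  rcases hε with rfl | rfl
  · rw [one_mul, one_mul, hp, push_of_le_half, reflect_reflect]
    simp [reflect]; linarith
  · rw [push_of_le_half (v := lift !₂[-1 * x, y, 0]) (by simp; linarith), reflect_lift]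
    simp only [Matrix.cons_val_zero, Matrix.cons_val_one, Matrix.cons_val,
        neg_mul, one_mul, neg_neg]
    rw [hp, reflect_lift]
    simp

theorem unfurl_kArc_upper {ε y : ℝ} (hε : ε = 1 ∨ ε = -1) (hy : 0 ≤ y) (hy1 : y ≤ 1) :
    unfurl (lift (kArc ε y)) = lift !₂[ε * (3 - 2 * y), 3 * y - 2, 0] := by
  refine unfurl_of_push hε (stretch_kArc hε (abs_le.2 ⟨by linarith, hy1⟩)) ?_ (by linarith) ?_
  · rw [abs_of_nonneg hy]; linarith
  · rw [abs_of_nonneg hy, show y - 2 * (1 - y) = 3 * y - 2 by ring]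
    exact push_upper y

theorem unfurl_kArc_lower {ε y : ℝ} (hε : ε = 1 ∨ ε = -1) (hy : -1 ≤ y) (hy1 : y ≤ 0) :
    unfurl (lift (kArc ε y)) = lift !₂[ε * (3 + 2 * y - (1 - |1 + 2 * y|)),
      -y - 2 - 7 / 2 * (1 - |1 + 2 * y|), 0] := by
  refine unfurl_of_push hε (stretch_kArc hε (abs_le.2 ⟨hy, by linarith⟩)) ?_ ?_ ?_
  · rw [abs_of_nonpos hy1]; linarith
  · rcases abs_cases (1 + 2 * y) with ⟨e, _⟩ | ⟨e, _⟩ <;> rw [e] <;> linarith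
  · rw [abs_of_nonpos hy1, show 3 - 2 * -y = 3 + 2 * y by ring,
      show y - 2 * (1 - -y) = -y - 2 by ring]
    exact push_lower hy hy1

theorem unfurl_of_mem {v : R4} (h : v ∈ squareCone) : unfurl v = v := by
  have h1 := abs_le.1 h.1
  have h2 := abs_le.1 h.2.1
  rw [unfurl, stretch_of_le h.1, push_of_mem h1.2 h2.1,
    push_of_mem (by simp [reflect]; linarith) (by simp [reflect]; linarith), reflect_reflect]

theorem lift_mem_squareCone {p : R3} (h : p ∈ square) : lift p ∈ squareCone := by
  rw [← proj_mem_square_iff (by simp)]; simpa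

/-- The two straight inner strands. -/
theorem ballEquivalent_unfurl {q β : ℝ} (hβ : 1 < β) (hq : β < q) :
    BallEquivalent (Surf q β modelK) (Surf q β (strands 1 0)) := by
  have hr : ∀ (c : ℝ) (v : R4), 0 < c → unfurl (c • v) = c • unfurl v := fun c v hc => by
    simp only [unfurl, stretch_smul c _ hc, push_smul c _ hc, reflect_smul]
  have hs : ∀ p ∈ square, unfurl (lift p) = lift p := fun p hp =>
    unfurl_of_mem (lift_mem_squareCone hp)
  refine ballEquivalent_of_homogeneous hβ hq (f := unfurl) (g := unfurlInv)
    (continuous_reflect.comp (continuous_push.comp (continuous_reflect.comp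
      (continuous_push.comp continuous_stretch))))
    (continuous_stretchInv.comp (continuous_pushInv.comp (continuous_reflect.comp
      (continuous_pushInv.comp continuous_reflect)))) (fun v => ?_) (fun v => ?_) hr
    (fun v => rfl) hs (fun p hp => ?_) (fun p hp => ?_)
  · simp [unfurl, unfurlInv, pushInv_push, stretchInv_stretch]
  · simp [unfurl, unfurlInv, push_pushInv, stretch_stretchInv]
  · rcases mem_modelK_union_square_iff.1 (Or.inl hp) with h | ⟨ε, y, hε, hy, rfl⟩
    · exact ⟨p, Or.inl (Or.inl ⟨h.2.2, h.1, (framed_modelK p h).1 hp⟩), hs p h⟩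
    have hy' := abs_le.1 hy
    rcases le_total 0 y with h | h
    · refine ⟨_, Or.inl (Or.inr ⟨rfl, ?_, ?_, ?_⟩), unfurl_kArc_upper hε h hy'.2⟩ <;>
        simp only [Matrix.cons_val_zero, Matrix.cons_val_one]
      · linarith
      · linarith
      · rw [abs_mul, abs_of_sign hε, abs_of_nonneg (by linarith),
          outer_of_ge (by linarith) (by linarith)]
        ring
    refine ⟨_, ?_, unfurl_kArc_lower hε hy'.1 h⟩
    rcases abs_cases (1 + 2 * y) with ⟨e, _⟩ | ⟨e, _⟩ <;> rw [e]
    · refine Or.inl (Or.inr ⟨rfl, ?_, ?_, ?_⟩) <;> simp only [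
        Matrix.cons_val_zero, Matrix.cons_val_one]
      · linarith
      · linarith
      · rw [abs_mul, abs_of_sign hε, abs_of_nonneg (by linarith),
          outer_of_le (by linarith) (by linarith)]
        ring
    · refine Or.inr ⟨?_, ?_, ?_⟩ <;> simp only [Matrix.cons_val_zero,
        Matrix.cons_val_one, Matrix.cons_val, Pi.one_apply,
        Pi.zero_apply, neg_zero, and_true]
      · linarith
      · linarith
      · rcases hε with rfl | rfl
        · left; ring
        · right; ring
  · have key : ∀ {ε y : ℝ}, ε = 1 ∨ ε = -1 → |y| ≤ 1 → kArc ε y ∈ modelK := fun hε hy => by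
      rcases mem_modelK_union_square_iff.2 (Or.inr ⟨_, _, hε, hy, rfl⟩) with h | h
      · exact h
      · refine (framed_modelK _ h).2 (le_antisymm hy ?_)
        have := h.1
        simp only [kArc, vec3_zero, vec3_one,
            abs_mul, abs_of_sign hε, one_mul] at this ⊢
        linarith [le_abs_self (2 - |‹ℝ›|)]
    rcases hp with (⟨hz, hx, hy⟩ | ⟨hz, hy, hy', hx⟩) | ⟨hy, hy', hp⟩
    · have h : p ∈ square := ⟨hx, hy.le, hz⟩
      exact ⟨p, (framed_modelK p h).2 hy, hs p h⟩
    · obtain ⟨ε, hε, hx⟩ : ∃ ε : ℝ, (ε = 1 ∨ ε = -1) ∧ p 0 = ε * outer (p 1) := by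
        rcases eq_or_eq_neg_of_abs_eq hx with h | h
        · exact ⟨1, Or.inl rfl, by linarith⟩
        · exact ⟨-1, Or.inr rfl, by linarith⟩
      -- The parameters of `kArc` invert `3 y - 2`, `6 y - 2` and, for the inner strand below, `-8 y
      -- - 9`: these are the `y`-coordinates on the three edges produced by `unfurl`.
      rcases le_total (-2) (p 1) with h | h
      · refine ⟨kArc ε ((p 1 + 2) / 3), key hε (abs_le.2 ⟨by linarith, by linarith⟩), ?_⟩
        rw [unfurl_kArc_upper hε (by linarith) (by linarith)]
        rw [outer_of_ge h hy'] at hx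
        congr 1
        refine R3.ext ?_ ?_ hz.symm <;> simp only [Matrix.cons_val_zero,
            Matrix.cons_val_one, hx] <;> ring
      · refine ⟨kArc ε ((p 1 + 2) / 6), key hε (abs_le.2 ⟨by linarith, by linarith⟩), ?_⟩
        rw [unfurl_kArc_lower hε (by linarith) (by linarith), abs_of_nonneg (by linarith)]
        rw [outer_of_le h hy] at hx
        congr 1
        refine R3.ext ?_ ?_ hz.symm <;> simp only [Matrix.cons_val_zero,
            Matrix.cons_val_one, hx] <;> ring
    · obtain ⟨ε, hε, hx, hz⟩ : ∃ ε : ℝ, (ε = 1 ∨ ε = -1) ∧ p 0 = ε ∧ p 2 = 0 := by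
        simp only [Pi.one_apply, Pi.zero_apply, neg_zero] at hp
        rcases hp with h | h
        · exact ⟨1, Or.inl rfl, h⟩
        · exact ⟨-1, Or.inr rfl, h⟩
      refine ⟨kArc ε (-(p 1 + 9) / 8), key hε (abs_le.2 ⟨by linarith, by linarith⟩), ?_⟩
      rw [unfurl_kArc_lower hε (by linarith) (by linarith), abs_of_nonpos (by linarith)]
      congr 1
      refine R3.ext ?_ ?_ hz.symm <;> simp only [Matrix.cons_val_zero,
          Matrix.cons_val_one, hx] <;> ring

/-! ### Rounding the inner strands of the model knot `L` -/

/-- The factor `b` will be a function of a direction, with no limit where the radius `r` vanishes;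
boundedness suffices there. -/
theorem continuous_mul_of_bounded {X : Type*} [TopologicalSpace X] {r b : X → ℝ}
    (hr : Continuous r) (hb : ∀ x, |b x| ≤ 1) (hc : ∀ x, r x ≠ 0 → ContinuousAt b x) :
    Continuous fun x => r x * b x := by
  rw [continuous_iff_continuousAt]
  intro x
  by_cases h : r x = 0
  · have h0 : Filter.Tendsto (fun x => |r x|) (𝓝 x) (𝓝 0) := by
      simpa [h] using (hr.abs.tendsto x)
    rw [ContinuousAt, h, zero_mul]
    refine squeeze_zero_norm (fun y => ?_) h0
    rw [Real.norm_eq_abs, abs_mul]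
    exact mul_le_of_le_one_right (abs_nonneg _) (hb y)
  · exact hr.continuousAt.mul (hc x h)

/-- `bend` maps the boundary of the unit ball of the norm `|x| + |z|` to the unit circle; this is
the first coordinate. -/
noncomputable def bend (x z : ℝ) : ℝ :=
  (|x| + |z|) * Real.sin (Real.pi / 2 * (x / (|x| + |z|)))

/-- The first coordinate of the inverse of `bend`. -/
noncomputable def unbend (x z : ℝ) : ℝ :=
  √(x ^ 2 + z ^ 2) * (2 / Real.pi * Real.arcsin (x / √(x ^ 2 + z ^ 2)))

theorem abs_two_div_pi_mul_arcsin_le (a : ℝ) : |2 / Real.pi * Real.arcsin a| ≤ 1 := by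
  have hp := Real.pi_pos
  rw [abs_mul, abs_of_pos (by positivity), div_mul_eq_mul_div, div_le_one hp]
  linarith [abs_le.2 ⟨Real.neg_pi_div_two_le_arcsin a, Real.arcsin_le_pi_div_two a⟩]

theorem continuous_bend {X : Type*} [TopologicalSpace X] {x z : X → ℝ} (hx : Continuous x)
    (hz : Continuous z) : Continuous fun v => bend (x v) (z v) := by
  refine continuous_mul_of_bounded (by fun_prop) (fun v => Real.abs_sin_le_one _) fun v hv => ?_
  have h1 : ContinuousAt (fun v => x v / (|x v| + |z v|)) v :=
    hx.continuousAt.div (by fun_prop) hv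
  fun_prop

theorem continuous_unbend {X : Type*} [TopologicalSpace X] {x z : X → ℝ} (hx : Continuous x)
    (hz : Continuous z) : Continuous fun v => unbend (x v) (z v) := by
  refine continuous_mul_of_bounded (by fun_prop) (fun v => abs_two_div_pi_mul_arcsin_le _)
    fun v hv => ?_
  have h1 : ContinuousAt (fun v => x v / √(x v ^ 2 + z v ^ 2)) v :=
    hx.continuousAt.div (by fun_prop) hv
  exact continuousAt_const.mul (Real.continuous_arcsin.continuousAt.comp h1)

/-- Since `|b| = 1 - |a|`, the two angles are complementary up to sign. -/
theorem sin_sq_add_sin_sq {a b : ℝ} (h : |a| + |b| = 1) :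
    Real.sin (Real.pi / 2 * a) ^ 2 + Real.sin (Real.pi / 2 * b) ^ 2 = 1 := by
  have e : ∀ c : ℝ, Real.sin (Real.pi / 2 * c) ^ 2 = Real.sin (Real.pi / 2 * |c|) ^ 2 := fun c => by
    rcases abs_choice c with h | h <;> rw [h]
    rw [mul_neg, Real.sin_neg, neg_sq]
  rw [e a, e b, show |b| = 1 - |a| by linarith, mul_sub, mul_one, Real.sin_pi_div_two_sub]
  exact Real.sin_sq_add_cos_sq _

theorem bend_sq_add_sq (x z : ℝ) : bend x z ^ 2 + bend z x ^ 2 = (|x| + |z|) ^ 2 := by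
  unfold bend
  rw [add_comm |z| |x|]
  rcases (add_nonneg (abs_nonneg x) (abs_nonneg z)).eq_or_lt with h | h
  · simp [← h]
  · rw [mul_pow, mul_pow, ← mul_add, sin_sq_add_sin_sq, mul_one]
    rw [abs_div, abs_div, abs_of_pos h, ← add_div, div_self h.ne']

theorem unbend_bend (x z : ℝ) : unbend (bend x z) (bend z x) = x := by
  have h0 := add_nonneg (abs_nonneg x) (abs_nonneg z)
  rw [unbend, bend_sq_add_sq, Real.sqrt_sq h0, bend]
  rcases h0.eq_or_lt with h | h
  · rw [← h, zero_mul]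
    exact (abs_eq_zero.1 (by linarith [abs_nonneg x, abs_nonneg z])).symm
  · have h1 : |x / (|x| + |z|)| ≤ 1 := by
      rw [abs_div, abs_of_pos h, div_le_one h]; linarith [abs_nonneg z]
    have h2 := abs_le.1 h1
    have hp := Real.pi_pos
    rw [mul_div_cancel_left₀ _ h.ne', Real.arcsin_sin (by nlinarith) (by nlinarith)]
    field_simp

theorem abs_arcsin (a : ℝ) : |Real.arcsin a| = Real.arcsin |a| := by
  rcases le_total 0 a with h | h
  · rw [abs_of_nonneg h, abs_of_nonneg (Real.arcsin_nonneg.2 h)]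
  · rw [abs_of_nonpos h, abs_of_nonpos (Real.arcsin_nonpos.2 h), Real.arcsin_neg]

theorem abs_arcsin_add {a b : ℝ} (h : a ^ 2 + b ^ 2 = 1) :
    |Real.arcsin a| + |Real.arcsin b| = Real.pi / 2 := by
  have hb : |b| = √(1 - |a| ^ 2) := by
    rw [sq_abs, show 1 - a ^ 2 = b ^ 2 by linarith, Real.sqrt_sq_eq_abs]
  rw [abs_arcsin, abs_arcsin, hb, ← Real.arccos_eq_arcsin (abs_nonneg a)]
  rw [Real.arccos]; ring

theorem abs_unbend_add (x z : ℝ) : |unbend x z| + |unbend z x| = √(x ^ 2 + z ^ 2) := by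
  unfold unbend
  have h0 := Real.sqrt_nonneg (x ^ 2 + z ^ 2)
  rw [add_comm (z ^ 2) (x ^ 2)]
  rcases h0.eq_or_lt with h | h
  · simp [← h]
  · have hp := Real.pi_pos
    have h1 : (x / √(x ^ 2 + z ^ 2)) ^ 2 + (z / √(x ^ 2 + z ^ 2)) ^ 2 = 1 := by
      rw [div_pow, div_pow, ← add_div, Real.sq_sqrt (by positivity), div_self]
      exact (Real.sqrt_pos.1 h).ne'
    rw [abs_mul, abs_mul, abs_mul, abs_mul, ← mul_add, ← mul_add, abs_arcsin_add h1, abs_of_pos h,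
      abs_of_pos (by positivity)]
    field_simp

theorem bend_unbend (x z : ℝ) : bend (unbend x z) (unbend z x) = x := by
  rw [bend, abs_unbend_add, unbend]
  have h0 := Real.sqrt_nonneg (x ^ 2 + z ^ 2)
  rcases h0.eq_or_lt with h | h
  · rw [← h, zero_mul]
    have := Real.sqrt_eq_zero'.1 h.symm
    nlinarith [sq_nonneg x, sq_nonneg z]
  · have h1 : |x / √(x ^ 2 + z ^ 2)| ≤ 1 := by
      rw [abs_div, abs_of_pos h, div_le_one h]
      exact Real.abs_le_sqrt (by nlinarith [sq_nonneg z])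
    have h2 := abs_le.1 h1
    have hp := Real.pi_pos
    rw [mul_div_cancel_left₀ _ h.ne', ← mul_assoc,
      show Real.pi / 2 * (2 / Real.pi) = 1 by field_simp, one_mul, Real.sin_arcsin h2.1 h2.2]
    field_simp

theorem bend_zero_right (x : ℝ) : bend x 0 = x := by
  rw [bend, abs_zero, add_zero]
  rcases lt_trichotomy x 0 with h | rfl | h
  · rw [abs_of_neg h, div_neg, div_self h.ne, mul_neg, Real.sin_neg]; simp
  · simp
  · rw [abs_of_pos h, div_self h.ne']; simp

theorem bend_zero_left (z : ℝ) : bend 0 z = 0 := by simp [bend]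

theorem bend_mul (x z : ℝ) {c : ℝ} (hc : 0 < c) : bend (c * x) (c * z) = c * bend x z := by
  rw [bend, bend, abs_mul, abs_mul, abs_of_pos hc, ← mul_add, mul_div_mul_left _ _ hc.ne',
      mul_assoc]

theorem bend_of_add_eq_one {x z : ℝ} (h : |x| + |z| = 1) :
    bend x z = Real.sin (Real.pi / 2 * x) := by simp [bend, h]

theorem bend_neg (x z : ℝ) : bend (-x) (-z) = -bend x z := by
  simp [bend, neg_div, mul_neg, Real.sin_neg]

/-- The homeomorphism which is `bend` in the `(x, z)`-planes. -/
noncomputable def rounding (v : R4) : R4 := !₂[bend (v 0) (v 2), v 1, bend (v 2) (v 0), v 3]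
/-- The inverse of `rounding`. -/
noncomputable def roundingInv (v : R4) : R4 := !₂[unbend (v 0) (v 2), v 1, unbend (v 2) (v 0), v 3]

/-- The `x`-coordinate of an inner strand wound around a circular cylinder. -/
noncomputable def circleX (y : ℝ) : ℝ := Real.cos (Real.pi / 2 * (y + 5))
/-- The `z`-coordinate of an inner strand wound around a circular cylinder. -/
noncomputable def circleZ (y : ℝ) : ℝ := Real.sin (Real.pi / 2 * (y + 5))

/-- Unit steps of the zigzag on the boundary of the ball of `|x| + |z|` become quarter turns of the
circle, so rounding yields exact helices. -/
theorem sin_strandX (y : ℝ) : Real.sin (Real.pi / 2 * strandX y) = circleX y := by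
  rw [circleX]
  rcases le_total y (-3) with h | h
  · rw [strandX_of_le h, ← Real.sin_pi_div_two_sub]; congr 1; ring
  · rw [strandX_of_ge h, ← Real.cos_sub_two_pi, ← Real.cos_pi_div_two_sub, ← Real.cos_neg]
    congr 1; ring

theorem sin_strandZ (y : ℝ) : Real.sin (Real.pi / 2 * strandZ y) = circleZ y := by
  rw [circleZ]
  rcases le_total y (-4) with h | h
  · rw [strandZ_of_le h]
  rcases le_total y (-2) with h' | h'
  · rw [strandZ_of_mem h h', ← Real.sin_pi_sub]; congr 1; ring
  · rw [strandZ_of_ge h', ← Real.sin_sub_two_pi (Real.pi / 2 * (y + 5))]; congr 1; ring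

theorem rounding_of_eq_zero {v : R4} (h : v 2 = 0) : rounding v = v := by
  refine R4.ext ?_ rfl ?_ rfl
  · simp [rounding, h, bend_zero_right]
  · simp [rounding, h, bend_zero_left]

theorem rounding_strand {ε y : ℝ} (hε : ε = 1 ∨ ε = -1) (hy : -5 ≤ y) (hy' : y ≤ -1) :
    rounding (lift !₂[ε * strandX y, y, ε * strandZ y]) =
      lift !₂[ε * circleX y, y, ε * circleZ y] := by
  have h := abs_strand_add hy hy'
  have h' : |strandZ y| + |strandX y| = 1 := by linarith
  refine R4.ext ?_ rfl ?_ rfl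
  · rcases hε with rfl | rfl <;> simp [rounding, bend_neg, bend_of_add_eq_one h, sin_strandX]
  · rcases hε with rfl | rfl <;> simp [rounding, bend_neg, bend_of_add_eq_one h', sin_strandZ]

theorem mem_strands_inner {c s : ℝ → ℝ} {ε y : ℝ} (hε : ε = 1 ∨ ε = -1) (hy : -5 ≤ y)
    (hy' : y ≤ -1) : !₂[ε * c y, y, ε * s y] ∈ strands c s := by
  refine Or.inr ⟨hy, hy', ?_⟩
  rcases hε with rfl | rfl <;> simp

theorem exists_of_mem_strands {c s : ℝ → ℝ} {p : R3} (hp : p ∈ strands c s) :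
    (p 2 = 0 ∧ ∀ c' s', p ∈ strands c' s') ∨
      ∃ ε y : ℝ, (ε = 1 ∨ ε = -1) ∧ -5 ≤ y ∧ y ≤ -1 ∧ p = !₂[ε * c y, y, ε * s y] := by
  rcases hp with hp | ⟨hy, hy', hp⟩
  · exact Or.inl ⟨by rcases hp with hp | hp <;> exact hp.1, fun _ _ => Or.inl hp⟩
  · refine Or.inr ?_
    rcases hp with ⟨h, h'⟩ | ⟨h, h'⟩
    · exact ⟨1, p 1, Or.inl rfl, hy, hy', R3.ext (by simp [h]) rfl (by simp [h'])⟩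
    · exact ⟨-1, p 1, Or.inr rfl, hy, hy', R3.ext (by simp [h]) rfl (by simp [h'])⟩

theorem ballEquivalent_rounding {q β : ℝ} (hβ : 1 < β) (hq : β < q) :
    BallEquivalent (Surf q β (strands strandX strandZ)) (Surf q β (strands circleX circleZ)) := by
  refine ballEquivalent_of_homogeneous hβ hq (f := rounding) (g := roundingInv) ?_ ?_
    (fun v => R4.ext (unbend_bend _ _) rfl (unbend_bend _ _) rfl)
    (fun v => R4.ext (bend_unbend _ _) rfl (bend_unbend _ _) rfl)
    (fun c v hc => R4.ext (bend_mul _ _ hc) rfl (bend_mul _ _ hc) rfl) (fun v => rfl)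
    (fun p hp => rounding_of_eq_zero hp.2.2) (fun p hp => ?_) (fun p hp => ?_)
  · exact continuous_vec4 (continuous_bend (by fun_prop) (by fun_prop)) (by fun_prop)
      (continuous_bend (by fun_prop) (by fun_prop)) (by fun_prop)
  · exact continuous_vec4 (continuous_unbend (by fun_prop) (by fun_prop)) (by fun_prop)
      (continuous_unbend (by fun_prop) (by fun_prop)) (by fun_prop)
  · rcases exists_of_mem_strands hp with ⟨h, h'⟩ | ⟨ε, y, hε, hy, hy', rfl⟩
    · exact ⟨p, h' _ _, rounding_of_eq_zero h⟩
    · exact ⟨_, mem_strands_inner hε hy hy', rounding_strand hε hy hy'⟩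
  · rcases exists_of_mem_strands hp with ⟨h, h'⟩ | ⟨ε, y, hε, hy, hy', rfl⟩
    · exact ⟨p, h' _ _, rounding_of_eq_zero h⟩
    · exact ⟨_, mem_strands_inner hε hy hy', rounding_strand hε hy hy'⟩

/-! ### Unwinding the inner strands of the model knot `L` -/

/-- The distance of `v` from the `(y, t)`-plane. -/
noncomputable def radius (v : R4) : ℝ := √(v 0 ^ 2 + v 2 ^ 2)

/-- The rotation by the angle `θ` in the `(x, z)`-planes. -/
noncomputable def rotate (θ : ℝ) (v : R4) : R4 :=
  !₂[Real.cos θ * v 0 - Real.sin θ * v 2, v 1, Real.sin θ * v 0 + Real.cos θ * v 2, v 3]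

/-- The angle of the rotation which winds the inner strands around each other: it is `0` or `2 π`
on `G`, and `0` on the outer arcs. -/
noncomputable def turn (q β : ℝ) (v : R4) : ℝ :=
  if v 3 ≤ 0 then 0 else 2 * Real.pi * max 0 (min 1 (min ((v 1 + 5 * v 3) / (4 * v 3))
    (min ((profile q β (v 3) (min (radius v) (v 3)) - v 1) /
        (2 * profile q β (v 3) (min (radius v) (v 3))))
      (2 * (v 3 * outer (v 1 / v 3) - radius v) / v 3))))

theorem rotate_three (θ : ℝ) (v : R4) : rotate θ v 3 = v 3 := rfl

theorem rotate_zero (v : R4) : rotate 0 v = v := by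
  refine R4.ext ?_ rfl ?_ rfl <;> simp [rotate]

theorem rotate_two_pi (v : R4) : rotate (2 * Real.pi) v = v := by
  refine R4.ext ?_ rfl ?_ rfl <;> simp [rotate]

theorem rotate_neg_rotate (θ : ℝ) (v : R4) : rotate (-θ) (rotate θ v) = v := by
  have h := Real.sin_sq_add_cos_sq θ
  refine R4.ext ?_ rfl ?_ rfl <;> simp [rotate]
  · linear_combination v 0 * h
  · linear_combination v 2 * h

theorem sq_add_sq_rotate (θ : ℝ) (v : R4) :
    rotate θ v 0 ^ 2 + rotate θ v 2 ^ 2 = v 0 ^ 2 + v 2 ^ 2 := by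
  have h := Real.sin_sq_add_cos_sq θ
  simp only [rotate, vec4_zero, vec4_two]
  linear_combination (v 0 ^ 2 + v 2 ^ 2) * h

theorem norm_rotate (θ : ℝ) (v : R4) : ‖rotate θ v‖ = ‖v‖ := by
  have h := sq_add_sq_rotate θ v
  simp only [EuclideanSpace.norm_eq, Fin.sum_univ_four, Real.norm_eq_abs, sq_abs]
  congr 1
  change _ + v 1 ^ 2 + _ + v 3 ^ 2 = _
  linarith

theorem radius_rotate (θ : ℝ) (v : R4) : radius (rotate θ v) = radius v := by
  rw [radius, sq_add_sq_rotate, radius]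

theorem turn_rotate (q β θ : ℝ) (v : R4) : turn q β (rotate θ v) = turn q β v := by
  rw [turn, radius_rotate]; rfl

theorem radius_of_eq_zero {v : R4} (h : v 2 = 0) : radius v = |v 0| := by
  rw [radius, h]; simp [Real.sqrt_sq_eq_abs]

section Turn

variable {q β : ℝ} {v : R4}

theorem turn_eq_zero (hβ : 1 < β) (hq : β < q) (h1 : v 3 < 1)
    (h : 0 < v 3 → v 1 ≤ -5 * v 3 ∨ profile q β (v 3) (min (radius v) (v 3)) ≤ v 1 ∨
      v 3 * outer (v 1 / v 3) ≤ radius v) : turn q β v = 0 := by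
  rw [turn]
  split_ifs with h0
  · rfl
  rw [not_le] at h0
  have hp := profile_pos hβ hq h0 h1 (min (radius v) (v 3))
  rw [max_eq_left, mul_zero]
  refine min_le_of_right_le ?_
  rcases h h0 with h | h | h
  · exact min_le_of_left_le (div_nonpos_of_nonpos_of_nonneg (by linarith) (by linarith))
  · exact min_le_of_right_le (min_le_of_left_le
      (div_nonpos_of_nonpos_of_nonneg (by linarith) (by linarith)))
  · exact min_le_of_right_le (min_le_of_right_le
      (div_nonpos_of_nonpos_of_nonneg (by linarith) (by linarith)))

theorem norm_le_radius (v : R4) : ‖v‖ ≤ 2 * radius v + |v 1| + |v 3| := by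
  have h0 : |v 0| ≤ radius v := Real.abs_le_sqrt (by nlinarith [sq_nonneg (v 2)])
  have h2 : |v 2| ≤ radius v := Real.abs_le_sqrt (by nlinarith [sq_nonneg (v 0)])
  linarith [norm_le_sum4 v]

theorem turn_of_lt_norm (hβ : 1 < β) (hq : β < q) (h1 : v 3 < 1) (h : 12 * v 3 < ‖v‖) :
    turn q β v = 0 := by
  refine turn_eq_zero hβ hq h1 fun h0 => ?_
  -- Where the angle is nonzero, `|x|` and `|z|` are below `3 t` and `|y|` below `5 t`; hence `12 =
  -- 3 + 3 + 5 + 1`.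
  by_contra! hc
  obtain ⟨ha, hb, hc⟩ := hc
  have h2 := profile_le hβ hq h0 h1 (min_le_right (radius v) (v 3))
  have h3 := mul_le_mul_of_nonneg_left (outer_le (v 1 / v 3)) h0.le
  have h4 : |v 1| ≤ 5 * v 3 := abs_le.2 ⟨by linarith, by linarith⟩
  have h5 := norm_le_radius v
  rw [abs_of_pos h0] at h5
  linarith

/-- On `G` the radius is `|x|`, so the third term in `turn` compares `y` with the two sheets `y =
±profile`. It is `0` on the upper and `1` on the lower sheet, where the remaining terms are at least
`1`. The angle is therefore a multiple of `2π`, and the whole return of the twist takes place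
between the sheets. -/
theorem rotate_turn_of_mem_G (hβ : 1 < β) (hq : β < q) (h0 : 0 < v 3) (h1 : v 3 < 1)
    (h : v ∈ G q β) : rotate (turn q β v) v = v ∧ rotate (-turn q β v) v = v := by
  obtain ⟨hz, hx, hy⟩ := (mem_G_iff hβ hq h0 h1).1 h
  have hr := radius_of_eq_zero hz
  have hm : min (radius v) (v 3) = |v 0| := by rw [hr, min_eq_left hx]
  have hp := profile_pos hβ hq h0 h1 |v 0|
  have hp1 := profile_le hβ hq h0 h1 hx
  suffices turn q β v = 0 ∨ turn q β v = 2 * Real.pi by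
    rcases this with h | h <;> rw [h]
    · rw [neg_zero, rotate_zero]; exact ⟨rfl, rfl⟩
    · refine ⟨rotate_two_pi v, ?_⟩
      conv_lhs => rw [← rotate_two_pi v, rotate_neg_rotate]
  rcases abs_eq hp.le |>.1 hy with hy | hy
  · exact Or.inl (turn_eq_zero hβ hq h1 fun _ => Or.inr (Or.inl (by rw [hm, hy])))
  · right
    rw [turn, if_neg h0.not_ge, hm, hr, hy, min_eq_left, max_eq_right zero_le_one, mul_one]
    have e1 : -1 ≤ -profile q β (v 3) |v 0| / v 3 := by rw [le_div_iff₀ h0]; linarith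
    have e2 : -profile q β (v 3) |v 0| / v 3 ≤ 0 :=
      div_nonpos_of_nonpos_of_nonneg (by linarith) h0.le
    refine le_min ?_ (le_min ?_ ?_)
    · rw [le_div_iff₀ (by linarith)]; linarith
    · rw [le_div_iff₀ (by linarith)]; linarith
    · rw [le_div_iff₀ h0, outer_of_ge (by linarith) (by linarith)]
      nlinarith

/-- At radius `t` and `-5 ≤ y / t ≤ -1` the first linear term is the smallest one: the angle is
exactly that of the helix `(circleX, circleZ)`. -/
theorem turn_of_inner (hβ : 1 < β) (h0 : 0 < v 3) (h1 : v 3 < 1)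
    (hr : radius v = v 3) (hy : -5 ≤ v 1 / v 3) (hy' : v 1 / v 3 ≤ -1) :
    turn q β v = Real.pi / 2 * (v 1 / v 3 + 5) := by
  have e : (v 1 + 5 * v 3) / (4 * v 3) = (v 1 / v 3 + 5) / 4 := by field_simp
  rw [turn, if_neg h0.not_ge, hr, min_self, profile_self hβ h0 h1, e]
  have hy'' := hy'
  rw [div_le_iff₀ h0] at hy''
  rw [min_eq_right, min_eq_left, max_eq_right]
  · ring
  · linarith
  · refine le_min ?_ ?_
    · rw [le_div_iff₀ (by linarith)]
      nlinarith
    · rw [le_div_iff₀ h0]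
      rcases le_total (v 1 / v 3) (-2) with h | h
      · rw [outer_of_le h hy]; nlinarith
      · rw [outer_of_ge h (by linarith)]; nlinarith
  · exact min_le_of_left_le (by linarith)

theorem continuousAt_profile {X : Type*} [TopologicalSpace X] {t a : X → ℝ} {x : X} (hβ : 1 < β)
    (h0 : 0 < t x) (h1 : t x < 1) (ht : ContinuousAt t x) (ha : ContinuousAt a x) :
    ContinuousAt (fun x => profile q β (t x) (a x)) x := by
  have hb := rpow_lt_self_of_lt_one hβ h0 h1
  have e1 : ∀ r : ℝ, ContinuousAt (fun x => t x ^ r) x := fun r =>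
    ht.rpow_const (Or.inl h0.ne')
  have e2 : ContinuousAt (fun x => slope q β (t x)) x :=
    (ht.sub (e1 q)).div (ht.sub (e1 β)) (by linarith)
  exact (e1 q).add ((continuousAt_const.max (ha.sub (e1 β))).mul e2)

theorem continuousAt_turn (hβ : 1 < β) (hq : β < q) (h0 : 0 < v 3) (h1 : v 3 < 1) :
    ContinuousAt (turn q β) v := by
  have hr : ContinuousAt radius v := by unfold radius; fun_prop
  have hc : ∀ i, ContinuousAt (fun v : R4 => v i) v := fun i => by fun_prop
  have hp : ContinuousAt (fun v : R4 => profile q β (v 3) (min (radius v) (v 3))) v :=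
    continuousAt_profile hβ h0 h1 (hc 3) (hr.min (hc 3))
  have hp0 := profile_pos hβ hq h0 h1 (min (radius v) (v 3))
  have ho : Continuous outer := by unfold outer; fun_prop
  have ho' : ContinuousAt (fun v : R4 => outer (v 1 / v 3)) v :=
    ho.continuousAt.comp ((hc 1).div (hc 3) h0.ne')
  refine ContinuousAt.congr (f := fun v : R4 => 2 * Real.pi * max 0 (min 1 (min
    ((v 1 + 5 * v 3) / (4 * v 3)) (min ((profile q β (v 3) (min (radius v) (v 3)) - v 1) /
        (2 * profile q β (v 3) (min (radius v) (v 3))))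
      (2 * (v 3 * outer (v 1 / v 3) - radius v) / v 3))))) ?_ ?_
  · refine continuousAt_const.mul (continuousAt_const.max (continuousAt_const.min
      (Filter.Tendsto.min ?_ (Filter.Tendsto.min ?_ ?_))))
    · exact ((hc 1).add ((hc 3).const_mul 5)).div ((hc 3).const_mul 4) (by linarith)
    · exact (hp.sub (hc 1)).div (hp.const_mul 2) (by linarith)
    · exact (((((hc 3).mul ho').sub hr)).const_mul 2).div (hc 3) h0.ne'
  · filter_upwards [(hc 3).eventually (lt_mem_nhds h0)] with w hw
    rw [turn, if_neg (not_le.2 hw)]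

/-- For `t > 0` the angle is continuous; at the origin it need not be, but rotations are isometries.
At other points with `t ≤ 0` the rotation is trivial nearby by `turn_of_lt_norm`. -/
theorem continuousAt_rotate_turn (hβ : 1 < β) (hq : β < q) (h1 : ‖v‖ < 1) {σ : ℝ} :
    ContinuousAt (fun v => rotate (σ * turn q β v) v) v := by
  have h3 : v 3 < 1 := ((le_abs_self _).trans (abs_coord_le v 3)).trans_lt h1
  rcases lt_or_ge 0 (v 3) with h0 | h0
  · have ht := (continuousAt_turn hβ hq h0 h3).const_mul σ
    have hc : ∀ i, ContinuousAt (fun v : R4 => v i) v := fun i => by fun_prop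
    have hcos := Real.continuous_cos.continuousAt.comp ht
    have hsin := Real.continuous_sin.continuousAt.comp ht
    exact continuousAt_vec4 ((hcos.mul (hc 0)).sub (hsin.mul (hc 2))) (hc 1)
      ((hsin.mul (hc 0)).add (hcos.mul (hc 2))) (hc 3)
  rcases eq_or_ne v 0 with rfl | hv
  · have : rotate (σ * turn q β 0) 0 = 0 := by
      rw [← norm_eq_zero, norm_rotate, norm_zero]
    rw [ContinuousAt, this, tendsto_zero_iff_norm_tendsto_zero]
    simp only [norm_rotate]
    simpa using (continuous_norm (E := R4)).tendsto 0
  · refine continuousAt_id.congr ?_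
    have h4 : 12 * v 3 < ‖v‖ := by linarith [norm_pos_iff.2 hv]
    have c1 : ContinuousAt (fun v : R4 => ‖v‖ - 12 * v 3) v := by fun_prop
    have c2 : ContinuousAt (fun v : R4 => 1 - v 3) v := by fun_prop
    filter_upwards [c1.eventually (lt_mem_nhds (sub_pos.2 h4)),
      c2.eventually (lt_mem_nhds (sub_pos.2 h3))] with w hw hw'
    rw [turn_of_lt_norm hβ hq (sub_pos.1 hw') (sub_pos.1 hw), mul_zero, rotate_zero, id]

end Turn

theorem radius_smul_lift {t : ℝ} (ht : 0 ≤ t) (p : R3) :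
    radius (t • lift p) = t * √(p 0 ^ 2 + p 2 ^ 2) := by
  rw [radius]
  simp only [PiLp.smul_apply, smul_eq_mul, lift_zero, lift_two]
  rw [mul_pow, mul_pow, ← mul_add, Real.sqrt_mul (sq_nonneg t), Real.sqrt_sq ht]

theorem rotate_smul_lift (θ t : ℝ) (p : R3) : rotate θ (t • lift p) = t •
    lift !₂[Real.cos θ * p 0 - Real.sin θ * p 2, p 1, Real.sin θ * p 0 + Real.cos θ * p 2] := by
  refine R4.ext ?_ rfl ?_ rfl <;> simp [rotate] <;> ring

theorem proj_rotate {v : R4} (h : v 3 ≠ 0) (θ : ℝ) : proj (rotate θ v) =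
    !₂[Real.cos θ * proj v 0 - Real.sin θ * proj v 2, proj v 1,
      Real.sin θ * proj v 0 + Real.cos θ * proj v 2] := by
  conv_lhs => rw [← smul_lift_proj h, rotate_smul_lift, proj_smul h, proj_lift]

/-- The sign `σ` treats winding and unwinding at once. `G` and the outer arcs are fixed, and the
inner strands lie at radius `t`, where the angle is known. -/
theorem rotate_turn_mem_Surf {q β σ : ℝ} (hβ : 1 < β) (hq : β < q) (hσ : σ = 1 ∨ σ = -1)
    {c s c' s' : ℝ → ℝ} (hcs : ∀ y, c y ^ 2 + s y ^ 2 = 1)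
    (hc : ∀ y, Real.cos (σ * (Real.pi / 2 * (y + 5))) * c y
      - Real.sin (σ * (Real.pi / 2 * (y + 5))) * s y = c' y)
    (hs : ∀ y, Real.sin (σ * (Real.pi / 2 * (y + 5))) * c y
      + Real.cos (σ * (Real.pi / 2 * (y + 5))) * s y = s' y)
    (hs1 : s (-1) = 0)
    {v : R4} (h1 : v 3 < 1) (h : v ∈ Surf q β (strands c s)) :
    rotate (σ * turn q β v) v ∈ Surf q β (strands c' s') := by
  rcases h with rfl | ⟨h0, h⟩
  · left
    rw [← norm_eq_zero, norm_rotate, norm_zero]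
  refine Or.inr ⟨h0, ?_⟩
  rcases h with h | ⟨h, h'⟩
  · left
    obtain ⟨e, e'⟩ := rotate_turn_of_mem_G hβ hq h0 h1 h
    rcases hσ with rfl | rfl
    · rwa [one_mul, e]
    · rwa [neg_one_mul, e']
  right
  have hv := smul_lift_proj h0.ne'
  rcases h with (⟨hz, hx, hy⟩ | ⟨hz, hy, hy', hx⟩) | ⟨hy, hy', hp⟩
  · exact absurd ⟨hx, hy.le, hz⟩ h'
  · have : turn q β v = 0 := by
      refine turn_eq_zero hβ hq h1 fun _ => Or.inr (Or.inr ?_)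
      rw [← hv, radius_smul_lift h0.le, hz]
      simp only [ne_eq, OfNat.ofNat_ne_zero, not_false_eq_true, zero_pow, add_zero,
        Real.sqrt_sq_eq_abs, hx]
      rw [hv, proj_one]
    rw [this, mul_zero, rotate_zero]
    exact ⟨Or.inl (Or.inr ⟨hz, hy, hy', hx⟩), h'⟩
  · obtain ⟨ε, hε, hx, hz⟩ : ∃ ε : ℝ, (ε = 1 ∨ ε = -1) ∧ proj v 0 = ε * c (proj v 1) ∧
        proj v 2 = ε * s (proj v 1) := by
      rcases hp with ⟨h, h'⟩ | ⟨h, h'⟩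
      · exact ⟨1, Or.inl rfl, by linarith, by linarith⟩
      · exact ⟨-1, Or.inr rfl, by linarith, by linarith⟩
    have hε2 : ε ^ 2 = 1 := by rcases hε with rfl | rfl <;> norm_num
    have hr : radius v = v 3 := by
      rw [← hv, radius_smul_lift h0.le, hx, hz, mul_pow, mul_pow, ← mul_add, hcs, hε2]
      simp
    have e : proj (rotate (σ * turn q β v) v) =
        !₂[ε * c' (proj v 1), proj v 1, ε * s' (proj v 1)] := by
      rw [proj_rotate h0.ne', turn_of_inner hβ h0 h1 hr hy hy', ← proj_one, hx, hz]
      refine R3.ext ?_ ?_ ?_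
      · simp only [Matrix.cons_val_zero, ← hc]; ring
      · simp
      · simp only [Matrix.cons_val, ← hs]; ring
    rw [e]
    refine ⟨mem_strands_inner hε hy hy', fun hsq => h' ?_⟩
    -- The rotated strand can meet the square only at its end `y = -1`. There `s (-1) = 0` puts the
    -- original point in the square too, contrary to `h'`.
    have hy1 : proj v 1 = -1 := le_antisymm hy' (abs_le.1 hsq.2.1).1
    refine ⟨?_, by rw [hy1]; norm_num, ?_⟩
    · rw [hx, hy1, abs_mul, abs_of_sign hε, one_mul, ← sq_le_one_iff_abs_le_one]
      nlinarith [hcs (-1)]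
    · rw [hz, hy1, hs1, mul_zero]

theorem ballEquivalent_rotate {q β : ℝ} (hβ : 1 < β) (hq : β < q) :
    BallEquivalent (Surf q β (strands 1 0)) (Surf q β (strands circleX circleZ)) := by
  have hsc : ∀ y, circleX y ^ 2 + circleZ y ^ 2 = 1 := fun y => Real.cos_sq_add_sin_sq _
  have h1 : circleZ (-1) = 0 := by
    rw [circleZ, show Real.pi / 2 * (-1 + 5) = 2 * Real.pi by ring, Real.sin_two_pi]
  have hh : ∀ {v : R4}, v ∈ Metric.ball (0 : R4) 1 → v 3 < 1 := fun {v} hv =>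
    ((le_abs_self _).trans (abs_coord_le v 3)).trans_lt (mem_ball_zero_iff.1 hv)
  have inv : ∀ v, rotate (-1 * turn q β (rotate (1 * turn q β v) v))
      (rotate (1 * turn q β v) v) = v := fun v => by
    rw [turn_rotate, one_mul, neg_one_mul, rotate_neg_rotate]
  have inv' : ∀ v, rotate (1 * turn q β (rotate (-1 * turn q β v) v))
      (rotate (-1 * turn q β v) v) = v := fun v => by
    rw [turn_rotate, one_mul, neg_one_mul]
    conv_lhs => rw [← neg_neg (turn q β v), neg_neg (-turn q β v), rotate_neg_rotate]
  refine ⟨fun v => rotate (1 * turn q β v) v, fun v => rotate (-1 * turn q β v) v,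
    fun v hv => (continuousAt_rotate_turn hβ hq (mem_ball_zero_iff.1 hv)).continuousWithinAt,
    fun v hv => (continuousAt_rotate_turn hβ hq (mem_ball_zero_iff.1 hv)).continuousWithinAt,
    fun v _ => ⟨norm_rotate _ v, norm_rotate _ v, inv v, inv' v⟩, fun v hv => ⟨fun h => ?_,
    fun h => ?_⟩⟩
  · refine rotate_turn_mem_Surf hβ hq (Or.inl rfl) (c := 1) (s := 0) (fun y => by simp)
      (fun y => ?_) (fun y => ?_) rfl (hh hv) h
    · rw [one_mul, Pi.one_apply, Pi.zero_apply, circleX]; ring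
    · rw [one_mul, Pi.one_apply, Pi.zero_apply, circleZ]; ring
  · have := rotate_turn_mem_Surf hβ hq (Or.inr rfl) (c := circleX) (s := circleZ) (c' := 1)
      (s' := 0) hsc (fun y => ?_) (fun y => ?_) h1 (v := rotate (1 * turn q β v) v)
      ((rotate_three _ v).trans_lt (hh hv)) h
    · rwa [inv] at this
    · rw [neg_one_mul, Real.cos_neg, Real.sin_neg, circleX, circleZ, Pi.one_apply,
        ← Real.cos_sq_add_sin_sq (Real.pi / 2 * (y + 5))]
      ring
    · rw [neg_one_mul, Real.cos_neg, Real.sin_neg, circleX, circleZ, Pi.zero_apply]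
      ring

theorem ballEquivalent_model {q β : ℝ} (hβ : 1 < β) (hq : β < q) :
    BallEquivalent (Surf q β modelK) (Surf q β modelL) := by
  rw [modelL_eq]
  exact (ballEquivalent_unfurl hβ hq).trans
    ((ballEquivalent_rotate hβ hq).trans (ballEquivalent_rounding hβ hq).symm)

/-! ### The cone-like surface over the model knot `K` -/

/-- At height `t`, the surface of the model knot `K` is the curve `|y| = sheet q β t |x|`,
`|x| ≤ 2 t`. -/
noncomputable def sheet (q β t a : ℝ) : ℝ := min (profile q β t a) (2 * t - a)

/-- The surface of the model knot `K` without the origin. -/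
def Hexagon (q β : ℝ) : Set R4 :=
  {v | 0 < v 3 ∧ v 2 = 0 ∧ |v 0| ≤ 2 * v 3 ∧ |v 1| = sheet q β (v 3) |v 0|}

/-- The point over `(x, t)` on the sheet of the sign `ε`. -/
noncomputable def sheetMap (q β ε : ℝ) (p : ℝ × ℝ) : R4 :=
  !₂[p.1, ε * sheet q β p.2 |p.1|, 0, p.2]

section Hexagon

variable {q β : ℝ}

theorem sheet_of_le (hβ : 1 < β) (hq : β < q) {t a : ℝ} (h0 : 0 < t) (h1 : t < 1) (h : a ≤ t) :
    sheet q β t a = profile q β t a :=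
  min_eq_left (by linarith [profile_le hβ hq h0 h1 h])

theorem sheet_of_ge (hβ : 1 < β) (hq : β < q) {t a : ℝ} (h0 : 0 < t) (h1 : t < 1) (h : t ≤ a) :
    sheet q β t a = 2 * t - a :=
  min_eq_right (by linarith [profile_mono hβ hq h0 h1 h, profile_self (q := q) hβ h0 h1])

theorem sheet_nonneg (hβ : 1 < β) (hq : β < q) {t a : ℝ} (h0 : 0 < t) (h1 : t < 1)
    (h : a ≤ 2 * t) : 0 ≤ sheet q β t a :=
  le_min (profile_pos hβ hq h0 h1 a).le (by linarith)

theorem sheet_pos (hβ : 1 < β) (hq : β < q) {t a : ℝ} (h0 : 0 < t) (h1 : t < 1)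
    (h : a < 2 * t) : 0 < sheet q β t a :=
  lt_min (profile_pos hβ hq h0 h1 a) (by linarith)

theorem sheet_le (hβ : 1 < β) (hq : β < q) {t a : ℝ} (h0 : 0 < t) (h1 : t < 1) :
    sheet q β t a ≤ t := by
  rcases le_total a t with h | h
  · rw [sheet_of_le hβ hq h0 h1 h]; exact profile_le hβ hq h0 h1 h
  · rw [sheet_of_ge hβ hq h0 h1 h]; linarith

/-- Up to an error `t^β` the sheet is the homogeneous tent `min a (2 t - a)`. This replaces a
Lipschitz estimate for `sheet` jointly in `x` and `t`. -/
theorem abs_sheet_sub_le (hβ : 1 < β) (hq : β < q) {t a : ℝ} (h0 : 0 < t) (h1 : t < 1)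
    (ha : 0 ≤ a) : |sheet q β t a - min a (2 * t - a)| ≤ t ^ β := by
  have hb := Real.rpow_pos_of_pos h0 β
  have hqb := rpow_q_lt_rpow_β hq h0 h1
  rcases le_total a t with h | h
  · rw [sheet_of_le hβ hq h0 h1 h, min_eq_left (by linarith)]
    rcases le_total a (t ^ β) with h' | h'
    · rw [profile_of_le h']
      have := Real.rpow_pos_of_pos h0 q
      exact abs_le.2 ⟨by linarith, by linarith⟩
    · have h2 := sub_le_profile hβ hq h0 h1 a
      have h3 : profile q β t a = t - (t - a) * slope q β t := by
        rw [profile_of_ge h']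
        linear_combination slope_mul (q := q) hβ h0 h1
      have h4 : t - a ≤ (t - a) * slope q β t :=
        le_mul_of_one_le_right (by linarith) (one_le_slope hβ hq h0 h1)
      have := Real.rpow_pos_of_pos h0 q
      exact abs_le.2 ⟨by linarith, by linarith⟩
  · rw [sheet_of_ge hβ hq h0 h1 h, min_eq_right (by linarith), sub_self, abs_zero]
    exact hb.le

theorem mem_Surf_modelK_iff (hβ : 1 < β) (hq : β < q) {v : R4} (h1 : v 3 < 1) :
    v ∈ Surf q β modelK ↔ v = 0 ∨ v ∈ Hexagon q β := by
  refine or_congr_right (and_congr_right fun h0 => ?_)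
  rw [mem_G_iff hβ hq h0 h1, mem_sdiff, proj_mem_square_iff h0, mem_modelK_iff]
  simp only [squareCone, mem_ofPred_eq, proj_zero, proj_one, proj_two, abs_div, abs_of_pos h0,
    div_le_iff₀ h0, div_eq_zero_iff, h0.ne', or_false]
  rcases le_or_gt |v 0| (v 3) with h | h
  · rw [sheet_of_le hβ hq h0 h1 h]
    constructor
    · rintro (⟨hz, -, hy⟩ | ⟨⟨hz, -, hy⟩, h'⟩)
      · exact ⟨hz, by linarith, hy⟩
      · refine absurd ⟨h, ?_, hz⟩ h'
        have := hy.trans_le (min_le_left _ _)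
        rwa [div_le_one h0] at this
    · rintro ⟨hz, -, hy⟩
      exact Or.inl ⟨hz, h, hy⟩
  · rw [sheet_of_ge hβ hq h0 h1 h.le]
    have e : min 1 (2 - |v 0| / v 3) = 2 - |v 0| / v 3 :=
      min_eq_right (by linarith [(one_lt_div h0).2 h])
    have e' : |v 1| / v 3 = 2 - |v 0| / v 3 ↔ |v 1| = 2 * v 3 - |v 0| := by
      rw [div_eq_iff h0.ne', sub_mul, div_mul_cancel₀ _ h0.ne']
    rw [e, e']
    simp [h.not_ge]

theorem exists_sheetMap {v : R4} (hv : v ∈ Hexagon q β) :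
    ∃ ε : ℝ, (ε = 1 ∨ ε = -1) ∧ 0 ≤ ε * v 1 ∧ v = sheetMap q β ε (v 0, v 3) := by
  obtain ⟨-, hz, -, hy⟩ := hv
  rcases le_total 0 (v 1) with h | h
  · rw [abs_of_nonneg h] at hy
    exact ⟨1, Or.inl rfl, by linarith, R4.ext rfl (by simp [sheetMap, hy]) hz rfl⟩
  · rw [abs_of_nonpos h] at hy
    exact ⟨-1, Or.inr rfl, by linarith, R4.ext rfl (by simp [sheetMap, ← hy]) hz rfl⟩

theorem eq_sheetMap {v : R4} (hv : v ∈ Hexagon q β) {ε : ℝ} (hε : ε = 1 ∨ ε = -1)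
    (h : 0 ≤ ε * v 1) : v = sheetMap q β ε (v 0, v 3) := by
  refine R4.ext rfl ?_ hv.2.1 rfl
  have := hv.2.2.2
  rcases hε with rfl | rfl
  · rw [abs_of_nonneg (by linarith)] at this; simp [sheetMap, this]
  · rw [abs_of_nonpos (by linarith)] at this; simp [sheetMap, ← this]

theorem sheetMap_mem (hβ : 1 < β) (hq : β < q) {ε : ℝ} (hε : ε = 1 ∨ ε = -1) {p : ℝ × ℝ}
    (h0 : 0 < p.2) (h1 : p.2 < 1) (h : |p.1| ≤ 2 * p.2) : sheetMap q β ε p ∈ Hexagon q β := by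
  refine ⟨h0, rfl, h, ?_⟩
  simp only [sheetMap, vec4_one, vec4_three, vec4_zero]
  rw [abs_mul, abs_of_sign hε, one_mul, abs_of_nonneg (sheet_nonneg hβ hq h0 h1 h)]

theorem continuousOn_sheetMap (hβ : 1 < β) {ε : ℝ} {Q : Set (ℝ × ℝ)}
    (hQ : ∀ p ∈ Q, 0 < p.2 ∧ p.2 < 1) : ContinuousOn (sheetMap q β ε) Q := by
  intro p hp
  refine ContinuousAt.continuousWithinAt ?_
  have h2 : ContinuousAt (fun p : ℝ × ℝ => p.2) p := continuousAt_snd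
  have h1 : ContinuousAt (fun p : ℝ × ℝ => |p.1|) p := continuousAt_fst.abs
  exact continuousAt_vec4 continuousAt_fst (continuousAt_const.mul
    (Filter.Tendsto.min (continuousAt_profile hβ (hQ p hp).1 (hQ p hp).2 h2 h1)
      ((h2.const_mul 2).sub h1))) continuousAt_const h2

theorem isPreconnected_sheetMap (hβ : 1 < β) {ε : ℝ} {Q : Set (ℝ × ℝ)}
    (hQ : ∀ p ∈ Q, 0 < p.2 ∧ p.2 < 1) (hc : Convex ℝ Q) :
    IsPreconnected (sheetMap q β ε '' Q) :=
  hc.isPreconnected.image _ (continuousOn_sheetMap hβ hQ)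

theorem sheetMap_fold (hβ : 1 < β) (hq : β < q) {p : ℝ × ℝ} (h0 : 0 < p.2) (h1 : p.2 < 1)
    (h : |p.1| = 2 * p.2) (ε ε' : ℝ) : sheetMap q β ε p = sheetMap q β ε' p := by
  have : sheet q β p.2 |p.1| = 0 := by
    rw [sheet_of_ge hβ hq h0 h1 (by linarith), h, sub_self]
  simp only [sheetMap, this, mul_zero]

/-- The part of the surface over a convex set of `(x, t)` which contains a point of a fold is
connected. -/
theorem isPreconnected_Hexagon (hβ : 1 < β) (hq : β < q) {Q : Set (ℝ × ℝ)}
    (hQ : ∀ p ∈ Q, 0 < p.2 ∧ p.2 < 1 ∧ |p.1| ≤ 2 * p.2) (hc : Convex ℝ Q) {p : ℝ × ℝ} (hp : p ∈ Q)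
    (hf : |p.1| = 2 * p.2) : IsPreconnected {v ∈ Hexagon q β | (v 0, v 3) ∈ Q} := by
  have e : {v ∈ Hexagon q β | (v 0, v 3) ∈ Q} =
      sheetMap q β 1 '' Q ∪ sheetMap q β (-1) '' Q := by
    ext v
    constructor
    · rintro ⟨hv, hvQ⟩
      obtain ⟨ε, rfl | rfl, -, e⟩ := exists_sheetMap hv
      · exact Or.inl ⟨_, hvQ, e.symm⟩
      · exact Or.inr ⟨_, hvQ, e.symm⟩
    · rintro (⟨p, hp, rfl⟩ | ⟨p, hp, rfl⟩)
      · exact ⟨sheetMap_mem hβ hq (Or.inl rfl) (hQ p hp).1 (hQ p hp).2.1 (hQ p hp).2.2, hp⟩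
      · exact ⟨sheetMap_mem hβ hq (Or.inr rfl) (hQ p hp).1 (hQ p hp).2.1 (hQ p hp).2.2, hp⟩
  rw [e]
  have hQ' : ∀ p ∈ Q, 0 < p.2 ∧ p.2 < 1 := fun p hp => ⟨(hQ p hp).1, (hQ p hp).2.1⟩
  refine IsPreconnected.union (sheetMap q β 1 p) ⟨p, hp, rfl⟩ ⟨p, hp, ?_⟩
    (isPreconnected_sheetMap hβ hQ' hc) (isPreconnected_sheetMap hβ hQ' hc)
  exact sheetMap_fold hβ hq (hQ p hp).1 (hQ p hp).2.1 hf _ _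

theorem norm_le_of_mem_Hexagon (hβ : 1 < β) (hq : β < q) {v : R4} (hv : v ∈ Hexagon q β)
    (h1 : v 3 < 1) : ‖v‖ ≤ 4 * v 3 := by
  obtain ⟨h0, hz, hx, hy⟩ := hv
  have := sheet_le hβ hq h0 h1 (a := |v 0|)
  have h2 := norm_le_sum4 v
  rw [hz, abs_zero, abs_of_pos h0] at h2
  linarith

theorem abs_coord_sub_le (v w : R4) (i : Fin 4) : |v i - w i| ≤ dist v w := by
  rw [dist_eq_norm]; simpa using abs_coord_le (v - w) i

theorem dist_le_sum4 (v w : R4) :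
    dist v w ≤ |v 0 - w 0| + |v 1 - w 1| + |v 2 - w 2| + |v 3 - w 3| := by
  rw [dist_eq_norm]; simpa using norm_le_sum4 (v - w)

/-- A connected subset of the surface which joins both sheets reaches a fold, far away from the
bridge. -/
theorem exists_far_of_isPreconnected (hβ : 1 < β) (hq : β < q) {E : Set R4} (hE : IsPreconnected E)
    (hEX : E ⊆ Hexagon q β) (hE1 : ∀ v ∈ E, v 3 < 1) {b b' : R4} (hb : b ∈ E) (hb' : b' ∈ E)
    (hx : |b 0| ≤ b 3 / 2) (h : b 1 * b' 1 ≤ 0) : ∃ c ∈ E, b 3 / 2 ≤ dist c b := by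
  -- The sheets lie on different sides of `y = 0`, which the surface meets only at the folds `|x| =
  -- 2 t`.
  obtain ⟨c, hc, hc1⟩ : ∃ c ∈ E, c 1 = 0 := by
    have hcont : ContinuousOn (fun v : R4 => v 1) E := by fun_prop
    rcases le_total (b 1) 0 with h1 | h1
    · rcases le_total (b' 1) 0 with h2 | h2
      · rcases eq_or_lt_of_le h1 with h1 | h1
        · exact ⟨b, hb, h1⟩
        · exact ⟨b', hb', le_antisymm h2 (by nlinarith)⟩
      · obtain ⟨c, hc, e⟩ := hE.intermediate_value hb hb' hcont ⟨h1, h2⟩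
        exact ⟨c, hc, e⟩
    · rcases le_total (b' 1) 0 with h2 | h2
      · obtain ⟨c, hc, e⟩ := hE.intermediate_value hb' hb hcont ⟨h2, h1⟩
        exact ⟨c, hc, e⟩
      · rcases eq_or_lt_of_le h1 with h1 | h1
        · exact ⟨b, hb, h1.symm⟩
        · exact ⟨b', hb', le_antisymm (by nlinarith) h2⟩
  refine ⟨c, hc, ?_⟩
  obtain ⟨h0, hz, hcx, hy⟩ := hEX hc
  rw [hc1, abs_zero] at hy
  have h2 : |c 0| = 2 * c 3 := by
    by_contra hne
    exact (sheet_pos hβ hq h0 (hE1 c hc) (lt_of_le_of_ne hcx hne)).ne hy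
  have h3 := abs_coord_sub_le c b 0
  have h4 := abs_le.1 (abs_coord_sub_le c b 3)
  have h5 := abs_sub_abs_le_abs_sub (c 0) (b 0)
  linarith

/-- This absorbs all constants in comparisons of the scales `t^q`, `t^β` and `t`. -/
theorem exists_mul_rpow_le {a b : ℝ} (hab : a < b) {A : ℝ} (hA : 0 < A) :
    ∃ δ : ℝ, 0 < δ ∧ δ < 1 ∧ ∀ s, 0 < s → s < δ → A * s ^ b ≤ s ^ a := by
  have hd : 0 < b - a := sub_pos.2 hab
  refine ⟨min (1 / 2) ((1 / A) ^ (1 / (b - a))), by positivity,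
    (min_le_left _ _).trans_lt (by norm_num), fun s h0 hs => ?_⟩
  have h1 : s ^ (b - a) ≤ 1 / A := by
    have := Real.rpow_le_rpow h0.le (hs.le.trans (min_le_right _ _)) hd.le
    rwa [← Real.rpow_mul (by positivity), one_div_mul_cancel hd.ne', Real.rpow_one] at this
  have h2 : s ^ b = s ^ (b - a) * s ^ a := by rw [← Real.rpow_add h0]; ring_nf
  have h3 := Real.rpow_pos_of_pos h0 a
  calc A * s ^ b = A * s ^ (b - a) * s ^ a := by rw [h2]; ring
    _ ≤ A * (1 / A) * s ^ a := by gcongr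
    _ = s ^ a := by field_simp

theorem exists_mul_rpow_le_self {b : ℝ} (hb : 1 < b) {A : ℝ} (hA : 0 < A) :
    ∃ δ : ℝ, 0 < δ ∧ δ < 1 ∧ ∀ s, 0 < s → s < δ → A * s ^ b ≤ s := by
  simpa using exists_mul_rpow_le hb hA

theorem abs_sheet_sub_sheet_le (hβ : 1 < β) (hq : β < q) {t t' x x' : ℝ} (h0 : 0 < t) (h1 : t < 1)
    (h0' : 0 < t') (h1' : t' < 1) : |sheet q β t |x| - sheet q β t' (|x'|)|
      ≤ t ^ β + t' ^ β + |x - x'| + 2 * |t - t'| := by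
  have h2 := abs_le.1 (abs_sheet_sub_le hβ hq h0 h1 (abs_nonneg x))
  have h3 := abs_le.1 (abs_sheet_sub_le hβ hq h0' h1' (abs_nonneg x'))
  have h4 := abs_le.1 (abs_abs_sub_abs_le_abs_sub x x')
  have h5 := abs_le.1 (le_refl |t - t'|)
  have h6 := abs_nonneg (t - t')
  rw [abs_le]
  rcases min_cases |x| (2 * t - |x|) with ⟨e, _⟩ | ⟨e, _⟩ <;>
    rcases min_cases |x'| (2 * t' - |x'|) with ⟨e', _⟩ | ⟨e', _⟩ <;> rw [e] at h2 <;>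
    rw [e'] at h3 <;> constructor <;> linarith

/-- Close points of one sheet are joined by a small connected subset of that sheet. -/
theorem exists_small_of_same_sheet (hβ : 1 < β) (hq : β < q) {M η : ℝ} (hM : 0 < M) (hη : 0 < η) :
    ∃ δ : ℝ, 0 < δ ∧ δ < 1 ∧ ∀ (ε x x' t t' : ℝ), (ε = 1 ∨ ε = -1) → 0 < t → t < δ →
      |x| ≤ 2 * t → |x'| ≤ 2 * t' → |x - x'| ≤ M * t ^ q → |t - t'| ≤ M * t ^ q →
      ∃ E ⊆ Hexagon q β, IsPreconnected E ∧ sheetMap q β ε (x, t) ∈ E ∧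
        sheetMap q β ε (x', t') ∈ E ∧ ∀ c ∈ E, dist c (sheetMap q β ε (x, t)) ≤ η * t := by
  have h2β : (0:ℝ) < 2 ^ β := by positivity
  -- Over the box `Q` the `y`-coordinate varies by at most `(1 + 2^β) t^β + 3 M t^q`, and `x` and
  -- `t` by `M t^q` each, hence `1 + 2^β + 5 M`. The terms `2 M + 2` give `M t^q ≤ t / 2`.
  obtain ⟨δ₁, h1, h1', hδ₁⟩ := exists_mul_rpow_le_self hβ
    (A := (1 + 2 ^ β + 5 * M) / η + 2 * M + 2) (by positivity)
  refine ⟨δ₁ / 2, by positivity, by linarith, fun ε x x' t t' hε h0 ht hx hx' hxx htt => ?_⟩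
  have ht1 : t < 1 := by linarith
  have hs := hδ₁ t h0 (by linarith)
  have hqb := (rpow_q_lt_rpow_β hq h0 ht1).le
  have hb := Real.rpow_pos_of_pos h0 β
  have hMq : M * t ^ q ≤ M * t ^ β := by gcongr
  have hMt : M * t ^ q ≤ t / 2 := by
    have : 0 ≤ (1 + 2 ^ β + 5 * M) / η := by positivity
    nlinarith
  have hs' : (1 + 2 ^ β + 5 * M) * t ^ β ≤ η * t := by
    have h3 : ((1 + 2 ^ β + 5 * M) / η) * t ^ β ≤ t := by nlinarith
    rw [div_mul_eq_mul_div, div_le_iff₀ hη] at h3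
    linarith
  set Q : Set (ℝ × ℝ) :=
      {p | |p.1| ≤ 2 * p.2 ∧ |x - p.1| ≤ M * t ^ q ∧ |t - p.2| ≤ M * t ^ q} with hQd
  have hQ : ∀ p ∈ Q, 0 < p.2 ∧ p.2 ≤ 2 * t := fun p hp => by
    have := abs_le.1 hp.2.2
    exact ⟨by linarith, by linarith⟩
  have hQ' : ∀ p ∈ Q, 0 < p.2 ∧ p.2 < 1 := fun p hp =>
    ⟨(hQ p hp).1, by linarith [(hQ p hp).2]⟩
  have hconv : Convex ℝ Q := by
    have e : Q = ({p | p.1 ≤ 2 * p.2} ∩ {p | -(2 * p.2) ≤ p.1}) ∩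
        (Icc (x - M * t ^ q) (x + M * t ^ q) ×ˢ Icc (t - M * t ^ q) (t + M * t ^ q)) := by
      ext p
      simp only [hQd, mem_ofPred_eq, abs_le, mem_inter_iff, mem_prod, mem_Icc]
      constructor <;> rintro ⟨⟨_, _⟩, ⟨_, _⟩, _, _⟩ <;>
        refine ⟨⟨?_, ?_⟩, ⟨?_, ?_⟩, ?_, ?_⟩ <;> linarith
    rw [e]
    refine Convex.inter (Convex.inter ?_ ?_) ((convex_Icc _ _).prod (convex_Icc _ _))
    · intro p hp p' hp' a b ha hb _
      simp only [mem_ofPred_eq, Prod.fst_add, Prod.smul_fst, Prod.snd_add, Prod.smul_snd,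
        smul_eq_mul] at *
      nlinarith
    · intro p hp p' hp' a b ha hb _
      simp only [mem_ofPred_eq, Prod.fst_add, Prod.smul_fst, Prod.snd_add, Prod.smul_snd,
        smul_eq_mul] at *
      nlinarith
  have hq0 : 0 ≤ M * t ^ q := by positivity
  refine ⟨sheetMap q β ε '' Q, ?_, isPreconnected_sheetMap hβ hQ' hconv,
    ⟨_, ⟨hx, by simpa using hq0, by simpa using hq0⟩, rfl⟩, ⟨_, ⟨hx', hxx, htt⟩, rfl⟩, ?_⟩
  · rintro _ ⟨p, hp, rfl⟩
    exact sheetMap_mem hβ hq hε (hQ' p hp).1 (hQ' p hp).2 hp.1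
  · rintro _ ⟨p, hp, rfl⟩
    refine (dist_le_sum4 _ _).trans ?_
    have h4 := abs_sheet_sub_sheet_le hβ hq (hQ' p hp).1 (hQ' p hp).2 h0 ht1 (x := p.1) (x' := x)
    have h5 : p.2 ^ β ≤ 2 ^ β * t ^ β := by
      rw [← Real.mul_rpow (by norm_num) h0.le]
      exact Real.rpow_le_rpow (hQ p hp).1.le (hQ p hp).2 (by linarith)
    have h6 := hp.2.1
    have h7 := hp.2.2
    rw [abs_sub_comm] at h6 h7
    have h8 : sheetMap q β ε p 1 - sheetMap q β ε (x, t) 1 =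
      ε * (sheet q β p.2 |p.1| - sheet q β t |x|) := by
        simp only [sheetMap, vec4_one]; ring
    rw [h8, abs_mul, abs_of_sign hε, one_mul]
    have h9 : |p.1 - x| + |sheet q β p.2 |p.1| - sheet q β t (|x|)| + |(0:ℝ) - 0| + |p.2 - t| ≤
        η * t := by
      rw [sub_self, abs_zero]; linarith
    exact h9

/-- Close points of the surface which are not separated by the bridge are joined by a small
connected subset of the surface. -/
theorem exists_small_of_not_separated (hβ : 1 < β) (hq : β < q) {M η : ℝ} (hM : 0 < M)
    (hη : 0 < η) : ∃ δ : ℝ, 0 < δ ∧ δ < 1 ∧ ∀ p ∈ Hexagon q β, ∀ p' ∈ Hexagon q β, p 3 < δ →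
      p' 3 < 1 → dist p p' ≤ M * p 3 ^ q →
      (0 ≤ p 1 * p' 1 ∨ p 3 ^ β + M * p 3 ^ q ≤ |p 0|) →
      ∃ E ⊆ Hexagon q β, IsPreconnected E ∧ p ∈ E ∧ p' ∈ E ∧ ∀ c ∈ E, dist c p ≤ η * p 3 := by
  obtain ⟨δ, h0, h1, H⟩ := exists_small_of_same_sheet hβ hq (M := 2 * M) (η := η / 2)
    (by linarith) (by linarith)
  obtain ⟨δ', h0', h1', H'⟩ := exists_mul_rpow_le_self (hβ.trans hq) (A := M) hM
  refine ⟨min δ δ', by positivity, (min_le_left _ _).trans_lt h1, ?_⟩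
  intro p hp p' hp' hpδ hp1' hd h
  have hp0 := hp.1
  have hp1 : p 3 < 1 := hpδ.trans_le ((min_le_left _ _).trans h1.le)
  have hq0 := Real.rpow_pos_of_pos hp0 q
  have hMq : 0 ≤ M * p 3 ^ q := by positivity
  have hsmall := H' _ hp0 (hpδ.trans_le (min_le_right _ _))
  have hpδ := hpδ.trans_le (min_le_left _ _)
  have hdx := (abs_coord_sub_le p p' 0).trans hd
  have hdy := (abs_coord_sub_le p p' 1).trans hd
  have hdt := (abs_coord_sub_le p p' 3).trans hd
  by_cases hs : 0 ≤ p 1 * p' 1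
  · obtain ⟨ε, hε, he, he'⟩ : ∃ ε : ℝ, (ε = 1 ∨ ε = -1) ∧ 0 ≤ ε * p 1 ∧ 0 ≤ ε * p' 1 := by
      rcases nonneg_and_nonneg_or_nonpos_and_nonpos_of_mul_nonneg hs with ⟨ha, hb⟩ | ⟨ha, hb⟩
      · exact ⟨1, Or.inl rfl, by linarith, by linarith⟩
      · exact ⟨-1, Or.inr rfl, by linarith, by linarith⟩
    obtain ⟨E, hE, hEc, hpE, hpE', hEd⟩ := H ε (p 0) (p' 0) (p 3) (p' 3) hε hp0 hpδ hp.2.2.1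
      hp'.2.2.1 (by linarith) (by linarith)
    rw [← eq_sheetMap hp hε he] at hpE hEd
    rw [← eq_sheetMap hp' hε he'] at hpE'
    exact ⟨E, hE, hEc, hpE, hpE', fun c hc => (hEd c hc).trans (by nlinarith)⟩
  · have hx := h.resolve_left hs
    rw [not_le] at hs
    obtain ⟨ε, hε, he, hep⟩ := exists_sheetMap hp
    have he' : ε * p' 1 ≤ 0 := by
      by_contra! hc
      have h3 : 0 ≤ (ε * p 1) * (ε * p' 1) := mul_nonneg he hc.le
      have h4 : (ε * p 1) * (ε * p' 1) = p 1 * p' 1 := by rcases hε with rfl | rfl <;> ring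
      linarith
    have hε' : -ε = 1 ∨ -ε = -1 := by rcases hε with rfl | rfl <;> simp
    have hep' := eq_sheetMap hp' hε' (by linarith)
    -- On opposite sheets `|y|` is at most the distance of the points. As `|x| ≥ t^β + M t^q`, the
    -- profile exceeds `M t^q`; so the small value of the sheet is `2 t - |x|`, and the points can
    -- be joined through a nearby fold.
    have hy : |p 1| ≤ M * p 3 ^ q := by
      have h3 : |p 1| ≤ |p 1 - p' 1| := by
        rcases hε with rfl | rfl
        · rw [abs_of_nonneg (by linarith), abs_of_nonneg (by linarith)]; linarith
        · rw [abs_of_nonpos (by linarith), abs_of_nonpos (by linarith)]; linarith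
      linarith
    have hfold : 2 * p 3 - |p 0| ≤ M * p 3 ^ q := by
      rw [hp.2.2.2, sheet, min_le_iff] at hy
      rcases hy with hy | hy
      · have := sub_le_profile hβ hq hp0 hp1 |p 0|
        linarith
      · exact hy
    obtain ⟨ς, hς, hςx⟩ : ∃ ς : ℝ, (ς = 1 ∨ ς = -1) ∧ p 0 = ς * |p 0| := by
      rcases le_total 0 (p 0) with h | h
      · exact ⟨1, Or.inl rfl, by rw [abs_of_nonneg h, one_mul]⟩
      · exact ⟨-1, Or.inr rfl, by rw [abs_of_nonpos h]; ring⟩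
    have hf : |ς * (2 * p 3)| = 2 * p 3 := by
      rw [abs_mul, abs_of_sign hς, one_mul, abs_of_pos (by linarith)]
    have hfx : |p 0 - ς * (2 * p 3)| ≤ M * p 3 ^ q := by
      rw [hςx, ← mul_sub, abs_mul, abs_of_sign hς, one_mul, abs_of_nonpos (by linarith [hp.2.2.1])]
      linarith
    have hfx' : |ς * (2 * p 3) - p' 0| ≤ 2 * M * p 3 ^ q := by
      have := abs_sub_le (ς * (2 * p 3)) (p 0) (p' 0)
      rw [abs_sub_comm] at hfx
      linarith
    obtain ⟨E₁, hE₁, hEc₁, hpE₁, hfE₁, hEd₁⟩ := H ε (p 0) (ς * (2 * p 3)) (p 3) (p 3) hε hp0 hpδ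
      hp.2.2.1 hf.le (by linarith) (by rw [sub_self, abs_zero]; linarith)
    obtain ⟨E₂, hE₂, hEc₂, hfE₂, hpE₂, hEd₂⟩ := H (-ε) (ς * (2 * p 3)) (p' 0) (p 3) (p' 3) hε' hp0
      hpδ hf.le hp'.2.2.1 hfx' (by linarith)
    rw [sheetMap_fold (p := (ς * (2 * p 3), p 3)) hβ hq hp0 hp1 hf (-ε) ε] at hfE₂ hEd₂
    rw [← hep] at hpE₁ hEd₁
    rw [← hep'] at hpE₂
    refine ⟨E₁ ∪ E₂, union_subset hE₁ hE₂, hEc₁.union _ hfE₁ hfE₂ hEc₂, Or.inl hpE₁, Or.inr hpE₂,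
        ?_⟩
    rintro c (hc | hc)
    · exact (hEd₁ c hc).trans (by nlinarith)
    · linarith [dist_triangle c (sheetMap q β ε (ς * (2 * p 3), p 3)) p, hEd₁ _ hfE₁, hEd₂ c hc]

end Hexagon

/-! ### Self-equivalences of the surface over the model knot `K` -/

/-- The map `g` is the germ of a bi-Lipschitz homeomorphism of the surface, with inverse `k`. -/
structure HexagonIso (q β : ℝ) (g k : R4 → R4) (C r : ℝ) : Prop where
  one_le : 1 ≤ C
  pos : 0 < r
  lt_one : r < 1
  maps : ∀ v ∈ Hexagon q β, v 3 < r → g v ∈ Hexagon q β ∧ k (g v) = v ∧ g v 3 ≤ C * v 3 ∧ g v 3 < 1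
  maps' : ∀ v ∈ Hexagon q β, v 3 < r → k v ∈ Hexagon q β ∧ g (k v) = v ∧ k v 3 ≤ C * v 3 ∧ k v 3 < 1
  lip : ∀ v ∈ Hexagon q β, ∀ w ∈ Hexagon q β, v 3 < r → w 3 < r → dist (g v) (g w) ≤ C * dist v w
  lip' : ∀ v ∈ Hexagon q β, ∀ w ∈ Hexagon q β, v 3 < r → w 3 < r → dist (k v) (k w) ≤ C * dist v w

/-- The edges of the bridge. -/
noncomputable def edge (q β ς ε s : ℝ) : R4 := !₂[ς * s ^ β, ε * s ^ q, 0, s]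

section

variable {q β : ℝ}

theorem edge_mem (hβ : 1 < β) (hq : β < q) {ς ε s : ℝ} (hς : ς = 1 ∨ ς = -1)
    (hε : ε = 1 ∨ ε = -1) (h0 : 0 < s) (h1 : s < 1) : edge q β ς ε s ∈ Hexagon q β := by
  have hb := Real.rpow_pos_of_pos h0 β
  have hq0 := Real.rpow_pos_of_pos h0 q
  have hlt := rpow_lt_self_of_lt_one hβ h0 h1
  have e : |edge q β ς ε s 0| = s ^ β := by
    simp only [edge, vec4_zero, abs_mul, abs_of_sign hς, one_mul, abs_of_pos hb]
  refine ⟨h0, rfl, ?_, ?_⟩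
  · rw [e]
    change s ^ β ≤ 2 * s
    linarith
  · rw [e]
    change |ε * s ^ q| = sheet q β s (s ^ β)
    rw [abs_mul, abs_of_sign hε, one_mul, abs_of_pos hq0, sheet_of_le hβ hq h0 h1 hlt.le,
      profile_of_le le_rfl]

theorem eq_edge (hβ : 1 < β) (hq : β < q) {v : R4} (hv : v ∈ Hexagon q β) (h1 : v 3 < 1)
    {ς : ℝ} (h : v 0 = ς * v 3 ^ β) (hς : ς = 1 ∨ ς = -1) :
    ∃ ε : ℝ, (ε = 1 ∨ ε = -1) ∧ v = edge q β ς ε (v 3) := by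
  have hb := Real.rpow_pos_of_pos hv.1 β
  have hq0 := Real.rpow_pos_of_pos hv.1 q
  have hlt := rpow_lt_self_of_lt_one hβ hv.1 h1
  have hx : |v 0| = v 3 ^ β := by rw [h, abs_mul, abs_of_sign hς, one_mul, abs_of_pos hb]
  have hy := hv.2.2.2
  rw [hx, sheet_of_le hβ hq hv.1 h1 hlt.le, profile_of_le le_rfl] at hy
  rcases (abs_eq hq0.le).1 hy with hy | hy
  · exact ⟨1, Or.inl rfl, R4.ext h (by simp [edge, hy]) hv.2.1 rfl⟩
  · exact ⟨-1, Or.inr rfl, R4.ext h (by simp [edge, hy]) hv.2.1 rfl⟩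

theorem slope_le_two (hβ : 1 < β) {t : ℝ} (h0 : 0 < t) (h1 : t < 1) (h : 2 * t ^ β ≤ t) :
    slope q β t ≤ 2 := by
  have hlt := rpow_lt_self_of_lt_one hβ h0 h1
  have := Real.rpow_pos_of_pos h0 q
  rw [slope, div_le_iff₀ (by linarith)]
  linarith

/-- Points of the wings near the bridge are close to the edges. -/
theorem exists_edge_near (hβ : 1 < β) (hq : β < q) {M : ℝ} (hM : 0 < M) : ∃ δ : ℝ, 0 < δ ∧ δ < 1 ∧
    ∀ v ∈ Hexagon q β, v 3 < δ → v 3 ^ β ≤ |v 0| → |v 0| ≤ v 3 ^ β + M * v 3 ^ q →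
    ∀ ς ε : ℝ, (ς = 1 ∨ ς = -1) → (ε = 1 ∨ ε = -1) → v 0 = ς * |v 0| → v 1 = ε * |v 1| →
      dist v (edge q β ς ε (v 3)) ≤ 3 * M * v 3 ^ q := by
  obtain ⟨δ, h0, h1, H⟩ := exists_mul_rpow_le_self hβ (A := 2 + M) (by linarith)
  -- The factor `3` is `1` for `x` plus `2` for `y`, the slope of the wing being at most `2` once `2
  -- t^β ≤ t`.
  refine ⟨δ, h0, h1, fun v hv hδ hx hx' ς ε hς hε hςv hεv => ?_⟩
  have hv0 := hv.1
  have hv1 : v 3 < 1 := hδ.trans h1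
  have hs := H _ hv.1 hδ
  have hb := Real.rpow_pos_of_pos hv0 β
  have hqb := rpow_q_lt_rpow_β hq hv0 hv1
  have hMq : M * v 3 ^ q ≤ M * v 3 ^ β := by gcongr
  have hsl1 := one_le_slope hβ hq hv0 hv1
  have hsl := slope_le_two (q := q) hβ hv0 hv1 (by nlinarith)
  have hy := hv.2.2.2
  rw [sheet_of_le hβ hq hv0 hv1 (by nlinarith), profile_of_ge hx] at hy
  have hy' : 0 ≤ (|v 0| - v 3 ^ β) * slope q β (v 3) :=
    mul_nonneg (by linarith) (by linarith)
  have hy'' : (|v 0| - v 3 ^ β) * slope q β (v 3) ≤ M * v 3 ^ q * 2 := by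
    gcongr
    linarith
  have e0 : |v 0 - edge q β ς ε (v 3) 0| = |v 0| - v 3 ^ β := by
    change |v 0 - ς * v 3 ^ β| = _
    conv_lhs => rw [hςv]
    rw [← mul_sub, abs_mul, abs_of_sign hς, one_mul, abs_of_nonneg (by linarith)]
  have e1 : |v 1 - edge q β ς ε (v 3) 1| = (|v 0| - v 3 ^ β) * slope q β (v 3) := by
    change |v 1 - ε * v 3 ^ q| = _
    conv_lhs => rw [hεv]
    rw [← mul_sub, abs_mul, abs_of_sign hε, one_mul, hy, abs_of_nonneg] <;> linarith
  have e2 : |v 2 - edge q β ς ε (v 3) 2| = 0 := by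
    change |v 2 - 0| = 0
    simp [hv.2.1]
  have e3 : |v 3 - edge q β ς ε (v 3) 3| = 0 := by
    change |v 3 - v 3| = 0
    simp
  refine (dist_le_sum4 _ _).trans ?_
  rw [e0, e1, e2, e3]
  linarith

theorem exists_sign (x : ℝ) : ∃ ς : ℝ, (ς = 1 ∨ ς = -1) ∧ x = ς * |x| := by
  rcases le_total 0 x with h | h
  · exact ⟨1, Or.inl rfl, by rw [abs_of_nonneg h, one_mul]⟩
  · exact ⟨-1, Or.inr rfl, by rw [abs_of_nonpos h]; ring⟩

/-- Each side of the surface is connected. -/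
theorem isPreconnected_half (hβ : 1 < β) (hq : β < q) {σ τ : ℝ} (hσ : σ = 1 ∨ σ = -1) (hτ0 : 0 < τ)
    (hτ1 : τ ≤ 1) : IsPreconnected {v ∈ Hexagon q β | v 3 < τ ∧ 0 < σ * v 0} := by
  set Q : Set (ℝ × ℝ) := {p | 0 < p.2 ∧ p.2 < τ ∧ |p.1| ≤ 2 * p.2 ∧ 0 < σ * p.1} with hQ
  have hconv : Convex ℝ Q := by
    have hpos : ∀ {x y a b : ℝ}, 0 < x → 0 < y → 0 ≤ a → 0 ≤ b → a + b = 1 → 0 < a * x + b * y := by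
      intro x y a b hx hy ha hb hab
      rcases ha.eq_or_lt with rfl | ha
      · have : b = 1 := by linarith
        rw [this]; linarith
      · have := mul_pos ha hx
        have := mul_nonneg hb hy.le
        linarith
    intro p hp p' hp' a b ha hb hab
    have hp1 := abs_le.1 hp.2.2.1
    have hp1' := abs_le.1 hp'.2.2.1
    refine ⟨?_, ?_, abs_le.2 ⟨?_, ?_⟩, ?_⟩ <;>
      simp only [Prod.fst_add, Prod.smul_fst, Prod.snd_add, Prod.smul_snd, smul_eq_mul]
    · exact hpos hp.1 hp'.1 ha hb hab
    · have := hpos (sub_pos.2 hp.2.1) (sub_pos.2 hp'.2.1) ha hb hab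
      nlinarith
    · nlinarith
    · nlinarith
    · have := hpos hp.2.2.2 hp'.2.2.2 ha hb hab
      linarith
  have hσ2 : σ * σ = 1 := by rcases hσ with rfl | rfl <;> norm_num
  have hfold : |σ * τ| = 2 * (τ / 2) := by
    rw [abs_mul, abs_of_sign hσ, one_mul, abs_of_pos hτ0]; ring
  have hpre := isPreconnected_Hexagon hβ hq (Q := Q) (fun p hp => ⟨hp.1, hp.2.1.trans_le hτ1,
    hp.2.2.1⟩) hconv (p := (σ * τ, τ / 2)) ⟨by positivity, half_lt_self hτ0, hfold.le, by
      change 0 < σ * (σ * τ)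
      rw [← mul_assoc, hσ2]; linarith⟩ hfold
  convert hpre using 1
  ext v
  exact ⟨fun hv => ⟨hv.1, hv.1.1, hv.2.1, hv.1.2.2.1, hv.2.2⟩,
    fun hv => ⟨hv.1, hv.2.2.1, hv.2.2.2.2⟩⟩

end

namespace HexagonIso

variable {q β C r : ℝ} {g k : R4 → R4}

theorem symm (h : HexagonIso q β g k C r) : HexagonIso q β k g C r :=
  ⟨h.one_le, h.pos, h.lt_one, h.maps', h.maps, h.lip', h.lip⟩

theorem continuousOn (h : HexagonIso q β g k C r) :
    ContinuousOn g {v ∈ Hexagon q β | v 3 < r} :=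
  LipschitzOnWith.continuousOn (K := ⟨C, by linarith [h.one_le]⟩)
    (LipschitzOnWith.of_dist_le_mul fun v hv w hw => h.lip v hv.1 w hw.1 hv.2 hw.2)

/-- Opposite points of the bridge are mapped to different sheets, and near to the bridge. -/
theorem exists_opposite (h : HexagonIso q β g k C r) (hβ : 1 < β) (hq : β < q) :
    ∃ M δ : ℝ, 0 < M ∧ 0 < δ ∧ ∀ b ∈ Hexagon q β, ∀ b' ∈ Hexagon q β, b 3 < δ →
      b' 0 = b 0 → b' 1 = -b 1 → b' 3 = b 3 → |b 0| ≤ b 3 ^ β →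
      g b 1 * g b' 1 < 0 ∧ |g b 0| < g b 3 ^ β + M * g b 3 ^ q := by
  have hC := h.one_le
  have hC0 : 0 < C := by linarith
  obtain ⟨δ₁, h1, h1', H₁⟩ := exists_small_of_not_separated hβ hq (M := 2 * C * C ^ q)
    (η := 1 / (4 * C ^ 2)) (by positivity) (by positivity)
  obtain ⟨δ₂, h2, h2', H₂⟩ := exists_mul_rpow_le_self hβ (A := 2) two_pos
  refine ⟨2 * C * C ^ q, min (min δ₁ r / (2 * C)) δ₂, by positivity,
    by have := h.pos; positivity, ?_⟩
  intro b hb b' hb' hδ e0 e1 e3 hx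
  have hδ₁ : 2 * C * b 3 < min δ₁ r := by
    have := hδ.trans_le (min_le_left _ _)
    rw [lt_div_iff₀ (by linarith)] at this
    linarith
  have hb0 := hb.1
  have hδ₂ := H₂ _ hb.1 (hδ.trans_le (min_le_right _ _))
  have hr : 2 * C * b 3 < r := hδ₁.trans_le (min_le_right _ _)
  have hδ₁ : 2 * C * b 3 < δ₁ := hδ₁.trans_le (min_le_left _ _)
  have hCb : b 3 ≤ C * b 3 := le_mul_of_one_le_left hb0.le hC
  have hbr : b 3 < r := by nlinarith
  have hb1 : b 3 < 1 := hbr.trans h.lt_one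
  obtain ⟨hg, hkg, hgt, hg1⟩ := h.maps b hb hbr
  obtain ⟨hg', hkg', hgt', hg1'⟩ := h.maps b' hb' (e3 ▸ hbr)
  have hgr : g b 3 < r := by nlinarith
  have hbt : b 3 ≤ C * g b 3 := by
    have := (h.maps' _ hg hgr).2.2.1
    rwa [hkg] at this
  have hyb : |b 1| = b 3 ^ q := by
    rw [hb.2.2.2, sheet_of_le hβ hq hb0 hb1 (by linarith), profile_of_le hx]
  have hd : dist (g b) (g b') ≤ 2 * C * C ^ q * g b 3 ^ q := by
    have h3 : dist b b' ≤ 2 * b 3 ^ q := by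
      refine (dist_le_sum4 b b').trans ?_
      rw [e0, e1, e3, hb.2.1, hb'.2.1, sub_neg_eq_add, ← two_mul, abs_mul, hyb]
      simp
    have h4 : b 3 ^ q ≤ C ^ q * g b 3 ^ q := by
      rw [← Real.mul_rpow hC0.le hg.1.le]
      exact Real.rpow_le_rpow hb0.le hbt (by linarith)
    calc dist (g b) (g b') ≤ C * (2 * b 3 ^ q) :=
          (h.lip b hb b' hb' hbr (e3 ▸ hbr)).trans (by gcongr)
      _ ≤ C * (2 * (C ^ q * g b 3 ^ q)) := by gcongr
      _ = _ := by ring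
  -- Otherwise the images are joined by a small connected set `E`. With `η = 1 / (4 C^2)`, its
  -- preimage stays within `b 3 / 4` of `b`, but it joins opposite points of the bridge and has to
  -- reach a fold, at distance at least `b 3 / 2`.
  by_contra hc
  obtain ⟨E, hE, hEc, hbE, hbE', hEd⟩ := H₁ (g b) hg (g b') hg' (by nlinarith) hg1' hd (by
    by_contra! hc'
    exact hc hc')
  have hη : 1 / (4 * C ^ 2) ≤ 1 := by
    rw [div_le_one (by positivity)]; nlinarith
  have hEr : ∀ c ∈ E, c 3 < r := fun c hc => by
    have h3 := (le_abs_self _).trans ((abs_coord_sub_le c (g b) 3).trans (hEd c hc))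
    have h4 : 1 / (4 * C ^ 2) * g b 3 ≤ 1 * g b 3 := mul_le_mul_of_nonneg_right hη hg.1.le
    linarith
  have hmaps := fun c hc => h.maps' c (hE hc) (hEr c hc)
  obtain ⟨_, ⟨c, hc, rfl⟩, hfar⟩ := exists_far_of_isPreconnected hβ hq (E := k '' E)
    (hEc.image k (h.symm.continuousOn.mono fun c hc => ⟨hE hc, hEr c hc⟩))
    (by rintro _ ⟨c, hc, rfl⟩; exact (hmaps c hc).1)
    (by rintro _ ⟨c, hc, rfl⟩; exact (hmaps c hc).2.2.2) (b := b) (b' := b')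
    ⟨_, hbE, hkg⟩ ⟨_, hbE', hkg'⟩ (by linarith) (by rw [e1]; nlinarith [sq_nonneg (b 1)])
  have h3 : dist (k c) b ≤ b 3 / 4 := by
    rw [← hkg]
    calc dist (k c) (k (g b)) ≤ C * dist c (g b) := h.lip' _ (hE hc) _ hg (hEr c hc) hgr
      _ ≤ C * (1 / (4 * C ^ 2) * (C * b 3)) := by
        gcongr
        exact (hEd c hc).trans (by gcongr)
      _ = b 3 / 4 := by field_simp
      _ = k (g b) 3 / 4 := by rw [hkg]
  linarith

theorem mirror_mem {v : R4} (hv : v ∈ Hexagon q β) :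
    (!₂[v 0, -v 1, v 2, v 3] : R4) ∈ Hexagon q β :=
  ⟨hv.1, hv.2.1, hv.2.2.1, by
    have := hv.2.2.2
    simpa using this⟩

/-- Preimages of the edges stay away from the middle of the bridge. -/
theorem exists_le_abs (h : HexagonIso q β g k C r) (hβ : 1 < β) (hq : β < q) :
    ∃ c δ : ℝ, 0 < c ∧ 0 < δ ∧ δ ≤ r ∧ ∀ ς ε s : ℝ, (ς = 1 ∨ ς = -1) → (ε = 1 ∨ ε = -1) → 0 < s →
      s < δ → c * s ^ β ≤ |k (edge q β ς ε s) 0| := by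
  have hC := h.one_le
  have hC0 : 0 < C := by linarith
  obtain ⟨M, δ₁, hM, h1, H₁⟩ := h.exists_opposite hβ hq
  obtain ⟨δ₂, h2, h2', H₂⟩ := exists_edge_near hβ hq hM
  obtain ⟨δ₃, h3, h3', H₃⟩ := exists_mul_rpow_le_self hβ (A := 1 + M) (by linarith)
  have hcp : 0 < (1 / C) ^ β / 2 := by positivity
  obtain ⟨δ₄, h4, h4', H₄⟩ := exists_mul_rpow_le hq (A := 3 * M * C / ((1 / C) ^ β / 2))
    (by positivity)
  have hr := h.pos
  refine ⟨(1 / C) ^ β / 2, min (min (min δ₁ r / C) δ₂) (min δ₃ δ₄), hcp, by positivity, ?_, ?_⟩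
  · refine (min_le_left _ _).trans ((min_le_left _ _).trans ?_)
    rw [div_le_iff₀ hC0]
    exact (min_le_right _ _).trans (le_mul_of_one_le_right hr.le hC)
  intro ς ε s hς hε h0 hs
  by_contra! hc
  have hs₁ : C * s < min δ₁ r := by
    have := hs.trans_le ((min_le_left _ _).trans (min_le_left _ _))
    rw [lt_div_iff₀ hC0] at this
    linarith
  have hsr : C * s < r := hs₁.trans_le (min_le_right _ _)
  have hs₁ : C * s < δ₁ := hs₁.trans_le (min_le_left _ _)
  have hs₂ := hs.trans_le ((min_le_left _ _).trans (min_le_right _ _))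
  have hs₃ := H₃ s h0 (hs.trans_le ((min_le_right _ _).trans (min_le_left _ _)))
  have hs₄ := H₄ s h0 (hs.trans_le ((min_le_right _ _).trans (min_le_right _ _)))
  have hsCs : s ≤ C * s := le_mul_of_one_le_left h0.le hC
  have hr' : s < r := by linarith
  have hs1 : s < 1 := hr'.trans h.lt_one
  have hb := Real.rpow_pos_of_pos h0 β
  have hq0 := Real.rpow_pos_of_pos h0 q
  have hqb := (rpow_q_lt_rpow_β hq h0 hs1).le
  have hMq : M * s ^ q ≤ M * s ^ β := by gcongr
  have hMq0 : 0 < M * s ^ q := by positivity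
  -- This point of the wing lies beyond the edge by exactly the error `M s^q` of `exists_opposite`,
  -- so it is not the image of a point of the bridge. If the preimage of the edge were too close to
  -- the middle, then the preimage of `e'`, at distance of order `s^q` from it, would lie on the
  -- bridge.
  set e' := sheetMap q β ε (ς * (s ^ β + M * s ^ q), s) with he'
  have hx : |ς * (s ^ β + M * s ^ q)| = s ^ β + M * s ^ q := by
    rw [abs_mul, abs_of_sign hς, one_mul, abs_of_pos (by linarith)]
  have hmem : e' ∈ Hexagon q β := sheetMap_mem hβ hq hε h0 hs1 (by rw [hx]; linarith)
  have he0 : e' 0 = ς * (s ^ β + M * s ^ q) := rfl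
  have he1 : e' 1 = ε * |e' 1| := by
    have : e' 1 = ε * sheet q β s |ς * (s ^ β + M * s ^ q)| := rfl
    rw [this, hx, abs_mul, abs_of_sign hε, one_mul, abs_of_nonneg]
    exact sheet_nonneg hβ hq h0 hs1 (by linarith)
  have he3 : e' 3 = s := rfl
  have hd := H₂ e' hmem (by rwa [he3]) (by rw [he0, hx, he3]; linarith) (by rw [he0, hx, he3])
    ς ε hς hε (by rw [he0, hx]) he1
  rw [he3] at hd
  have hee := edge_mem hβ hq hς hε h0 hs1
  obtain ⟨hk, hgk, hkt, hk1⟩ := h.maps' e' hmem (by rwa [he3])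
  rw [he3] at hkt
  have hts : s ≤ C * k e' 3 := by
    have := (h.maps _ hk (by linarith)).2.2.1
    rwa [hgk, he3] at this
  have hxk : |k e' 0| ≤ k e' 3 ^ β := by
    have h5 := (abs_coord_sub_le (k e') (k (edge q β ς ε s)) 0).trans
      (h.lip' e' hmem _ hee (by rwa [he3]) hr')
    have h6 := abs_sub_abs_le_abs_sub (k e' 0) (k (edge q β ς ε s) 0)
    have h7 : C * dist e' (edge q β ς ε s) ≤ C * (3 * M * s ^ q) := by gcongr
    have h8 : 3 * M * C * s ^ q ≤ (1 / C) ^ β / 2 * s ^ β := by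
      rw [div_mul_eq_mul_div, div_le_iff₀ hcp] at hs₄
      linarith
    have h9 : (1 / C) ^ β * s ^ β ≤ k e' 3 ^ β := by
      rw [← Real.mul_rpow (by positivity) h0.le]
      refine Real.rpow_le_rpow (by positivity) ?_ (by linarith)
      rw [one_div, inv_mul_le_iff₀ hC0]
      exact hts
    linarith
  have := (H₁ (k e') hk _ (mirror_mem hk) (by linarith) rfl rfl rfl hxk).2
  rw [hgk, he0, hx, he3] at this
  exact lt_irrefl _ this

/-- The sign of the first coordinate is constant along the preimages of the edges on one side. -/
theorem exists_sign_edge (h : HexagonIso q β g k C r) (hβ : 1 < β) (hq : β < q) :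
    ∃ c δ : ℝ, 0 < c ∧ 0 < δ ∧ δ ≤ r ∧ ∀ ς : ℝ, (ς = 1 ∨ ς = -1) → ∃ σ : ℝ, (σ = 1 ∨ σ = -1) ∧
      ∀ ε s : ℝ, (ε = 1 ∨ ε = -1) → 0 < s → s < δ → c * s ^ β ≤ σ * k (edge q β ς ε s) 0 := by
  have hC0 : 0 < C := by linarith [h.one_le]
  obtain ⟨c, δ₁, hc, h1, h1r, H₁⟩ := h.exists_le_abs hβ hq
  obtain ⟨δ₂, h2, h2', H₂⟩ := exists_mul_rpow_le hq (A := 2 * C / c) (by positivity)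
  refine ⟨c, min δ₁ δ₂, hc, by positivity, (min_le_left _ _).trans h1r, fun ς hς => ?_⟩
  have hlt : ∀ s ∈ Ioo 0 (min δ₁ δ₂), s < r ∧ s < 1 := fun s hs =>
    have := hs.2.trans_le ((min_le_left _ _).trans h1r)
    ⟨this, this.trans h.lt_one⟩
  have hcont : ContinuousOn (fun s => k (edge q β ς 1 s) 0) (Ioo 0 (min δ₁ δ₂)) := by
    have h3 : ContinuousOn (fun s => edge q β ς 1 s) (Ioo 0 (min δ₁ δ₂)) := fun s hs =>
      (continuousAt_vec4 (continuousAt_const.mul (continuousAt_id.rpow_const (Or.inl hs.1.ne')))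
        (continuousAt_const.mul (continuousAt_id.rpow_const (Or.inl hs.1.ne')))
        continuousAt_const continuousAt_id).continuousWithinAt
    have h4 := h.symm.continuousOn.comp h3 fun s hs =>
      ⟨edge_mem hβ hq hς (Or.inl rfl) hs.1 (hlt s hs).2, (hlt s hs).1⟩
    exact (EuclideanSpace.proj (𝕜 := ℝ) (0 : Fin 4)).continuous.comp_continuousOn h4
  have hne : ∀ s ∈ Ioo 0 (min δ₁ δ₂), c * s ^ β ≤ |k (edge q β ς 1 s) 0| ∧ 0 < c * s ^ β :=
    fun s hs => ⟨H₁ ς 1 s hς (Or.inl rfl) hs.1 (hs.2.trans_le (min_le_left _ _)), by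
      have := Real.rpow_pos_of_pos hs.1 β
      positivity⟩
  have h0 : min δ₁ δ₂ / 2 ∈ Ioo 0 (min δ₁ δ₂) :=
    ⟨by positivity, half_lt_self (by positivity)⟩
  obtain ⟨σ, hσ, hσ0⟩ := exists_sign (k (edge q β ς 1 (min δ₁ δ₂ / 2)) 0)
  have hpos : ∀ s ∈ Ioo 0 (min δ₁ δ₂), 0 ≤ σ * k (edge q β ς 1 s) 0 := by
    intro s hs
    by_contra! hneg
    have h5 : 0 ≤ σ * k (edge q β ς 1 (min δ₁ δ₂ / 2)) 0 := by
      rw [hσ0]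
      rcases hσ with rfl | rfl <;> simp
    obtain ⟨s', hs', e⟩ := isPreconnected_Ioo.intermediate_value hs h0
      (continuousOn_const.mul hcont : ContinuousOn (fun s => σ * k (edge q β ς 1 s) 0) _)
      ⟨hneg.le, h5⟩
    have h6 := hne s' hs'
    have h7 : k (edge q β ς 1 s') 0 = 0 := by
      have e : σ * k (edge q β ς 1 s') 0 = 0 := e
      rcases hσ with rfl | rfl <;> linarith
    rw [h7, abs_zero] at h6
    linarith
  have hσabs : ∀ x : ℝ, 0 ≤ σ * x → |x| = σ * x := fun x hx => by
    rw [← abs_of_nonneg hx, abs_mul, abs_of_sign hσ, one_mul]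
  refine ⟨σ, hσ, fun ε s hε h0 hs => ?_⟩
  have hs' : s ∈ Ioo 0 (min δ₁ δ₂) := ⟨h0, hs⟩
  have h3 : c * s ^ β ≤ σ * k (edge q β ς 1 s) 0 := by
    rw [← hσabs _ (hpos s hs')]; exact (hne s hs').1
  rcases hε with rfl | rfl
  · exact h3
  have h4 := H₁ ς (-1) s hς (Or.inr rfl) h0 (hs.trans_le (min_le_left _ _))
  have hq0 := Real.rpow_pos_of_pos h0 q
  -- The lower edge is at distance `2 s^q` from the upper one. The two preimages cannot have
  -- opposite signs, since both have `|x| ≥ c s^β` and `s^q` is negligible against `s^β`.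
  by_cases hneg : 0 ≤ σ * k (edge q β ς (-1) s) 0
  · rwa [hσabs _ hneg] at h4
  have h5 : |k (edge q β ς (-1) s) 0| = -(σ * k (edge q β ς (-1) s) 0) := by
    rw [not_le] at hneg
    rw [← abs_of_neg hneg, abs_mul, abs_of_sign hσ, one_mul]
  have h6 := (abs_coord_sub_le (k (edge q β ς 1 s)) (k (edge q β ς (-1) s)) 0).trans
    (h.lip' _ (edge_mem hβ hq hς (Or.inl rfl) h0 (hlt s hs').2) _
      (edge_mem hβ hq hς (Or.inr rfl) h0 (hlt s hs').2) (hlt s hs').1 (hlt s hs').1)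
  have h7 : dist (edge q β ς 1 s) (edge q β ς (-1) s) ≤ 2 * s ^ q := by
    refine (dist_le_sum4 _ _).trans (le_of_eq ?_)
    change |ς * s ^ β - ς * s ^ β| + |1 * s ^ q - -1 * s ^ q| + |(0:ℝ) - 0| + |s - s| = _
    rw [sub_self, sub_self, sub_self, abs_zero, show 1 * s ^ q - -1 * s ^ q = 2 * s ^ q by ring,
      abs_of_pos (by positivity)]
    ring
  have h8 : σ * k (edge q β ς 1 s) 0 - σ * k (edge q β ς (-1) s) 0 ≤ C * (2 * s ^ q) := by
    rw [← mul_sub]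
    refine (le_abs_self _).trans ?_
    rw [abs_mul, abs_of_sign hσ, one_mul]
    exact h6.trans (by gcongr)
  have h9 := H₂ s h0 (hs.trans_le (min_le_right _ _))
  rw [div_mul_eq_mul_div, div_le_iff₀ hc] at h9
  have := (hne s hs').2
  linarith

theorem continuous_rpow_height (hβ : 1 < β) : Continuous fun v : R4 => v 3 ^ β :=
  (Real.continuous_rpow_const (by linarith)).comp (by fun_prop)

/-- The preimages of the edges on both sides lie on different sides. -/
theorem sign_edge_ne (h : HexagonIso q β g k C r) (hβ : 1 < β) (hq : β < q) {c δ σ : ℝ}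
    (hc : 0 < c) (hδ : 0 < δ) (hσ : σ = 1 ∨ σ = -1) (H : ∀ ς ε s : ℝ, (ς = 1 ∨ ς = -1) →
      (ε = 1 ∨ ε = -1) → 0 < s → s < δ → c * s ^ β ≤ σ * k (edge q β ς ε s) 0) : False := by
  have hC := h.one_le
  have hC0 : 0 < C := by linarith
  have hr := h.pos
  obtain ⟨M, δ₁, hM, h1, H₁⟩ := h.exists_opposite hβ hq
  obtain ⟨δ₂, h2, h2', H₂⟩ := exists_edge_near hβ hq hM
  obtain ⟨δ₃, h3, h3', H₃⟩ := exists_mul_rpow_le hq (A := 6 * M * C / c) (by positivity)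
  set τ := min (min δ₁ r) (min (min δ δ₂) δ₃) / (2 * C) with hτ
  have hτ0 : 0 < τ := by positivity
  have hτ' : 2 * C * τ = min (min δ₁ r) (min (min δ δ₂) δ₃) := by rw [hτ]; field_simp
  have hτ₁ : 2 * C * τ ≤ δ₁ := hτ'.trans_le ((min_le_left _ _).trans (min_le_left _ _))
  have hτr : 2 * C * τ ≤ r := hτ'.trans_le ((min_le_left _ _).trans (min_le_right _ _))
  have hτδ : 2 * C * τ ≤ δ :=
    hτ'.trans_le ((min_le_right _ _).trans ((min_le_left _ _).trans (min_le_left _ _)))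
  have hτ₂ : 2 * C * τ ≤ δ₂ :=
    hτ'.trans_le ((min_le_right _ _).trans ((min_le_left _ _).trans (min_le_right _ _)))
  have hτ₃ : 2 * C * τ ≤ δ₃ := hτ'.trans_le ((min_le_right _ _).trans (min_le_right _ _))
  have hτC : τ ≤ C * τ := le_mul_of_one_le_left hτ0.le hC
  have hr1 := h.lt_one
  -- This side, with `x = 0` included, is connected through its fold and contains no preimage of an
  -- edge, but it contains both midpoints of the bridge.
  set Q : Set (ℝ × ℝ) := {p | 0 < p.2 ∧ p.2 ≤ τ ∧ |p.1| ≤ 2 * p.2 ∧ σ * p.1 ≤ 0} with hQ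
  have hconv : Convex ℝ Q := by
    intro p hp p' hp' a b ha hb hab
    have hp1 := abs_le.1 hp.2.2.1
    have hp1' := abs_le.1 hp'.2.2.1
    refine ⟨?_, ?_, abs_le.2 ⟨?_, ?_⟩, ?_⟩ <;>
      simp only [Prod.fst_add, Prod.smul_fst, Prod.snd_add, Prod.smul_snd, smul_eq_mul]
    · rcases ha.eq_or_lt with rfl | ha
      · have : b = 1 := by linarith
        rw [this]; linarith [hp'.1]
      · have := mul_pos ha hp.1
        have := mul_nonneg hb hp'.1.le
        linarith
    · have := mul_le_mul_of_nonneg_left hp.2.1 ha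
      have := mul_le_mul_of_nonneg_left hp'.2.1 hb
      nlinarith
    · nlinarith
    · nlinarith
    · have := mul_nonpos_of_nonneg_of_nonpos ha hp.2.2.2
      have := mul_nonpos_of_nonneg_of_nonpos hb hp'.2.2.2
      linarith
  have hfold : |-σ * (2 * τ)| = 2 * τ := by
    rw [abs_mul, abs_neg, abs_of_sign hσ, one_mul, abs_of_pos (by linarith)]
  have hσ2 : σ * σ = 1 := by rcases hσ with rfl | rfl <;> norm_num
  have hpre := isPreconnected_Hexagon hβ hq (Q := Q) (fun p hp => ⟨hp.1, by linarith [hp.2.1],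
    hp.2.2.1⟩) hconv (p := (-σ * (2 * τ), τ)) ⟨hτ0, le_rfl, hfold.le, by
      change σ * (-σ * (2 * τ)) ≤ 0
      nlinarith⟩ hfold
  set X := {v ∈ Hexagon q β | (v 0, v 3) ∈ Q}
  have hXr : ∀ v ∈ X, v 3 < r := fun v hv => by
    have : v 3 ≤ τ := hv.2.2.1
    linarith
  have himg := hpre.image g (h.continuousOn.mono fun v hv => ⟨hv.1, hXr v hv⟩)
  have hht : ∀ v ∈ X, g v 3 ≤ C * τ := fun v hv => by
    have h4 : v 3 ≤ τ := hv.2.2.1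
    exact (h.maps v hv.1 (hXr v hv)).2.2.1.trans (by gcongr)
  have hX0 : ∀ v ∈ X, σ * v 0 ≤ 0 := fun v hv => hv.2.2.2.2
  have hedge : ∀ v ∈ X, |g v 0| ≠ g v 3 ^ β := by
    intro v hv he
    obtain ⟨hg, hkg, -, hg1⟩ := h.maps v hv.1 (hXr v hv)
    obtain ⟨ς, hς, e⟩ := exists_sign (g v 0)
    rw [he] at e
    obtain ⟨ε, hε, e⟩ := eq_edge hβ hq hg hg1 e hς
    have h4 := H ς ε (g v 3) hς hε hg.1 (by linarith [hht v hv])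
    rw [← e, hkg] at h4
    have := Real.rpow_pos_of_pos hg.1 β
    have : 0 < c * g v 3 ^ β := by positivity
    linarith [hX0 v hv]
  have hm : ∀ ε : ℝ, ε = 1 ∨ ε = -1 → sheetMap q β ε (0, τ) ∈ X := fun ε hε =>
    ⟨sheetMap_mem hβ hq hε hτ0 (by linarith) (by simp; linarith), hτ0, le_rfl,
      by simp [sheetMap]; linarith, by simp [sheetMap]⟩
  -- The error `M t^q` can be dropped: an image between `t^β` and `t^β + M t^q` would be close to an
  -- edge, whose preimage would be close to the midpoint `x = 0`.
  have hmx : ∀ ε : ℝ, ε = 1 ∨ ε = -1 → |g (sheetMap q β ε (0, τ)) 0| <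
      g (sheetMap q β ε (0, τ)) 3 ^ β + M * g (sheetMap q β ε (0, τ)) 3 ^ q →
      |g (sheetMap q β ε (0, τ)) 0| < g (sheetMap q β ε (0, τ)) 3 ^ β := by
    intro ε hε hlt
    set m := sheetMap q β ε (0, τ)
    have hmX : m ∈ X := hm ε hε
    obtain ⟨hg, hkg, -, hg1⟩ := h.maps m hmX.1 (hXr m hmX)
    by_contra! hge
    obtain ⟨ς, hς, e⟩ := exists_sign (g m 0)
    obtain ⟨ε', hε', e'⟩ := exists_sign (g m 1)
    have hgt := hht m hmX
    have h4 := H₂ (g m) hg (by linarith) hge hlt.le ς ε' hς hε' e e'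
    have h5 := H ς ε' (g m 3) hς hε' hg.1 (by linarith)
    have h6 := (abs_coord_sub_le (k (g m)) (k (edge q β ς ε' (g m 3))) 0).trans
      (h.lip' _ hg _ (edge_mem hβ hq hς hε' hg.1 hg1) (by linarith)
        (show g m 3 < r by linarith))
    rw [hkg, show m 0 = 0 from rfl, zero_sub, abs_neg] at h6
    have h7 : σ * k (edge q β ς ε' (g m 3)) 0 ≤ |k (edge q β ς ε' (g m 3)) 0| := by
      refine (le_abs_self _).trans_eq ?_
      rw [abs_mul, abs_of_sign hσ, one_mul]
    have h8 : C * dist (g m) (edge q β ς ε' (g m 3)) ≤ C * (3 * M * g m 3 ^ q) := by gcongr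
    have h9 := H₃ (g m 3) hg.1 (by linarith)
    rw [div_mul_eq_mul_div, div_le_iff₀ hc] at h9
    have := Real.rpow_pos_of_pos hg.1 q
    have : 0 < M * C * g m 3 ^ q := by positivity
    linarith
  have hm1 : (1:ℝ) = 1 ∨ (1:ℝ) = -1 := Or.inl rfl
  have hm2 : (-1:ℝ) = 1 ∨ (-1:ℝ) = -1 := Or.inr rfl
  have hτβ := Real.rpow_pos_of_pos hτ0 β
  obtain ⟨hop, hn1⟩ := H₁ _ (hm 1 hm1).1 _ (hm (-1) hm2).1 (show τ < δ₁ by linarith) rfl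
    (by simp [sheetMap]) rfl (by change |(0:ℝ)| ≤ τ ^ β; simpa using hτβ.le)
  obtain ⟨-, hn2⟩ := H₁ _ (hm (-1) hm2).1 _ (hm 1 hm1).1 (show τ < δ₁ by linarith) rfl
    (by simp [sheetMap]) rfl (by change |(0:ℝ)| ≤ τ ^ β; simpa using hτβ.le)
  have hn1 := hmx 1 hm1 hn1
  have hn2 := hmx (-1) hm2 hn2
  have hc0 := continuous_rpow_height hβ
  -- Away from the edges, the interior of the upper half of the bridge is open and closed in the
  -- surface. The connected image meets it as well as its complement.
  have hu : IsOpen {v : R4 | 0 < v 1 ∧ |v 0| < v 3 ^ β} :=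
    (isOpen_lt (f := fun _ : R4 => (0:ℝ)) (g := fun v : R4 => v 1) (by fun_prop)
      (by fun_prop)).inter (isOpen_lt (f := fun v : R4 => |v 0|) (by fun_prop) hc0)
  have hw : IsOpen {v : R4 | v 1 < 0 ∨ v 3 ^ β < |v 0|} :=
    (isOpen_lt (f := fun v : R4 => v 1) (g := fun _ : R4 => (0:ℝ)) (by fun_prop)
      (by fun_prop)).union (isOpen_lt (g := fun v : R4 => |v 0|) hc0 (by fun_prop))
  have hcov : g '' X ⊆
      {v : R4 | 0 < v 1 ∧ |v 0| < v 3 ^ β} ∪ {v : R4 | v 1 < 0 ∨ v 3 ^ β < |v 0|} := by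
    rintro _ ⟨v, hv, rfl⟩
    obtain ⟨hg, -, -, hg1⟩ := h.maps v hv.1 (hXr v hv)
    rcases lt_or_gt_of_ne (hedge v hv) with h4 | h4
    · rcases lt_trichotomy (g v 1) 0 with h5 | h5 | h5
      · exact Or.inr (Or.inl h5)
      · have := hg.2.2.2
        rw [h5, abs_zero] at this
        have h6 := rpow_lt_self_of_lt_one hβ hg.1 hg1
        have h7 := hg.1
        exact absurd this (sheet_pos hβ hq hg.1 hg1 (by linarith)).ne
      · exact Or.inl ⟨h5, h4⟩
    · exact Or.inr (Or.inr h4)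
  have hne : (g '' X ∩ {v : R4 | 0 < v 1 ∧ |v 0| < v 3 ^ β}).Nonempty ∧
      (g '' X ∩ {v : R4 | v 1 < 0 ∨ v 3 ^ β < |v 0|}).Nonempty := by
    rcases mul_neg_iff.1 hop with ⟨ha, hb⟩ | ⟨ha, hb⟩
    · exact ⟨⟨_, ⟨_, hm 1 hm1, rfl⟩, ha, hn1⟩, ⟨_, ⟨_, hm (-1) hm2, rfl⟩, Or.inl hb⟩⟩
    · exact ⟨⟨_, ⟨_, hm (-1) hm2, rfl⟩, hb, hn2⟩, ⟨_, ⟨_, hm 1 hm1, rfl⟩, Or.inl ha⟩⟩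
  obtain ⟨v, -, ⟨ha, hb⟩, hcd⟩ := himg _ _ hu hw hcov hne.1 hne.2
  rcases hcd with hcd | hcd
  · exact lt_asymm ha hcd
  · exact lt_asymm hb hcd

/-- One side of the surface is mapped to the complement of the left side, and contains the
preimages of the edges on the right; the preimages of the edges on the left lie on the other
side. -/
theorem exists_side (h : HexagonIso q β g k C r) (hβ : 1 < β) (hq : β < q) :
    ∃ σ c τ : ℝ, (σ = 1 ∨ σ = -1) ∧ 0 < c ∧ 0 < τ ∧ τ ≤ r ∧
      (∀ v ∈ Hexagon q β, v 3 < τ → 0 < σ * v 0 → -(g v 3 ^ β) < g v 0) ∧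
      ∀ ς ε s : ℝ, (ς = 1 ∨ ς = -1) → (ε = 1 ∨ ε = -1) → 0 < s → s < τ →
        c * s ^ β ≤ ς * σ * k (edge q β ς ε s) 0 := by
  have hC := h.one_le
  have hC0 : 0 < C := by linarith
  have hr := h.pos
  have hr1 := h.lt_one
  obtain ⟨c, δ, hc, hδ, hδr, H⟩ := h.exists_sign_edge hβ hq
  obtain ⟨σ, hσ, H₁⟩ := H 1 (Or.inl rfl)
  obtain ⟨σ', hσ', H₂⟩ := H (-1) (Or.inr rfl)
  have hσσ : σ' = -σ := by
    by_contra hne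
    have e : σ' = σ := by
      rcases hσ with rfl | rfl <;> rcases hσ' with rfl | rfl <;> simp at hne ⊢
    refine h.sign_edge_ne hβ hq hc hδ hσ fun ς ε s hς hε h0 hs => ?_
    rcases hς with rfl | rfl
    · exact H₁ ε s hε h0 hs
    · exact e ▸ H₂ ε s hε h0 hs
  have hτC : δ / C ≤ δ := div_le_self hδ.le hC
  refine ⟨σ, c, δ / C, hσ, hc, by positivity, hτC.trans hδr, ?_, ?_⟩
  swap
  · intro ς ε s hς hε h0 hs
    rcases hς with rfl | rfl
    · rw [one_mul]; exact H₁ ε s hε h0 (hs.trans_le hτC)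
    · rw [neg_one_mul, ← hσσ]; exact H₂ ε s hε h0 (hs.trans_le hτC)
  intro v₀ hv₀ hv₀τ hv₀σ
  set τ := δ / C with hτ
  have hτ0 : 0 < τ := by positivity
  have hCτ : C * τ = δ := by rw [hτ]; field_simp
  have hpre := isPreconnected_half hβ hq hσ hτ0 (by linarith : τ ≤ 1)
  set X := {v ∈ Hexagon q β | v 3 < τ ∧ 0 < σ * v 0}
  have hXτ : ∀ v ∈ X, v 3 < τ := fun v hv => hv.2.1
  have hXr : ∀ v ∈ X, v 3 < r := fun v hv => by linarith [hXτ v hv]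
  have himg := hpre.image g (h.continuousOn.mono fun v hv => ⟨hv.1, hXr v hv⟩)
  have hX0 : ∀ v ∈ X, 0 < σ * v 0 := fun v hv => hv.2.2
  have hedge : ∀ v ∈ X, g v 0 ≠ -(g v 3 ^ β) := by
    intro v hv he
    obtain ⟨hg, hkg, hgt, hg1⟩ := h.maps v hv.1 (hXr v hv)
    obtain ⟨ε, hε, e⟩ := eq_edge hβ hq hg hg1 (ς := -1) (by linarith) (Or.inr rfl)
    have h4 := H₂ ε (g v 3) hε hg.1 (by
      have := mul_lt_mul_of_pos_left (hXτ v hv) hC0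
      linarith)
    rw [← e, hkg, hσσ] at h4
    have := Real.rpow_pos_of_pos hg.1 β
    have : 0 < c * g v 3 ^ β := by positivity
    linarith [hX0 v hv]
  have hc0 := continuous_rpow_height hβ
  have hu : IsOpen {v : R4 | -(v 3 ^ β) < v 0} := isOpen_lt hc0.neg (by fun_prop)
  have hw : IsOpen {v : R4 | v 0 < -(v 3 ^ β)} := isOpen_lt (by fun_prop) hc0.neg
  -- The image of the side is connected and misses the left edges, which are exactly the points of
  -- the surface with `x = -t^β`. It contains a right edge point, so it stays to the right.
  have hcov : g '' X ⊆ {v : R4 | -(v 3 ^ β) < v 0} ∪ {v : R4 | v 0 < -(v 3 ^ β)} := by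
    rintro _ ⟨v, hv, rfl⟩
    rcases lt_or_gt_of_ne (hedge v hv) with h4 | h4
    · exact Or.inr h4
    · exact Or.inl h4
  have hs0 : 0 < τ / (2 * C) := by positivity
  have hsτ : τ / (2 * C) < τ := div_lt_self hτ0 (by linarith)
  have hs1 : τ / (2 * C) < 1 := by linarith
  have hem : edge q β 1 1 (τ / (2 * C)) ∈ Hexagon q β :=
    edge_mem hβ hq (Or.inl rfl) (Or.inl rfl) hs0 hs1
  obtain ⟨hk, hgk, hkt, hk1⟩ := h.maps' _ hem (show τ / (2 * C) < r by linarith)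
  have hkt : k (edge q β 1 1 (τ / (2 * C))) 3 ≤ τ / 2 := by
    refine hkt.trans_eq ?_
    change C * (τ / (2 * C)) = τ / 2
    field_simp
  have hβ0 := Real.rpow_pos_of_pos hs0 β
  have hne : (g '' X ∩ {v : R4 | -(v 3 ^ β) < v 0}).Nonempty := by
    refine ⟨edge q β 1 1 (τ / (2 * C)), ⟨_, ⟨hk, ?_, ?_⟩, hgk⟩, ?_⟩
    · linarith
    · refine lt_of_lt_of_le ?_ (H₁ 1 _ (Or.inl rfl) hs0 (hsτ.trans_le hτC))
      positivity
    · change -((τ / (2 * C)) ^ β) < 1 * (τ / (2 * C)) ^ β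
      linarith
  have hv₀X : v₀ ∈ X := ⟨hv₀, hv₀τ, hv₀σ⟩
  by_contra hcon
  have h5 : g v₀ 0 < -(g v₀ 3 ^ β) :=
    lt_of_le_of_ne (not_lt.1 hcon) (hedge v₀ hv₀X)
  obtain ⟨v, -, ha, hb⟩ := himg _ _ hu hw hcov hne ⟨_, ⟨v₀, hv₀X, rfl⟩, h5⟩
  have hb : v 0 < -(v 3 ^ β) := hb
  exact lt_asymm ha hb

end HexagonIso

/-! ### A function which detects the linking -/

/-- At height `t`, the left half of the wings of `G` is the curve `x = -leftProfile q β t y`,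
`t ^ q ≤ |y| ≤ t`; it is continued by a vertical segment. -/
noncomputable def leftProfile (q β t y : ℝ) : ℝ := profile β q t (min |y| t)

section LeftProfile

variable {q β t y : ℝ}

theorem leftProfile_of_ge (hq : 1 < q) (h0 : 0 < t) (h1 : t < 1) (h : t ≤ |y|) :
    leftProfile q β t y = t := by
  rw [leftProfile, min_eq_right h, profile_self hq h0 h1]

/-- A wing is also a graph over `y`, with the roles of `q` and `β` exchanged and the inverse slope.
-/
theorem slope_mul_slope (hβ : 1 < β) (hq : 1 < q) (h0 : 0 < t) (h1 : t < 1) :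
    slope q β t * slope β q t = 1 := by
  have h2 := rpow_lt_self_of_lt_one hβ h0 h1
  have h3 := rpow_lt_self_of_lt_one hq h0 h1
  have h4 : t - t ^ β ≠ 0 := by linarith
  have h5 : t - t ^ q ≠ 0 := by linarith
  rw [slope, slope]
  field_simp

theorem slope_pos (hβ : 1 < β) (hq : 1 < q) (h0 : 0 < t) (h1 : t < 1) : 0 < slope q β t :=
  div_pos (by linarith [rpow_lt_self_of_lt_one hq h0 h1])
    (by linarith [rpow_lt_self_of_lt_one hβ h0 h1])

theorem profile_profile (hβ : 1 < β) (hq : 1 < q) (h0 : 0 < t) (h1 : t < 1) (a : ℝ) :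
    profile β q t (profile q β t a) = max a (t ^ β) := by
  have h2 := slope_mul_slope hβ hq h0 h1
  have h3 := slope_pos hβ hq h0 h1
  rw [profile, profile, add_sub_cancel_left, max_eq_right (mul_nonneg (le_max_left _ _) h3.le),
    mul_assoc, h2, mul_one]
  rcases le_total a (t ^ β) with h | h
  · rw [max_eq_left (by linarith), max_eq_right h, add_zero]
  · rw [max_eq_right (by linarith), max_eq_left h]; ring

theorem leftProfile_eq (hβ : 1 < β) (hq : β < q) (h0 : 0 < t) (h1 : t < 1) {a : ℝ} (ha : a ≤ t)
    (h : |y| = profile q β t a) : leftProfile q β t y = max a (t ^ β) := by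
  rw [leftProfile, h, min_eq_left (profile_le hβ hq h0 h1 ha),
    profile_profile hβ (hβ.trans hq) h0 h1]

theorem profile_leftProfile (hβ : 1 < β) (hq : β < q) (h0 : 0 < t) (h1 : t < 1) (h : t ^ q ≤ |y|)
    (h' : |y| ≤ t) : |y| = profile q β t (leftProfile q β t y) := by
  rw [leftProfile, min_eq_left h', profile_profile (hβ.trans hq) hβ h0 h1, max_eq_left h]

theorem leftProfile_mem (hβ : 1 < β) (hq : 1 < q) (h0 : 0 ≤ t) (h1 : t < 1) :
    leftProfile q β t y ∈ Icc 0 t := by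
  rcases h0.eq_or_lt with rfl | h0
  · rw [leftProfile, profile, slope, Real.zero_rpow (by linarith), Real.zero_rpow (by linarith)]
    simp
  · have hs := slope_pos hq hβ h0 h1
    have hb := Real.rpow_pos_of_pos h0 β
    refine ⟨?_, ?_⟩
    · rw [leftProfile, profile]; positivity
    · have e : profile β q t t = t := profile_self hq h0 h1
      rw [leftProfile]
      conv_rhs => rw [← e]
      unfold profile
      gcongr
      exact min_le_right _ _

theorem leftProfile_pos (hβ : 1 < β) (hq : 1 < q) (h0 : 0 < t) (h1 : t < 1) :
    0 < leftProfile q β t y := by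
  have hs := slope_pos hq hβ h0 h1
  have hb := Real.rpow_pos_of_pos h0 β
  rw [leftProfile, profile]; positivity

theorem leftProfile_le (hβ : 1 < β) (hq : 1 < q) (h0 : 0 < t) (h1 : t < 1) :
    leftProfile q β t y ≤ t := (leftProfile_mem hβ hq h0.le h1).2

end LeftProfile

theorem continuousAt_of_abs_le {X : Type*} [TopologicalSpace X] {r b : X → ℝ} {x : X}
    (hr : ContinuousAt r x) (h0 : r x = 0) (hb : ∀ᶠ y in 𝓝 x, |b y| ≤ r y) : ContinuousAt b x := by
  have h1 : b x = 0 := by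
    have := hb.self_of_nhds
    rw [h0] at this
    exact abs_nonpos_iff.1 this
  rw [ContinuousAt, h1]
  refine squeeze_zero_norm' hb ?_
  rw [← h0]; exact hr

/-- Minus the `x`-coordinate of the left curve at the height `t` and at the level `y`. -/
noncomputable def curveX (q β t y : ℝ) : ℝ :=
  t * circleX (max (-5 * t) (min (-t) y) / t) + (leftProfile q β t y - t)

/-- Minus the `z`-coordinate of the left curve at the height `t` and at the level `y`. -/
noncomputable def curveZ (t y : ℝ) : ℝ := t * circleZ (max (-5 * t) (min (-t) y) / t)

/-- The outer arcs of the model knot `L` are `|x| = outerAt t y` at the height `t`. -/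
noncomputable def outerAt (t y : ℝ) : ℝ := t + 2 / 3 * max 0 (min (t - y) (y + 5 * t))

/-- A function whose zeros are the left half of the surface of the model knot `L`, closed by a
segment close to the edges of the bridge. -/
noncomputable def linkFun (q β : ℝ) (v : R4) : ℂ :=
  let t := max 0 (v 3)
  let a := bend (v 0) (v 2)
  let b := bend (v 2) (v 0)
  (((a + curveX q β t (v 1) : ℝ) : ℂ) + ((b + curveZ t (v 1) : ℝ) : ℂ) * Complex.I) *
      (((a + outerAt t (v 1) : ℝ) : ℂ) - (b : ℂ) * Complex.I) +
    ((max 0 (v 1 - t) ^ 2 + max 0 (-5 * t - v 1) ^ 2 + max 0 (-v 3) ^ 2 : ℝ) : ℂ)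

section LinkFun

variable {q β : ℝ}

theorem outerAt_eq {t y : ℝ} (ht : 0 < t) : outerAt t y = t * outer (y / t) := by
  have e : max 0 (min (t - y) (y + 5 * t)) = t * max 0 (min (1 - y / t) (y / t + 5)) := by
    rw [mul_max_of_nonneg _ _ ht.le, mul_min_of_nonneg _ _ ht.le, mul_zero]
    congr 2 <;> field_simp
  rw [outerAt, outer, e]; ring

theorem le_outerAt (t y : ℝ) : t ≤ outerAt t y := by
  rw [outerAt]; linarith [le_max_left 0 (min (t - y) (y + 5 * t))]

theorem circleX_neg_one : circleX (-1) = 1 := by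
  rw [circleX, show Real.pi / 2 * (-1 + 5) = 2 * Real.pi by ring, Real.cos_two_pi]

theorem circleZ_neg_one : circleZ (-1) = 0 := by
  rw [circleZ, show Real.pi / 2 * (-1 + 5) = 2 * Real.pi by ring, Real.sin_two_pi]

theorem circleX_neg_five : circleX (-5) = 1 := by simp [circleX]

theorem circleZ_neg_five : circleZ (-5) = 0 := by simp [circleZ]

theorem curveX_of_ge {t y : ℝ} (ht : 0 < t) (h : -t ≤ y) :
    curveX q β t y = leftProfile q β t y := by
  rw [curveX, min_eq_left h, max_eq_right (by linarith), neg_div, div_self ht.ne', circleX_neg_one]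
  ring

theorem curveZ_of_ge {t y : ℝ} (ht : 0 < t) (h : -t ≤ y) : curveZ t y = 0 := by
  rw [curveZ, min_eq_left h, max_eq_right (by linarith), neg_div, div_self ht.ne', circleZ_neg_one,
    mul_zero]

theorem curveX_of_mem (hq : 1 < q) {t y : ℝ} (ht : 0 < t) (ht1 : t < 1) (h : -5 * t ≤ y)
    (h' : y ≤ -t) : curveX q β t y = t * circleX (y / t) := by
  rw [curveX, min_eq_right h', max_eq_right h, leftProfile_of_ge hq ht ht1, sub_self, add_zero]
  rw [abs_of_nonpos (by linarith)]; linarith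

theorem curveZ_of_mem {t y : ℝ} (h : -5 * t ≤ y) (h' : y ≤ -t) :
    curveZ t y = t * circleZ (y / t) := by
  rw [curveZ, min_eq_right h', max_eq_right h]

theorem curveX_of_le (hq : 1 < q) {t y : ℝ} (ht : 0 < t) (ht1 : t < 1) (h : y ≤ -5 * t) :
    curveX q β t y = t := by
  rw [curveX, min_eq_right (by linarith), max_eq_left h, leftProfile_of_ge hq ht ht1, sub_self,
    add_zero, mul_div_cancel_right₀ _ ht.ne', circleX_neg_five, mul_one]
  rw [abs_of_nonpos (by linarith)]; linarith

theorem curveZ_of_le {t y : ℝ} (ht : 0 < t) (h : y ≤ -5 * t) : curveZ t y = 0 := by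
  rw [curveZ, min_eq_right (by linarith), max_eq_left h, mul_div_cancel_right₀ _ ht.ne',
    circleZ_neg_five, mul_zero]

/-- The critical height is zero. There the helix terms are `t` times bounded functions of `y / t`,
and `leftProfile` is squeezed between `0` and `t`. -/
theorem continuousAt_linkFun (hβ : 1 < β) (hq : 1 < q) {v : R4} (h1 : v 3 < 1) :
    ContinuousAt (linkFun q β) v := by
  have hc : ∀ i, ContinuousAt (fun v : R4 => v i) v := fun i => by fun_prop
  have ht : ContinuousAt (fun v : R4 => max 0 (v 3)) v := by fun_prop
  have h1' : max 0 (v 3) < 1 := max_lt one_pos h1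
  have hcirc : ∀ f : ℝ → ℝ, Continuous f → (∀ y, |f y| ≤ 1) → ContinuousAt (fun v : R4 =>
      max 0 (v 3) * f (max (-5 * max 0 (v 3)) (min (-max 0 (v 3)) (v 1)) / max 0 (v 3))) v := by
    intro f hf hb
    refine (continuous_mul_of_bounded (by fun_prop) (fun v => hb _) fun v hv => ?_).continuousAt
    refine hf.continuousAt.comp (f := fun v : R4 =>
      max (-5 * max 0 (v 3)) (min (-max 0 (v 3)) (v 1)) / max 0 (v 3)) ?_
    exact ContinuousAt.div (by fun_prop) (by fun_prop) hv
  have hX : Continuous circleX := by unfold circleX; fun_prop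
  have hZ : Continuous circleZ := by unfold circleZ; fun_prop
  have hp : ContinuousAt (fun v : R4 => leftProfile q β (max 0 (v 3)) (v 1)) v := by
    rcases (le_max_left 0 (v 3)).eq_or_lt with h | h
    · refine continuousAt_of_abs_le ht h.symm ?_
      filter_upwards [ht.eventually (gt_mem_nhds h1')] with w hw
      have := leftProfile_mem (q := q) (y := w 1) hβ hq (le_max_left 0 (w 3)) hw
      rw [abs_of_nonneg this.1]; exact this.2
    · exact continuousAt_profile hq h h1' ht (Filter.Tendsto.min (hc 1).abs ht)
  have ha : ContinuousAt (fun v : R4 => bend (v 0) (v 2)) v :=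
    (continuous_bend (by fun_prop) (by fun_prop)).continuousAt
  have hb : ContinuousAt (fun v : R4 => bend (v 2) (v 0)) v :=
    (continuous_bend (by fun_prop) (by fun_prop)).continuousAt
  have hcX : ContinuousAt (fun v : R4 => curveX q β (max 0 (v 3)) (v 1)) v :=
    (hcirc _ hX fun y => Real.abs_cos_le_one _).add (hp.sub ht)
  have hcZ : ContinuousAt (fun v : R4 => curveZ (max 0 (v 3)) (v 1)) v :=
    hcirc _ hZ fun y => Real.abs_sin_le_one _
  have ho : ContinuousAt (fun v : R4 => outerAt (max 0 (v 3)) (v 1)) v := by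
    unfold outerAt; fun_prop
  have hof : ∀ {f : R4 → ℝ}, ContinuousAt f v → ContinuousAt (fun v => (f v : ℂ)) v :=
    fun hf => Complex.continuous_ofReal.continuousAt.comp hf
  have hE : ContinuousAt (fun v : R4 => max 0 (v 1 - max 0 (v 3)) ^ 2 +
      max 0 (-5 * max 0 (v 3) - v 1) ^ 2 + max 0 (-v 3) ^ 2) v := by fun_prop
  exact (((hof (ha.add hcX)).add ((hof (hb.add hcZ)).mul continuousAt_const)).mul
    ((hof (ha.add ho)).sub ((hof hb).mul continuousAt_const))).add (hof hE)

/-- `linkFun` has the form `A * conj B + E`, where `A` vanishes on the inner part and `B` on the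
outer part of the left curve, and `E ≥ 0` penalizes levels and heights off the curve. Where the two
parts meet, `A = B` and the product is `|A|^2`. The conjugate thus lets the arcs close up without
zeros beyond the ends. -/
theorem linkFun_re (v : R4) : (linkFun q β v).re =
    (bend (v 0) (v 2) + curveX q β (max 0 (v 3)) (v 1)) *
      (bend (v 0) (v 2) + outerAt (max 0 (v 3)) (v 1)) +
    (bend (v 2) (v 0) + curveZ (max 0 (v 3)) (v 1)) * bend (v 2) (v 0) +
    (max 0 (v 1 - max 0 (v 3)) ^ 2 + max 0 (-5 * max 0 (v 3) - v 1) ^ 2 + max 0 (-v 3) ^ 2) := by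
  simp only [linkFun, Complex.add_re, Complex.mul_re, Complex.sub_re, Complex.ofReal_re,
    Complex.ofReal_im, Complex.I_re, Complex.I_im, Complex.add_im, Complex.sub_im, Complex.mul_im]
  ring

theorem linkFun_im (v : R4) : (linkFun q β v).im =
    (bend (v 2) (v 0) + curveZ (max 0 (v 3)) (v 1)) *
      (bend (v 0) (v 2) + outerAt (max 0 (v 3)) (v 1)) -
    (bend (v 0) (v 2) + curveX q β (max 0 (v 3)) (v 1)) * bend (v 2) (v 0) := by
  simp only [linkFun, Complex.add_re, Complex.mul_re, Complex.sub_re, Complex.ofReal_re,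
    Complex.ofReal_im, Complex.I_re, Complex.I_im, Complex.add_im, Complex.sub_im, Complex.mul_im]
  ring

theorem bend_pos {x z : ℝ} (hx : 0 < x) : 0 < bend x z := by
  have h : 0 < |x| + |z| := by have := abs_pos.2 hx.ne'; positivity
  have h1 : x / (|x| + |z|) ≤ 1 := by
    rw [div_le_one h]; linarith [le_abs_self x, abs_nonneg z]
  have h2 : 0 < x / (|x| + |z|) := div_pos hx h
  have hp := Real.pi_pos
  exact mul_pos h (Real.sin_pos_of_pos_of_lt_pi (by positivity) (by nlinarith))

/-- The real part is positive to the right of the bridge. -/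
theorem linkFun_re_pos_of_pos (hβ : 1 < β) (hq : 1 < q) {v : R4} (h0 : 0 < v 3) (h1 : v 3 < 1)
    (hx : 0 < v 0) (hy : -v 3 ≤ v 1) : 0 < (linkFun q β v).re := by
  rw [linkFun_re, max_eq_right h0.le, curveX_of_ge h0 hy, curveZ_of_ge h0 hy, add_zero]
  have h2 := bend_pos (z := v 2) hx
  have h3 := leftProfile_pos (y := v 1) hβ hq h0 h1
  have h4 := le_outerAt (v 3) (v 1)
  have h5 : 0 < (bend (v 0) (v 2) + leftProfile q β (v 3) (v 1)) *
    (bend (v 0) (v 2) + outerAt (v 3) (v 1)) := mul_pos (by linarith) (by linarith)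
  have h6 := mul_self_nonneg (bend (v 2) (v 0))
  positivity

/-- For `t ≤ 0` the curve collapses to the axis, and the real part becomes `(|x| + |z|)^2 + y^2 +
t^2`. -/
theorem pos_of_linkFun_eq_zero {v : R4} (hv : v ≠ 0) (h : linkFun q β v = 0) (hβ : 1 < β)
    (hq : 1 < q) : 0 < v 3 := by
  by_contra! hc
  have hre := congrArg Complex.re h
  have e : max 0 (v 3) = 0 := max_eq_left hc
  have e1 : curveX q β 0 (v 1) = 0 := by
    have := leftProfile_mem (q := q) (y := v 1) hβ hq le_rfl one_pos
    rw [Icc_self, mem_singleton_iff] at this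
    rw [curveX, this]; simp
  have e2 : curveZ 0 (v 1) = 0 := by rw [curveZ]; simp
  have e3 : outerAt 0 (v 1) = 0 := by
    rw [outerAt, max_eq_left]
    · simp
    · rcases le_total (v 1) 0 with h | h
      · exact min_le_of_right_le (by linarith)
      · exact min_le_of_left_le (by linarith)
  rw [linkFun_re, e, e1, e2, e3, Complex.zero_re, add_zero, add_zero] at hre
  have h5 := bend_sq_add_sq (v 0) (v 2)
  have h3 : max 0 (-v 3) = -v 3 := max_eq_right (by linarith)
  have h6 : max 0 (v 1 - 0) ^ 2 + max 0 (-5 * 0 - v 1) ^ 2 = v 1 ^ 2 := by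
    rcases le_total (v 1) 0 with h | h
    · rw [max_eq_left (by linarith), max_eq_right (by linarith)]; ring
    · rw [max_eq_right (by linarith), max_eq_left (by linarith)]; ring
  rw [h3] at hre
  have h7 := sq_nonneg (|v 0| + |v 2|)
  have hx : |v 0| + |v 2| = 0 := by nlinarith [sq_nonneg (v 1), sq_nonneg (v 3)]
  have ha := abs_nonneg (v 0)
  have hb := abs_nonneg (v 2)
  refine hv (R4.ext (abs_eq_zero.1 (by linarith)) ?_ (abs_eq_zero.1 (by linarith)) ?_)
  · exact pow_eq_zero_iff two_ne_zero |>.1 (by nlinarith [sq_nonneg (v 1), sq_nonneg (v 3)])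
  · exact pow_eq_zero_iff two_ne_zero |>.1 (by nlinarith [sq_nonneg (v 1), sq_nonneg (v 3)])

theorem rounding_injective : Function.Injective rounding :=
  Function.LeftInverse.injective (g := roundingInv)
    fun _ => R4.ext (unbend_bend _ _) rfl (unbend_bend _ _) rfl

theorem rounding_smul (c : ℝ) (v : R4) (hc : 0 < c) : rounding (c • v) = c • rounding v :=
  R4.ext (bend_mul _ _ hc) rfl (bend_mul _ _ hc) rfl

/-- Away from the cut, the zeros lie on the surface of the model knot `L`. -/
theorem mem_of_linkFun_eq_zero (hβ : 1 < β) (hq : β < q) {v : R4} (h0 : 0 < v 3) (h1 : v 3 < 1)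
    (h : linkFun q β v = 0) : v ∈ Surf q β modelL ∨
      v 0 = -(v 3 ^ β) ∧ |v 1| ≤ v 3 ^ q ∧ v 2 = 0 := by
  have hq1 := hβ.trans hq
  have hre := congrArg Complex.re h
  have him := congrArg Complex.im h
  have hmax := max_eq_right h0.le
  have hneg : max 0 (-v 3) = 0 := max_eq_left (by linarith)
  rw [linkFun_re, hmax, hneg, Complex.zero_re] at hre
  rw [linkFun_im, hmax, Complex.zero_im] at him
  set a := bend (v 0) (v 2)
  set b := bend (v 2) (v 0)
  have hround : ∀ p : R4, rounding p = !₂[a, v 1, b, v 3] → v = p := fun p hp =>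
    rounding_injective (hp.trans rfl).symm
  -- Beyond the ends of the curve both factors agree up to conjugation, and the real part is a sum
  -- of squares with positive penalty `d^2`.
  have hsq : ∀ d : ℝ, 0 < d → (a + v 3) * (a + v 3) + b * b + d ^ 2 ≠ 0 := fun d hd => by
    nlinarith [mul_self_nonneg (a + v 3), mul_self_nonneg b, pow_pos hd 2]
  rcases lt_or_ge (v 3) (v 1) with hy | hy
  · have ho : outerAt (v 3) (v 1) = v 3 := by
      rw [outerAt, max_eq_left (min_le_of_left_le (by linarith))]; ring
    rw [curveX_of_ge h0 (by linarith), curveZ_of_ge h0 (by linarith), ho,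
      leftProfile_of_ge hq1 h0 h1 (hy.le.trans (le_abs_self _)), max_eq_right (by linarith),
      max_eq_left (by linarith)] at hre
    exact absurd (by linarith) (hsq (v 1 - v 3) (by linarith))
  rcases lt_or_ge (v 1) (-5 * v 3) with hy' | hy'
  · have ho : outerAt (v 3) (v 1) = v 3 := by
      rw [outerAt, max_eq_left (min_le_of_right_le (by linarith))]; ring
    rw [curveX_of_le hq1 h0 h1 hy'.le, curveZ_of_le h0 hy'.le, ho, max_eq_left (by linarith),
      max_eq_right (by linarith)] at hre
    exact absurd (by linarith) (hsq (-5 * v 3 - v 1) (by linarith))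
  rw [max_eq_left (by linarith), max_eq_left (by linarith)] at hre
  -- This is the multiplicativity of the modulus, so one of the two factors vanishes.
  have hmul : ((a + curveX q β (v 3) (v 1)) ^ 2 + (b + curveZ (v 3) (v 1)) ^ 2) *
      ((a + outerAt (v 3) (v 1)) ^ 2 + b ^ 2) = 0 := by
    have e1 : (a + curveX q β (v 3) (v 1)) * (a + outerAt (v 3) (v 1)) +
      (b + curveZ (v 3) (v 1)) * b = 0 := by linarith
    calc _ = ((a + curveX q β (v 3) (v 1)) * (a + outerAt (v 3) (v 1)) +
        (b + curveZ (v 3) (v 1)) * b) ^ 2 + ((b + curveZ (v 3) (v 1)) *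
        (a + outerAt (v 3) (v 1)) - (a + curveX q β (v 3) (v 1)) * b) ^ 2 := by ring
      _ = 0 := by rw [e1, him]; ring
  have hzero : ∀ x y : ℝ, x ^ 2 + y ^ 2 = 0 → x = 0 ∧ y = 0 := fun x y hxy =>
    ⟨pow_eq_zero_iff two_ne_zero |>.1 (by nlinarith [sq_nonneg x, sq_nonneg y]),
      pow_eq_zero_iff two_ne_zero |>.1 (by nlinarith [sq_nonneg x, sq_nonneg y])⟩
  have hsurf : v 2 = 0 → |v 0| = v 3 → |v 1| = v 3 → v ∈ Surf q β modelL := fun hz hx hy => by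
    refine Or.inr ⟨h0, Or.inl ((mem_G_iff hβ hq h0 h1).2 ⟨hz, hx.le, ?_⟩)⟩
    rw [hx, hy, profile_self hβ h0 h1]
  rcases mul_eq_zero.1 hmul with hz | hz
  · obtain ⟨hX, hZ⟩ := hzero _ _ hz
    rcases le_or_gt (v 1) (-v 3) with hy1 | hy1
    · left
      rw [curveX_of_mem hq1 h0 h1 hy' hy1] at hX
      rw [curveZ_of_mem hy' hy1] at hZ
      have hY : -5 ≤ v 1 / v 3 := by rw [le_div_iff₀ h0]; exact hy'
      have hY' : v 1 / v 3 ≤ -1 := by rw [div_le_iff₀ h0]; linarith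
      have e := hround (v 3 • lift !₂[-1 * strandX (v 1 / v 3), v 1 / v 3,
        -1 * strandZ (v 1 / v 3)]) (by
          rw [rounding_smul _ _ h0, rounding_strand (Or.inr rfl) hY hY']
          refine R4.ext ?_ ?_ ?_ ?_ <;> simp
          · linarith
          · field_simp
          · linarith)
      have ep : proj v = !₂[-1 * strandX (v 1 / v 3), v 1 / v 3, -1 * strandZ (v 1 / v 3)] := by
        conv_lhs => rw [e, proj_smul h0.ne', proj_lift]
      by_cases hs : proj v ∈ square
      · have h3 : v 1 / v 3 = -1 := le_antisymm hY' (abs_le.1 hs.2.1).1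
        have e0 : proj v 0 = -1 := by
          rw [ep, h3, strandX_of_ge (by norm_num)]; norm_num
        have h4 : v 0 = -v 3 := by
          rw [proj_zero, div_eq_iff h0.ne'] at e0; linarith
        have h5 : v 1 = -v 3 := by rw [div_eq_iff h0.ne'] at h3; linarith
        refine hsurf ?_ ?_ ?_
        · have := hs.2.2
          rw [proj_two, div_eq_zero_iff] at this
          exact this.resolve_right h0.ne'
        · rw [h4, abs_neg, abs_of_pos h0]
        · rw [h5, abs_neg, abs_of_pos h0]
      · refine Or.inr ⟨h0, Or.inr ⟨?_, hs⟩⟩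
        rw [modelL_eq, ep]
        exact mem_strands_inner (Or.inr rfl) hY hY'
    · rw [curveX_of_ge h0 hy1.le] at hX
      rw [curveZ_of_ge h0 hy1.le, add_zero] at hZ
      have e := hround !₂[-leftProfile q β (v 3) (v 1), v 1, 0, v 3] (by
        rw [rounding_of_eq_zero rfl, hZ, show a = -leftProfile q β (v 3) (v 1) by linarith])
      have e0 : v 0 = -leftProfile q β (v 3) (v 1) := congrArg (fun p : R4 => p 0) e
      have e2 : v 2 = 0 := congrArg (fun p : R4 => p 2) e
      have hy2 : |v 1| ≤ v 3 := abs_le.2 ⟨hy1.le, hy⟩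
      rcases le_total |v 1| (v 3 ^ q) with hc | hc
      · right
        refine ⟨?_, hc, e2⟩
        rw [e0, leftProfile, min_eq_left hy2, profile_of_le hc]
      · left
        refine Or.inr ⟨h0, Or.inl ((mem_G_iff hβ hq h0 h1).2 ⟨e2, ?_, ?_⟩)⟩
        · rw [e0, abs_neg, abs_of_pos (leftProfile_pos hβ hq1 h0 h1)]
          exact leftProfile_le hβ hq1 h0 h1
        · rw [e0, abs_neg, abs_of_pos (leftProfile_pos hβ hq1 h0 h1)]
          exact profile_leftProfile hβ hq h0 h1 hc hy2
  · left
    obtain ⟨hX, hZ⟩ := hzero _ _ hz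
    have e := hround !₂[-outerAt (v 3) (v 1), v 1, 0, v 3] (by
      rw [rounding_of_eq_zero rfl, hZ, show a = -outerAt (v 3) (v 1) by linarith])
    have e0 : v 0 = -outerAt (v 3) (v 1) := congrArg (fun p : R4 => p 0) e
    have e2 : v 2 = 0 := congrArg (fun p : R4 => p 2) e
    have ho := le_outerAt (v 3) (v 1)
    have hx : |v 0| = outerAt (v 3) (v 1) := by rw [e0, abs_neg, abs_of_pos (by linarith)]
    by_cases hs : proj v ∈ square
    · have hs' := (proj_mem_square_iff h0).1 hs
      have h3 : |v 0| = v 3 := le_antisymm hs'.1 (by linarith)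
      refine hsurf e2 h3 (le_antisymm hs'.2.1 ?_)
      rw [h3, outerAt] at hx
      have h5 := le_max_right 0 (min (v 3 - v 1) (v 1 + 5 * v 3))
      have h6 : min (v 3 - v 1) (v 1 + 5 * v 3) ≤ 0 := by linarith
      have h7 := abs_le.1 hs'.2.1
      rcases min_le_iff.1 h6 with h6 | h6
      · exact (by linarith : v 3 ≤ v 1).trans (le_abs_self _)
      · linarith
    · refine Or.inr ⟨h0, Or.inr ⟨?_, hs⟩⟩
      rw [modelL_eq]
      refine Or.inl (Or.inr ⟨by simp [e2], ?_, ?_, ?_⟩)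
      · rw [proj_one, le_div_iff₀ h0]; exact hy'
      · rw [proj_one, div_le_one h0]; exact hy
      · rw [proj_zero, proj_one, abs_div, abs_of_pos h0, hx, outerAt_eq h0]
        field_simp

/-- The argument of `linkFun` along the right half of the surface of the model knot `L`. -/
noncomputable def windingAngle (q : ℝ) (v : R4) : ℝ :=
  2 * Real.pi * max 0 (min 1 (min (2 - |v 0| / v 3) (-v 1 / v 3 ^ q)))

theorem windingAngle_of_nonneg {v : R4} (h0 : 0 < v 3) (hy : 0 ≤ v 1) : windingAngle q v = 0 := by
  have : -v 1 / v 3 ^ q ≤ 0 :=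
    div_nonpos_of_nonpos_of_nonneg (by linarith) (Real.rpow_nonneg h0.le q)
  rw [windingAngle, max_eq_left, mul_zero]
  exact min_le_of_right_le (min_le_of_right_le this)

theorem windingAngle_of_le {v : R4} (h0 : 0 < v 3) (hx : |v 0| ≤ v 3) (hy : v 1 ≤ -(v 3 ^ q)) :
    windingAngle q v = 2 * Real.pi := by
  have h1 : 1 ≤ -v 1 / v 3 ^ q := by
    rw [le_div_iff₀ (Real.rpow_pos_of_pos h0 q)]; linarith
  have h2 : |v 0| / v 3 ≤ 1 := (div_le_one h0).2 hx
  rw [windingAngle, min_eq_left (le_min (by linarith) h1), max_eq_right zero_le_one, mul_one]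

/-- `outer > 1` except at the lower end, where `circleX = 1`. -/
theorem outer_add_circleX_pos (y : ℝ) (h : -5 ≤ y) (h' : y ≤ -1) : 0 < outer y + circleX y := by
  rcases h.eq_or_lt with rfl | h
  · rw [circleX_neg_five]; linarith [one_le_outer (-5)]
  · have h1 : -1 ≤ circleX y := Real.neg_one_le_cos _
    rcases le_total y (-2) with h2 | h2
    · rw [outer_of_le h2 h.le]; linarith
    · rw [outer_of_ge h2 (by linarith)]; linarith

/-- The argument of `linkFun` on the image of `p` differs from `windingAngle` by less than `π / 2`.
On the bridge, the wings and the outer arc `linkFun` is real and positive, and the angle is `0` or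
`2π`. On the inner strand the angle is that of the helix. -/
theorem linkFun_mul_exp_re_pos (hβ : 1 < β) (hq : β < q) {p : R4} (hp : p ∈ Hexagon q β)
    (h1 : p 3 < 1) (hx : -(p 3 ^ β) < p 0) :
    0 < (linkFun q β (coneMap modelMap p) *
      Complex.exp (-(windingAngle q p : ℂ) * Complex.I)).re := by
  have hq1 := hβ.trans hq
  have h0 := hp.1
  have hlt := rpow_lt_self_of_lt_one hβ h0 h1
  have hqlt := rpow_lt_self_of_lt_one hq1 h0 h1
  have hb := Real.rpow_pos_of_pos h0 β
  have hq0 := Real.rpow_pos_of_pos h0 q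
  rcases le_or_gt |p 0| (p 3) with hx' | hx'
  · have hyp := hp.2.2.2
    have hys := sheet_le hβ hq h0 h1 (a := |p 0|)
    rw [coneMap_of_mem_squareCone (fun _ h => modelMap_of_mem h) ⟨hx', by linarith, hp.2.1⟩]
    have hexp : Complex.exp (-(windingAngle q p : ℂ) * Complex.I) = 1 := by
      rcases le_total 0 (p 1) with hy | hy
      · simp [windingAngle_of_nonneg h0 hy]
      · rw [abs_of_nonpos hy, sheet_of_le hβ hq h0 h1 hx'] at hyp
        have := rpow_le_profile hβ hq h0 h1 |p 0|
        rw [windingAngle_of_le h0 hx' (by linarith), neg_mul, Complex.exp_neg]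
        push_cast
        rw [Complex.exp_two_pi_mul_I, inv_one]
    rw [sheet_of_le hβ hq h0 h1 hx'] at hyp
    have hyle : -p 3 ≤ p 1 := by
      have := profile_le hβ hq h0 h1 hx'
      linarith [neg_abs_le (p 1)]
    rw [hexp, mul_one, linkFun_re, max_eq_right h0.le, curveX_of_ge h0 hyle, curveZ_of_ge h0 hyle,
      hp.2.1, bend_zero_right, bend_zero_left, leftProfile_eq hβ hq h0 h1 hx' hyp]
    have h3 := le_outerAt (p 3) (p 1)
    have h4 : 0 < p 0 + max |p 0| (p 3 ^ β) := by linarith [le_max_right |p 0| (p 3 ^ β)]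
    have h5 : 0 < p 0 + outerAt (p 3) (p 1) := by linarith
    have h6 := mul_pos h4 h5
    rw [mul_zero, add_zero]
    positivity
  have hx0 : 0 < p 0 := by
    by_contra! hc
    rw [abs_of_nonpos hc] at hx'
    linarith
  have hxp := hp.2.2
  rw [abs_of_pos hx0] at hx' hxp
  rw [sheet_of_ge hβ hq h0 h1 hx'.le] at hxp
  have hyt : |p 1 / p 3| ≤ 1 := by
    rw [abs_div, abs_of_pos h0, div_le_one h0]; linarith
  have hY := abs_le.1 hyt
  have harc : proj p = kArc 1 (p 1 / p 3) := by
    refine R3.ext ?_ rfl ?_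
    · simp only [proj_zero, kArc, vec3_zero, abs_div, abs_of_pos h0, hxp.2]
      field_simp
      ring
    · simp [kArc, hp.2.1]
  have hcone : coneMap modelMap p = p 3 • lift (lArc 1 (p 1 / p 3)) := by
    rw [coneMap_of_pos h0, harc, modelMap_kArc (Or.inl rfl) hyt]
  have he3 : (coneMap modelMap p) 3 = p 3 := coneMap_three _ _
  rcases le_total 0 (p 1) with hy | hy
  · have hyd : 0 ≤ p 1 / p 3 := div_nonneg hy h0.le
    rw [windingAngle_of_nonneg h0 hy]
    simp only [Complex.ofReal_zero, neg_zero, zero_mul, Complex.exp_zero, mul_one]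
    rw [lArc_of_nonneg hyd] at hcone
    set y := 6 * (p 1 / p 3) - 5 with hyy
    have e0 : coneMap modelMap p 0 = p 3 * outer y := by rw [hcone]; simp
    have e1 : coneMap modelMap p 1 = p 3 * y := by rw [hcone]; simp
    have e2 : coneMap modelMap p 2 = 0 := by rw [hcone]; simp
    rw [linkFun_re, he3, max_eq_right h0.le, e0, e1, e2, bend_zero_right, bend_zero_left, mul_zero,
      add_zero]
    have h3 := le_outerAt (p 3) (p 3 * y)
    have h4 := mul_le_mul_of_nonneg_left (one_le_outer y) h0.le
    have h5 : 0 < p 3 * outer y + curveX q β (p 3) (p 3 * y) := by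
      rcases le_total y (-1) with h | h
      · rw [curveX_of_mem hq1 h0 h1 (by nlinarith) (by nlinarith), mul_div_cancel_left₀ _ h0.ne',
          ← mul_add]
        exact mul_pos h0 (outer_add_circleX_pos y (by linarith) h)
      · rw [curveX_of_ge h0 (by nlinarith)]
        have := leftProfile_pos (y := p 3 * y) hβ hq1 h0 h1
        linarith
    have h6 : 0 < p 3 * outer y + outerAt (p 3) (p 3 * y) := by linarith
    have h7 := mul_pos h5 h6
    positivity
  · have hyd : p 1 / p 3 ≤ 0 := div_nonpos_of_nonpos_of_nonneg hy h0.le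
    rw [lArc_of_nonpos hyd] at hcone
    set y := -5 - 4 * (p 1 / p 3) with hyy
    have hy5 : -5 ≤ y := by linarith
    have hy1 : y ≤ -1 := by linarith
    have hround : rounding (coneMap modelMap p) =
        p 3 • lift !₂[1 * circleX y, y, 1 * circleZ y] := by
      rw [hcone, rounding_smul _ _ h0, rounding_strand (Or.inl rfl) hy5 hy1]
    have ea : bend (coneMap modelMap p 0) (coneMap modelMap p 2) = p 3 * circleX y := by
      have := congrArg (fun w : R4 => w 0) hround
      simpa [rounding] using this
    have eb : bend (coneMap modelMap p 2) (coneMap modelMap p 0) = p 3 * circleZ y := by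
      have := congrArg (fun w : R4 => w 2) hround
      simpa [rounding] using this
    have e1 : coneMap modelMap p 1 = p 3 * y := by rw [hcone]; simp
    have hw : windingAngle q p = Real.pi / 2 * (y + 5) := by
      have h3 : 2 - |p 0| / p 3 = -(p 1 / p 3) := by
        have : |p 1| = -p 1 := abs_of_nonpos hy
        rw [abs_of_pos hx0, show p 0 = 2 * p 3 + p 1 by linarith]
        field_simp
        ring
      have h4 : -(p 1 / p 3) ≤ -p 1 / p 3 ^ q := by
        rw [← neg_div]
        exact div_le_div_of_nonneg_left (by linarith) hq0 hqlt.le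
      rw [windingAngle, h3, min_eq_left h4, min_eq_right (by linarith), max_eq_right (by linarith)]
      rw [hyy]; ring
    have hky : -5 * p 3 ≤ p 3 * y := by nlinarith
    have hky' : p 3 * y ≤ -p 3 := by nlinarith
    have hc1 : curveX q β (p 3) (p 3 * y) = p 3 * circleX y := by
      rw [curveX_of_mem hq1 h0 h1 hky hky', mul_div_cancel_left₀ _ h0.ne']
    have hc2 : curveZ (p 3) (p 3 * y) = p 3 * circleZ y := by
      rw [curveZ_of_mem hky hky', mul_div_cancel_left₀ _ h0.ne']
    have ho : outerAt (p 3) (p 3 * y) = p 3 * outer y := by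
      rw [outerAt_eq h0, mul_div_cancel_left₀ _ h0.ne']
    have hm1 : max 0 (p 3 * y - p 3) = 0 := max_eq_left (by linarith)
    have hm2 : max 0 (-5 * p 3 - p 3 * y) = 0 := max_eq_left (by linarith)
    have hm3 : max 0 (-p 3) = 0 := max_eq_left (by linarith)
    have hexp : Complex.exp (-(windingAngle q p : ℂ) * Complex.I) =
        (circleX y : ℂ) - (circleZ y : ℂ) * Complex.I := by
      rw [hw, ← Complex.ofReal_neg, Complex.exp_mul_I, ← Complex.ofReal_cos, ← Complex.ofReal_sin,
        Real.cos_neg, Real.sin_neg, circleX, circleZ]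
      push_cast
      ring
    rw [Complex.mul_re, linkFun_re, linkFun_im, he3, max_eq_right h0.le, ea, eb, e1, hc1, hc2, ho,
      hm1, hm2, hm3, hexp]
    simp only [Complex.sub_re, Complex.sub_im, Complex.mul_re, Complex.mul_im, Complex.ofReal_re,
      Complex.ofReal_im, Complex.I_re, Complex.I_im]
    have hcs : circleX y ^ 2 + circleZ y ^ 2 = 1 := Real.cos_sq_add_sin_sq _
    have hpos := outer_add_circleX_pos y hy5 hy1
    -- With `θ` the angle of the helix, the factors are `2 t e^{iθ}` and `t (outer + e^{-iθ})`.
    -- After multiplication by `e^{-iθ}` the real part is `2 t^2 (outer + cos θ)`.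
    have key : 0 < 2 * p 3 ^ 2 * (outer y + circleX y) := by positivity
    refine key.trans_eq ?_
    linear_combination (-(2 * p 3 ^ 2 * (outer y + circleX y))) * hcs

end LinkFun

/-! ### The surfaces are not ambient Lipschitz equivalent -/

/-- The map `H` is bi-Lipschitz near the origin, with inverse `H'`, and maps `X` to `Y`. -/
structure GermIso (X Y : Set R4) (H H' : R4 → R4) (C r : ℝ) : Prop where
  one_le : 1 ≤ C
  pos : 0 < r
  zero : H 0 = 0
  zero' : H' 0 = 0
  left_inv : ∀ v, ‖v‖ < r → H' (H v) = v
  right_inv : ∀ v, ‖v‖ < r → H (H' v) = v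
  lip : ∀ v w, ‖v‖ < r → ‖w‖ < r → dist (H v) (H w) ≤ C * dist v w
  lip' : ∀ v w, ‖v‖ < r → ‖w‖ < r → dist (H' v) (H' w) ≤ C * dist v w
  mem : ∀ v, ‖v‖ < r → (v ∈ X ↔ H v ∈ Y)

namespace GermIso

variable {X Y : Set R4} {H H' : R4 → R4} {C r : ℝ}

theorem norm_le (h : GermIso X Y H H' C r) {v : R4} (hv : ‖v‖ < r) : ‖H v‖ ≤ C * ‖v‖ := by
  simpa [h.zero] using h.lip v 0 hv (by simpa using h.pos)

theorem norm_le' (h : GermIso X Y H H' C r) {v : R4} (hv : ‖v‖ < r) : ‖H' v‖ ≤ C * ‖v‖ := by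
  simpa [h.zero'] using h.lip' v 0 hv (by simpa using h.pos)

theorem ne_zero (h : GermIso X Y H H' C r) {v : R4} (hv : ‖v‖ < r) (h0 : v ≠ 0) : H v ≠ 0 :=
  fun e => h0 (by rw [← h.left_inv v hv, e, h.zero'])

theorem ne_zero' (h : GermIso X Y H H' C r) {v : R4} (hv : ‖v‖ < r) (h0 : v ≠ 0) : H' v ≠ 0 :=
  fun e => h0 (by rw [← h.right_inv v hv, e, h.zero])

end GermIso

section

variable {q β : ℝ}

theorem ne_zero_of_mem_Hexagon {v : R4} (hv : v ∈ Hexagon q β) : v ≠ 0 := fun h => by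
  have := hv.1
  simp [h] at this

theorem height_le_norm (v : R4) : v 3 ≤ ‖v‖ := (le_abs_self _).trans (abs_coord_le v 3)

theorem mapsTo_diff_square {K K' : Set R3} {J J' : R3 → R3} (hm : MapsTo J K K')
    (hJ' : ∀ p ∈ square, J' p = p) (hinv : ∀ p, J' (J p) = p) :
    MapsTo J (K \ square) (K' \ square) :=
  fun p hp => ⟨hm hp.1, fun h => hp.2 (by
    have := hinv p
    rw [hJ' _ h] at this
    rwa [← this])⟩

set_option maxHeartbeats 1000000 in
/-- An ambient equivalence of the surfaces of the model knots gives a self-equivalence of the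
surface of the model knot `K`. -/
theorem GermIso.exists_hexagonIso {H H' : R4 → R4} {C r : ℝ} (hβ : 1 < β) (hq : β < q)
    (h : GermIso (Surf q β modelK) (Surf q β modelL) H H' C r) :
    ∃ C' r', HexagonIso q β (coneMap modelInv ∘ H) (H' ∘ coneMap modelMap) C' r' ∧
      (∀ v ∈ Hexagon q β, v 3 < r' → coneMap modelMap (coneMap modelInv (H v)) = H v) := by
  obtain ⟨C₀, R, P⟩ := outerPair_model
  have hR := P.nonneg
  have hC := h.one_le
  have hr := h.pos
  set D : ℝ := (R + 1) + C₀ * (R + 2) with hD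
  have hD1 : 1 ≤ D := by
    have : (0:ℝ) ≤ C₀ := C₀.2
    have : (0:ℝ) ≤ C₀ * (R + 2) := by positivity
    linarith
  have hC0 : 0 < C := by linarith
  have hD0 : 0 < D := by linarith
  have hCD : 1 ≤ C * D := one_le_mul_of_one_le_of_one_le hC hD1
  have hCCD : C ≤ C * D := le_mul_of_one_le_right hC0.le hD1
  have hDCD : D ≤ C * D := le_mul_of_one_le_left hD0.le hC
  -- A point of the surface of height `t` has norm at most `4 t`; after `H` or `H'` and a cone map
  -- the bound is `4 C D t`, which must stay below `r` and `1`.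
  set r' := min r 1 / (8 * (C * D)) with hr'
  have hr'0 : 0 < r' := by positivity
  have hr'e : 8 * (C * D) * r' = min r 1 := by rw [hr']; field_simp
  have hr1 : 8 * (C * D) * r' ≤ 1 := hr'e.trans_le (min_le_right _ _)
  have hrr : 8 * (C * D) * r' ≤ r := hr'e.trans_le (min_le_left _ _)
  have hr'1 : r' < 1 := by nlinarith
  have small : ∀ v ∈ Hexagon q β, v 3 < r' → v 3 < 1 ∧ 0 < v 3 ∧ ‖v‖ ≤ 4 * v 3 ∧ ‖v‖ < r ∧
      4 * (C * D) * v 3 < r ∧ 4 * (C * D) * v 3 < 1 ∧ 4 * C * v 3 ≤ 4 * (C * D) * v 3 ∧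
      4 * D * v 3 ≤ 4 * (C * D) * v 3 := by
    intro v hv hvr
    have h0 := hv.1
    have h1 : v 3 < 1 := hvr.trans hr'1
    have h2 := norm_le_of_mem_Hexagon hβ hq hv h1
    have h3 : 4 * (C * D) * v 3 ≤ 4 * (C * D) * r' := by gcongr
    have h4 : v 3 ≤ C * D * v 3 := le_mul_of_one_le_left h0.le hCD
    have h5 : 0 < C * D * r' := by positivity
    refine ⟨h1, h0, h2, ?_, ?_, ?_, ?_, ?_⟩
    · linarith
    · linarith
    · linarith
    · gcongr
    · gcongr
  have hmL : ∀ v ∈ Hexagon q β, v 3 < r' → H v ∈ Surf q β modelL ∧ H v 3 ≤ 4 * C * v 3 ∧ H v 3 < 1 ∧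
      0 < H v 3 := by
    intro v hv hvr
    obtain ⟨h1, h0, h2, h3, h4, h5, h6, h7⟩ := small v hv hvr
    have h8 := (h.mem v h3).1 ((mem_Surf_modelK_iff hβ hq h1).2 (Or.inr hv))
    have h9 : H v 3 ≤ 4 * C * v 3 := by
      have := (height_le_norm (H v)).trans (h.norm_le h3)
      nlinarith
    refine ⟨h8, h9, by linarith, ?_⟩
    exact h8.elim (fun e => absurd e (h.ne_zero h3 (ne_zero_of_mem_Hexagon hv))) fun e => e.1
  have hg : ∀ v ∈ Hexagon q β, v 3 < r' → coneMap modelInv (H v) ∈ Hexagon q β := by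
    intro v hv hvr
    obtain ⟨h8, h9, h10, h11⟩ := hmL v hv hvr
    have h12 := coneMap_mem_Surf hβ hq P.fix' P.symm.maps_diff h8 h10
    refine ((mem_Surf_modelK_iff hβ hq (by simpa using h10)).1 h12).resolve_left fun e => ?_
    have := congrArg (fun w : R4 => w 3) e
    simp at this
    linarith
  have hjl : ∀ v ∈ Hexagon q β, v 3 < r' →
      v ∈ Surf q β modelK ∧ coneMap modelMap v ∈ Surf q β modelL ∧
      ‖coneMap modelMap v‖ ≤ 4 * D * v 3 := by
    intro v hv hvr
    obtain ⟨h1, h0, h2, h3, h4, h5, h6, h7⟩ := small v hv hvr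
    have h8 : v ∈ Surf q β modelK := (mem_Surf_modelK_iff hβ hq h1).2 (Or.inr hv)
    refine ⟨h8, coneMap_mem_Surf hβ hq P.fix P.maps_diff h8 h1, ?_⟩
    have := P.dist_coneMap_le hβ hq h8 h1 (w := 0) (Or.inl rfl) (by simp)
    rw [coneMap_zero, dist_zero_right, dist_zero_right, ← hD] at this
    nlinarith
  have hk : ∀ v ∈ Hexagon q β, v 3 < r' → H' (coneMap modelMap v) ∈ Hexagon q β ∧
      H' (coneMap modelMap v) 3 ≤ 4 * (C * D) * v 3 := by
    intro v hv hvr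
    obtain ⟨h1, h0, h2, h3, h4, h5, h6, h7⟩ := small v hv hvr
    obtain ⟨h8, h9, h10⟩ := hjl v hv hvr
    have h11 : ‖coneMap modelMap v‖ < r := by linarith
    have h12 := h.norm_le' h11
    have h13 : ‖H' (coneMap modelMap v)‖ ≤ 4 * (C * D) * v 3 := h12.trans (by nlinarith)
    have h14 : H' (coneMap modelMap v) ∈ Surf q β modelK := by
      rw [h.mem _ (by linarith), h.right_inv _ h11]; exact h9
    have h15 := (height_le_norm (H' (coneMap modelMap v))).trans h13
    refine ⟨((mem_Surf_modelK_iff hβ hq (by linarith)).1 h14).resolve_left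
      (h.ne_zero' h11 fun e => ?_), h15⟩
    have := congrArg (fun w : R4 => w 3) e
    simp at this
    linarith
  refine ⟨4 * (C * D), r', ⟨by linarith, hr'0, hr'1, fun v hv hvr => ?_, fun v hv hvr => ?_,
    fun v hv w hw hvr hwr => ?_, fun v hv w hw hvr hwr => ?_⟩, fun v hv hvr => ?_⟩
  · obtain ⟨h1, h0, h2, h3, h4, h5, h6, h7⟩ := small v hv hvr
    obtain ⟨h8, h9, h10, h11⟩ := hmL v hv hvr
    refine ⟨hg v hv hvr, ?_, ?_, ?_⟩
    · change H' (coneMap modelMap (coneMap modelInv (H v))) = v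
      rw [P.symm.coneMap_coneMap hβ hq h8 h10, h.left_inv v h3]
    · change coneMap modelInv (H v) 3 ≤ _
      rw [coneMap_three]; linarith
    · change coneMap modelInv (H v) 3 < _
      rw [coneMap_three]; linarith
  · obtain ⟨h1, h0, h2, h3, h4, h5, h6, h7⟩ := small v hv hvr
    obtain ⟨h8, h9, h10⟩ := hjl v hv hvr
    obtain ⟨h12, h13⟩ := hk v hv hvr
    refine ⟨h12, ?_, h13, h13.trans_lt h5⟩
    change coneMap modelInv (H (H' (coneMap modelMap v))) = v
    rw [h.right_inv _ (by linarith), P.coneMap_coneMap hβ hq h8 h1]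
  · obtain ⟨h1, h0, h2, h3, h4, h5, h6, h7⟩ := small v hv hvr
    obtain ⟨h8, h9, h10, h11⟩ := hmL v hv hvr
    obtain ⟨k1, k0, k2, k3, k4, k5, k6, k7⟩ := small w hw hwr
    obtain ⟨k8, k9, k10, k11⟩ := hmL w hw hwr
    have h12 := P.symm.dist_coneMap_le hβ hq h8 h10 k8 k10
    have h13 := h.lip v w h3 k3
    have h14 := dist_nonneg (x := v) (y := w)
    calc _ ≤ D * dist (H v) (H w) := h12
      _ ≤ D * (C * dist v w) := by gcongr
      _ ≤ 4 * (C * D) * dist v w := by nlinarith [mul_nonneg (mul_nonneg hC0.le hD0.le) h14]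
  · obtain ⟨h1, h0, h2, h3, h4, h5, h6, h7⟩ := small v hv hvr
    obtain ⟨h8, h9, h10⟩ := hjl v hv hvr
    obtain ⟨k1, k0, k2, k3, k4, k5, k6, k7⟩ := small w hw hwr
    obtain ⟨k8, k9, k10⟩ := hjl w hw hwr
    have h12 := P.dist_coneMap_le hβ hq h8 h1 k8 k1
    have h13 := h.lip' (coneMap modelMap v) (coneMap modelMap w) (by linarith) (by linarith)
    have h14 := dist_nonneg (x := v) (y := w)
    calc _ ≤ C * dist (coneMap modelMap v) (coneMap modelMap w) := h13
      _ ≤ C * (D * dist v w) := by gcongr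
      _ ≤ 4 * (C * D) * dist v w := by nlinarith [mul_nonneg (mul_nonneg hC0.le hD0.le) h14]
  · obtain ⟨h8, h9, h10, h11⟩ := hmL v hv hvr
    exact P.symm.coneMap_coneMap hβ hq h8 h10

/-- A variation of `π` would produce, by continuity, a point where the cosine has changed its sign.
-/
theorem abs_sub_lt_pi_of_cos_pos {S : Set R4} (hS : IsPreconnected S) {N : R4 → ℝ}
    (hN : ContinuousOn N S) (hc : ∀ v ∈ S, 0 < Real.cos (N v)) {v w : R4} (hv : v ∈ S)
      (hw : w ∈ S) :
    |N v - N w| < Real.pi := by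
  have key : ∀ {v w : R4}, v ∈ S → w ∈ S → N v - N w < Real.pi := by
    intro v w hv hw
    by_contra! hge
    obtain ⟨u, hu, e⟩ := hS.intermediate_value hw hv hN
      (show N w + Real.pi ∈ Icc (N w) (N v) from ⟨by linarith [Real.pi_pos], by linarith⟩)
    have h1 := hc u hu
    rw [e, Real.cos_add_pi] at h1
    linarith [hc w hw]
  exact abs_lt.2 ⟨by linarith [key hw hv], key hv hw⟩

theorem exp_re_pos_iff (z : ℂ) : 0 < (Complex.exp z).re ↔ 0 < Real.cos z.im := by
  rw [Complex.exp_re]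
  exact mul_pos_iff_of_pos_left (Real.exp_pos _)

theorem continuousAt_windingAngle {p : R4} (h0 : 0 < p 3) : ContinuousAt (windingAngle q) p := by
  have hc : ∀ i, ContinuousAt (fun v : R4 => v i) p := fun i => by fun_prop
  have h1 : ContinuousAt (fun v : R4 => v 3 ^ q) p := (hc 3).rpow_const (Or.inl h0.ne')
  have h2 : ContinuousAt (fun v : R4 => |v 0| / v 3) p := (hc 0).abs.div (hc 3) h0.ne'
  have h3 : ContinuousAt (fun v : R4 => -v 1 / v 3 ^ q) p :=
    (hc 1).neg.div h1 (Real.rpow_pos_of_pos h0 q).ne'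
  exact continuousAt_const.mul (Filter.Tendsto.max tendsto_const_nhds (Filter.Tendsto.min
    tendsto_const_nhds (Filter.Tendsto.min (continuousAt_const.sub h2) h3)))

/-- A convex box on one side of the hyperplane `x = 0`. -/
def sideBox (σ τ : ℝ) : Set R4 :=
  {v | 0 < σ * v 0 ∧ |v 0| < 3 * τ ∧ |v 1| < 3 * τ ∧ |v 2| < 3 * τ ∧ |v 3| < τ}

theorem isOpen_sideBox (σ τ : ℝ) : IsOpen (sideBox σ τ) := by
  have h : ∀ (i : Fin 4) (a : ℝ), IsOpen {v : R4 | |v i| < a} := fun i a =>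
    isOpen_lt (f := fun v : R4 => |v i|) (by fun_prop) continuous_const
  exact (isOpen_lt (f := fun _ : R4 => (0:ℝ)) (g := fun v : R4 => σ * v 0) continuous_const
    (by fun_prop)).inter ((h 0 _).inter ((h 1 _).inter ((h 2 _).inter (h 3 _))))

theorem convex_sideBox (σ τ : ℝ) : Convex ℝ (sideBox σ τ) := by
  have h : ∀ (i : Fin 4) (a : ℝ), Convex ℝ {v : R4 | |v i| < a} := fun i a => by
    have e : {v : R4 | |v i| < a} =
        (EuclideanSpace.proj (𝕜 := ℝ) i).toLinearMap ⁻¹' Ioo (-a) a := by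
      ext v
      simp [abs_lt]
    rw [e]
    exact (convex_Ioo _ _).linear_preimage _
  have h0 : Convex ℝ {v : R4 | 0 < σ * v 0} := by
    have e : {v : R4 | 0 < σ * v 0} =
        (σ • (EuclideanSpace.proj (𝕜 := ℝ) (0 : Fin 4)).toLinearMap) ⁻¹' Ioi 0 := by
      ext v
      simp
    rw [e]
    exact (convex_Ioi _).linear_preimage _
  exact h0.inter ((h 0 _).inter ((h 1 _).inter ((h 2 _).inter (h 3 _))))

theorem norm_lt_of_mem_sideBox {σ τ : ℝ} {v : R4} (hv : v ∈ sideBox σ τ) : ‖v‖ < 10 * τ := by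
  obtain ⟨-, h0, h1, h2, h3⟩ := hv
  linarith [norm_le_sum4 v]

theorem mem_sideBox {σ τ : ℝ} (hβ : 1 < β) (hq : β < q) {v : R4} (hv : v ∈ Hexagon q β)
    (hτ : v 3 < τ)
    (h1 : v 3 < 1) (h : 0 < σ * v 0) : v ∈ sideBox σ τ := by
  have hs := sheet_le hβ hq hv.1 h1 (a := |v 0|)
  have h0 := hv.1
  refine ⟨h, by linarith [hv.2.2.1], by linarith [hv.2.2.2], ?_, by rwa [abs_of_pos h0]⟩
  rw [hv.2.1, abs_zero]; linarith

theorem edge_mem_squareCone (hβ : 1 < β) (hq : β < q) {ς ε s : ℝ} (hς : ς = 1 ∨ ς = -1)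
    (hε : ε = 1 ∨ ε = -1) (h0 : 0 < s) (h1 : s < 1) : edge q β ς ε s ∈ squareCone := by
  have h2 := rpow_lt_self_of_lt_one hβ h0 h1
  have h3 := rpow_lt_self_of_lt_one (hβ.trans hq) h0 h1
  have h4 := Real.rpow_pos_of_pos h0 β
  have h5 := Real.rpow_pos_of_pos h0 q
  refine ⟨?_, ?_, rfl⟩
  · change |ς * s ^ β| ≤ s
    rw [abs_mul, abs_of_sign hς, one_mul, abs_of_pos h4]; exact h2.le
  · change |ε * s ^ q| ≤ s
    rw [abs_mul, abs_of_sign hε, one_mul, abs_of_pos h5]; exact h3.le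

/-- On a convex box in the side given by `exists_side`, the argument of `linkFun ∘ H` is a
single-valued function. Its increments between the preimages of two right edge points, along the
surface and along the chord, are incompatible. -/
theorem not_germIso_model (hβ : 1 < β) (hq : β < q) {H H' : R4 → R4} {C r : ℝ}
    (h : GermIso (Surf q β modelK) (Surf q β modelL) H H' C r) : False := by
  have hq1 := hβ.trans hq
  obtain ⟨C', r', I, hJ⟩ := h.exists_hexagonIso hβ hq
  obtain ⟨σ, c, τ, hσ, hc, hτ, hτr', hside, hedge⟩ := I.exists_side hβ hq
  have hC := h.one_le
  have hC0 : 0 < C := by linarith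
  have hC' := I.one_le
  have hC'0 : 0 < C' := by linarith
  have hr := h.pos
  have hr'1 := I.lt_one
  obtain ⟨δ₁, hδ₁, -, H₁⟩ := exists_mul_rpow_le hq (A := 4 * C / c) (by positivity)
  obtain ⟨δ₂, hδ₂, hδ₂1, H₂⟩ := exists_mul_rpow_le hq (A := 4 * C * C' + 1) (by positivity)
  have hJe : ∀ {ς ε s : ℝ}, (ς = 1 ∨ ς = -1) → (ε = 1 ∨ ε = -1) → 0 < s → s < 1 →
      coneMap modelMap (edge q β ς ε s) = edge q β ς ε s := fun hς hε h0 h1 =>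
    coneMap_of_mem_squareCone (fun _ h => modelMap_of_mem h) (edge_mem_squareCone hβ hq hς hε h0 h1)
  -- the size of the box
  set ρ := min (min τ r) (min δ₁ 1) / (41 * C) with hρ
  have hρ0 : 0 < ρ := by positivity
  have hρe : 41 * C * ρ = min (min τ r) (min δ₁ 1) := by rw [hρ]; field_simp
  have hρτ : 41 * C * ρ ≤ τ := hρe.trans_le ((min_le_left _ _).trans (min_le_left _ _))
  have hρr : 41 * C * ρ ≤ r := hρe.trans_le ((min_le_left _ _).trans (min_le_right _ _))
  have hρδ : 41 * C * ρ ≤ δ₁ := hρe.trans_le ((min_le_right _ _).trans (min_le_left _ _))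
  have hρ1 : 41 * C * ρ ≤ 1 := hρe.trans_le ((min_le_right _ _).trans (min_le_right _ _))
  have hCρ : ρ ≤ C * ρ := le_mul_of_one_le_left hρ0.le hC
  -- Points of the box have norm below `10 ρ`, so their images have height at most `10 C ρ`, and
  -- edges of such height have norm at most `40 C ρ`. This explains the factor `41`.
  have hbox : ∀ v ∈ sideBox σ ρ, ‖v‖ < r ∧ ‖H v‖ ≤ 10 * (C * ρ) ∧ H v 3 ≤ 10 * (C * ρ) := by
    intro v hv
    have h1 := norm_lt_of_mem_sideBox hv
    have h2 : ‖v‖ < r := by linarith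
    have h3 := h.norm_le h2
    have h4 : ‖H v‖ ≤ 10 * (C * ρ) := by nlinarith
    exact ⟨h2, h4, (height_le_norm _).trans h4⟩
  have hHcont : ContinuousOn H (sideBox σ ρ) :=
    LipschitzOnWith.continuousOn (K := ⟨C, hC0.le⟩) (LipschitzOnWith.of_dist_le_mul
      fun v hv w hw => h.lip v w (hbox v hv).1 (hbox w hw).1)
  have hFcont : ContinuousOn (fun v => linkFun q β (H v)) (sideBox σ ρ) := fun v hv =>
    ContinuousAt.comp_continuousWithinAt (f := H) (g := linkFun q β)
      (continuousAt_linkFun hβ hq1 (by linarith [(hbox v hv).2.2])) (hHcont v hv)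
  have hhex : ∀ v ∈ Hexagon q β, v 3 < ρ → 0 < σ * v 0 →
      0 < (linkFun q β (H v) * Complex.exp
        (-(windingAngle q (coneMap modelInv (H v)) : ℂ) * Complex.I)).re := by
    intro v hv hvρ hσv
    have h1 : v 3 < r' := by linarith
    obtain ⟨hg, -, -, hg1⟩ := I.maps v hv h1
    have := linkFun_mul_exp_re_pos hβ hq hg hg1 (hside v hv (by linarith) hσv)
    rwa [Function.comp_apply, hJ v hv h1] at this
  -- A zero on the surface of `modelL` would come from a point of the surface on the chosen side,
  -- where `hhex` excludes it.
  have hne : ∀ v ∈ sideBox σ ρ, linkFun q β (H v) ≠ 0 := by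
    intro v hv h0
    obtain ⟨h1, h2, h3⟩ := hbox v hv
    have hv0 : v ≠ 0 := fun e => by simpa [e] using hv.1
    have hpos := pos_of_linkFun_eq_zero (h.ne_zero h1 hv0) h0 hβ hq1
    have hlt : H v 3 < 1 := by linarith
    rcases mem_of_linkFun_eq_zero hβ hq hpos hlt h0 with hs | ⟨hx, hy, hz⟩
    · have hv3 : v 3 < ρ := (abs_lt.1 hv.2.2.2.2).2
      have hmem := ((mem_Surf_modelK_iff hβ hq (by linarith)).1 ((h.mem v h1).2 hs)).resolve_left hv0
      have := hhex v hmem hv3 hv.1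
      rw [h0, zero_mul, Complex.zero_re] at this
      exact lt_irrefl _ this
    -- A zero on the closing segment is within `2 t^q` of a left edge, whose preimage has `σ x ≤ -c
    -- t^β`. So `v` would have `σ x < 0`, outside the box.
    · set t := H v 3 with ht
      have hem := edge_mem hβ hq (Or.inr rfl) (Or.inl rfl) hpos hlt (ς := -1) (ε := 1)
      have he := hedge (-1) 1 t (Or.inr rfl) (Or.inl rfl) hpos (by linarith)
      rw [Function.comp_apply, hJe (Or.inr rfl) (Or.inl rfl) hpos hlt] at he
      have hq0 := Real.rpow_pos_of_pos hpos q
      have hb0 := Real.rpow_pos_of_pos hpos β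
      have hen : ‖edge q β (-1) 1 t‖ < r :=
        (norm_le_of_mem_Hexagon hβ hq hem hlt).trans_lt (by change 4 * t < r; linarith)
      have hd : dist (H v) (edge q β (-1) 1 t) ≤ 2 * t ^ q := by
        refine (dist_le_sum4 _ _).trans ?_
        change |H v 0 - -1 * t ^ β| + |H v 1 - 1 * t ^ q| + |H v 2 - 0| + |H v 3 - t| ≤ _
        have h5 := abs_le.1 hy
        have h6 : |H v 1 - 1 * t ^ q| ≤ 2 * t ^ q := abs_le.2 ⟨by linarith, by linarith⟩
        rw [hx, hz, ← ht, show -t ^ β - -1 * t ^ β = 0 by ring, sub_self, sub_self, abs_zero]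
        linarith
      have h7 := (abs_coord_sub_le _ _ 0).trans (h.lip' (H v) _ (by linarith) hen)
      rw [h.left_inv v h1] at h7
      have h8 : C * dist (H v) (edge q β (-1) 1 t) ≤ C * (2 * t ^ q) := by gcongr
      have h9 : σ * v 0 - σ * H' (edge q β (-1) 1 t) 0 ≤ |v 0 - H' (edge q β (-1) 1 t) 0| := by
        rw [← mul_sub]
        refine (le_abs_self _).trans_eq ?_
        rw [abs_mul, abs_of_sign hσ, one_mul]
      have h10 := H₁ t hpos (by linarith)
      rw [div_mul_eq_mul_div, div_le_iff₀ hc] at h10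
      have h11 : 0 < C * t ^ q := by positivity
      linarith [hv.1]
  -- the preimages of the two edges on the right
  set s := min (ρ / C') δ₂ / 2 with hs
  have hs0 : 0 < s := by positivity
  have hsmin : 2 * s = min (ρ / C') δ₂ := by rw [hs]; ring
  have hsρ : C' * s < ρ := by
    have : 2 * s ≤ ρ / C' := hsmin.trans_le (min_le_left _ _)
    rw [le_div_iff₀ hC'0] at this
    nlinarith
  have hsδ : s < δ₂ := by
    have : 2 * s ≤ δ₂ := hsmin.trans_le (min_le_right _ _)
    linarith
  have hs1 : s < 1 := by linarith
  have hsC : s ≤ C' * s := le_mul_of_one_le_left hs0.le hC'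
  have hsb := Real.rpow_pos_of_pos hs0 β
  have hsq := Real.rpow_pos_of_pos hs0 q
  have hsbl := rpow_lt_self_of_lt_one hβ hs0 hs1
  have hH2 := H₂ s hs0 hsδ
  have hP : ∀ ε : ℝ, ε = 1 ∨ ε = -1 → H' (edge q β 1 ε s) ∈ Hexagon q β ∧
      H' (edge q β 1 ε s) 3 < ρ ∧ 0 < σ * H' (edge q β 1 ε s) 0 ∧
      coneMap modelInv (H (H' (edge q β 1 ε s))) = edge q β 1 ε s ∧
      H' (edge q β 1 ε s) ∈ sideBox σ ρ := by
    intro ε hε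
    have hem := edge_mem hβ hq (Or.inl rfl) hε hs0 hs1 (ς := 1)
    obtain ⟨h1, h2, h3, h4⟩ := I.maps' _ hem (show s < r' by linarith)
    have h5 := hedge 1 ε s (Or.inl rfl) hε hs0 (by linarith)
    simp only [Function.comp_apply] at h1 h2 h3 h4 h5
    rw [hJe (Or.inl rfl) hε hs0 hs1] at h1 h2 h3 h4 h5
    have h6 : H' (edge q β 1 ε s) 3 < ρ := h3.trans_lt hsρ
    have h7 : 0 < σ * H' (edge q β 1 ε s) 0 := by
      have : 0 < c * s ^ β := by positivity
      linarith
    exact ⟨h1, h6, h7, h2, mem_sideBox hβ hq h1 h6 h4 h7⟩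
  obtain ⟨hp1, hp2, hp3, hp4, hp5⟩ := hP 1 (Or.inl rfl)
  obtain ⟨hm1, hm2, hm3, hm4, hm5⟩ := hP (-1) (Or.inr rfl)
  set P := H' (edge q β 1 1 s) with hPdef
  set M := H' (edge q β 1 (-1) s) with hMdef
  -- the logarithm
  have hsc : IsSimplyConnected (sideBox σ ρ) := by
    have := (convex_sideBox σ ρ).contractibleSpace ⟨P, hp5⟩
    exact (inferInstance : SimplyConnectedSpace (sideBox σ ρ))
  obtain ⟨A, hA, hAe⟩ := Complex.exists_continuousOn_eqOn_exp_comp hsc (isOpen_sideBox σ ρ) hFcont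
    (by rintro ⟨v, hv, e⟩; exact hne v hv e)
  have hAe : ∀ v ∈ sideBox σ ρ, Complex.exp (A v) = linkFun q β (H v) := fun v hv => hAe hv
  have hAim : ContinuousOn (fun v => (A v).im) (sideBox σ ρ) :=
    Complex.continuous_im.comp_continuousOn hA
  -- along the surface
  have hpre := isPreconnected_half hβ hq hσ hρ0 (show ρ ≤ 1 by linarith)
  have hsub : {v ∈ Hexagon q β | v 3 < ρ ∧ 0 < σ * v 0} ⊆ sideBox σ ρ := fun v hv =>
    mem_sideBox hβ hq hv.1 hv.2.1 (by linarith [hv.2.1]) hv.2.2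
  have hpath := abs_sub_lt_pi_of_cos_pos hpre
    (N := fun v => (A v).im - windingAngle q (coneMap modelInv (H v)))
    ((hAim.mono hsub).sub fun v hv => ContinuousAt.comp_continuousWithinAt
      (f := coneMap modelInv ∘ H) (g := windingAngle q)
      (continuousAt_windingAngle (I.maps v hv.1 (by linarith [hv.2.1])).1.1)
      ((I.continuousOn v ⟨hv.1, by linarith [hv.2.1]⟩).mono
        fun w hw => ⟨hw.1, by linarith [hw.2.1]⟩))
    (fun v hv => by
      have h1 := hhex v hv.1 hv.2.1 hv.2.2
      rw [← hAe v (hsub hv), ← Complex.exp_add, exp_re_pos_iff] at h1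
      convert h1 using 2
      simp [sub_eq_add_neg])
    (v := M) (w := P) ⟨hm1, hm2, hm3⟩ ⟨hp1, hp2, hp3⟩
  -- The winding angle is `0` on the upper and `2π` on the lower right edge.
  rw [hp4, hm4, windingAngle_of_nonneg (show 0 < edge q β 1 1 s 3 from hs0)
    (by change 0 ≤ 1 * s ^ q; linarith), windingAngle_of_le (show 0 < edge q β 1 (-1) s 3 from hs0)
    (by change |1 * s ^ β| ≤ s; rw [one_mul, abs_of_pos hsb]; exact hsbl.le)
    (by change -1 * s ^ q ≤ -(s ^ q); linarith)] at hpath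
  -- along the chord
  have hseg : segment ℝ P M ⊆ sideBox σ ρ := (convex_sideBox σ ρ).segment_subset hp5 hm5
  have hPM : dist M P ≤ C' * (2 * s ^ q) := by
    have hem := edge_mem hβ hq (Or.inl rfl) (Or.inl rfl) hs0 hs1 (ς := 1) (ε := 1)
    have hem' := edge_mem hβ hq (Or.inl rfl) (Or.inr rfl) hs0 hs1 (ς := 1) (ε := -1)
    have h1 := I.lip' _ hem' _ hem (show s < r' by linarith) (show s < r' by linarith)
    rw [Function.comp_apply, Function.comp_apply, hJe (Or.inl rfl) (Or.inl rfl) hs0 hs1,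
      hJe (Or.inl rfl) (Or.inr rfl) hs0 hs1] at h1
    refine h1.trans (mul_le_mul_of_nonneg_left ?_ hC'0.le)
    refine (dist_le_sum4 _ _).trans ?_
    change |1 * s ^ β - 1 * s ^ β| + |-1 * s ^ q - 1 * s ^ q| + |(0:ℝ) - 0| + |s - s| ≤ _
    rw [sub_self, sub_self, sub_self, abs_zero, show -1 * s ^ q - 1 * s ^ q = -(2 * s ^ q) by ring,
      abs_neg, abs_of_pos (by positivity)]
    linarith
  have hHP : H P = edge q β 1 1 s := by
    refine h.right_inv _ ?_
    have hem := edge_mem hβ hq (Or.inl rfl) (Or.inl rfl) hs0 hs1 (ς := 1) (ε := 1)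
    refine (norm_le_of_mem_Hexagon hβ hq hem hs1).trans_lt ?_
    change 4 * s < r
    linarith
  have hchord := abs_sub_lt_pi_of_cos_pos (convex_segment P M).isPreconnected (hAim.mono hseg)
    (fun v hv => by
      rw [← exp_re_pos_iff, hAe v (hseg hv)]
      have h1 : dist v P ≤ C' * (2 * s ^ q) := by
        rw [dist_comm, dist_eq_norm, ← neg_sub, norm_neg]
        refine le_trans ?_ hPM
        rw [dist_eq_norm]
        exact norm_sub_le_of_mem_segment hv
      have h2 := (h.lip v P (hbox v (hseg hv)).1 (hbox P hp5).1)
      rw [hHP] at h2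
      -- The image of the chord stays within a multiple of `s^q` of the right edge, hence in `x >
      -- 0`, where the real part of `linkFun` is positive.
      have h3 : dist (H v) (edge q β 1 1 s) ≤ 2 * C * C' * s ^ q := by
        refine h2.trans ?_
        calc C * dist v P ≤ C * (C' * (2 * s ^ q)) := by gcongr
          _ = _ := by ring
      have hx := abs_le.1 ((abs_coord_sub_le (H v) (edge q β 1 1 s) 0).trans h3)
      have hy := abs_le.1 ((abs_coord_sub_le (H v) (edge q β 1 1 s) 1).trans h3)
      have ht := abs_le.1 ((abs_coord_sub_le (H v) (edge q β 1 1 s) 3).trans h3)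
      rw [show edge q β 1 1 s 0 = 1 * s ^ β from rfl] at hx
      rw [show edge q β 1 1 s 1 = 1 * s ^ q from rfl] at hy
      rw [show edge q β 1 1 s 3 = s from rfl] at ht
      have hCC : 0 < C * C' * s ^ q := by positivity
      exact linkFun_re_pos_of_pos hβ hq1 (by linarith) (by linarith [(hbox v (hseg hv)).2.2])
        (by linarith) (by linarith))
    (v := M) (w := P) (right_mem_segment ℝ P M) (left_mem_segment ℝ P M)
  -- The increment of the argument differs from `2π` by less than `π`, and is itself less than `π`.
  have e1 := abs_lt.1 hpath
  have e2 := abs_lt.1 hchord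
  linarith

end

/-! ### Reduction of arbitrary deformations to the model knots. -/

section

variable {q β : ℝ}

theorem coneMap_mem_Surf_image_iff (hβ : 1 < β) (hq : β < q) {K : Set R3} {Φ : R3 ≃ₜ R3}
    (hs : ∀ p ∈ square, Φ p = p) {v : R4} (h1 : v 3 < 1) :
    coneMap Φ v ∈ Surf q β (Φ '' K) ↔ v ∈ Surf q β K := by
  have hs' : ∀ p ∈ square, Φ.symm p = p := fun p hp => by
    conv_lhs => rw [← hs p hp]
    exact Φ.symm_apply_apply p
  refine ⟨fun h => ?_, fun h => coneMap_mem_Surf hβ hq hs (mapsTo_diff_square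
    (mapsTo_image _ _) hs' Φ.symm_apply_apply) h h1⟩
  have := coneMap_mem_Surf hβ hq hs' (mapsTo_diff_square (J := Φ.symm) (J' := Φ) (K' := K)
    (by rintro _ ⟨p, hp, rfl⟩; simpa using hp) hs Φ.apply_symm_apply) h (by simpa using h1)
  rwa [coneMap_coneMap fun _ => Φ.symm_apply_apply _] at this

/-- An ambient equivalence of the surfaces of two deformed knots gives one of the surfaces of the
knots themselves. -/
theorem exists_germIso (hβ : 1 < β) (hq : β < q) {K₀ L₀ K L : Set R3} (hK₀ : Framed K₀)
    (hL₀ : Framed L₀) (hK : IsDeformation K₀ K) (hL : IsDeformation L₀ L)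
    (h : AmbientLipschitzEquivalent (surface q β K) (surface q β L)) :
    ∃ H H' C r, GermIso (Surf q β K₀) (Surf q β L₀) H H' C r := by
  have fK := hK.framed hK₀
  have fL := hL.framed hL₀
  obtain ⟨Φ, A, A', hA, hA', hΦ, rfl⟩ := hK.exists_coneMap
  obtain ⟨Ψ, B, B', hB, hB', hΨ, rfl⟩ := hL.exists_coneMap
  obtain ⟨h, M, M', h0, hz, hM, hM', himg⟩ := h
  set C : ℝ≥0 := 1 + A + A' + B + B' + M + M' with hC
  have hA0 := A.coe_nonneg
  have hA0' := A'.coe_nonneg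
  have hB0 := B.coe_nonneg
  have hB0' := B'.coe_nonneg
  have hM0 := M.coe_nonneg
  have hM0' := M'.coe_nonneg
  have hCe : (C:ℝ) = 1 + A + A' + B + B' + M + M' := by rw [hC]; push_cast; rfl
  have hA := hA.weaken (show A ≤ C from NNReal.coe_le_coe.1 (by linarith))
  have hA' := hA'.weaken (show A' ≤ C from NNReal.coe_le_coe.1 (by linarith))
  have hB := hB.weaken (show B ≤ C from NNReal.coe_le_coe.1 (by linarith))
  have hB' := hB'.weaken (show B' ≤ C from NNReal.coe_le_coe.1 (by linarith))
  have hM := hM.weaken (show M ≤ C from NNReal.coe_le_coe.1 (by linarith))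
  have hM' := hM'.weaken (show M' ≤ C from NNReal.coe_le_coe.1 (by linarith))
  have hC1 : (1:ℝ) ≤ C := by linarith
  clear_value C
  have h0' : (0 : R4) ∈ h.target := by rw [← hz]; exact h.map_source h0
  have hz' : h.symm 0 = 0 := by
    conv_lhs => rw [← hz]
    exact h.left_inv h0
  obtain ⟨ρ, hρ, hb⟩ := Metric.isOpen_iff.1 (h.open_source.inter h.open_target) 0 ⟨h0, h0'⟩
  have hC0 : (0:ℝ) < C := by linarith
  -- A deformation followed by `h` expands by at most `C^2`, and the result must stay in the common
  -- ball and below height one.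
  set r := min ρ 1 / ((C:ℝ) ^ 2) with hr
  have hr0 : 0 < r := by positivity
  have hre : (C:ℝ) ^ 2 * r = min ρ 1 := by rw [hr]; field_simp
  have hCC : (C:ℝ) * r ≤ C ^ 2 * r := by gcongr; exact le_self_pow₀ hC1 two_ne_zero
  have hCr : r ≤ C * r := le_mul_of_one_le_left hr0.le hC1
  have hra : ∀ {f : R4 → R4}, LipschitzWith C f → f 0 = 0 → ∀ {v : R4}, ‖v‖ < r →
      f v ∈ h.source ∧ f v ∈ h.target ∧ ‖f v‖ ≤ C * ‖v‖ := by
    intro f hf f0 v hv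
    have h1 := hf.dist_le_mul v 0
    rw [f0, dist_zero_right, dist_zero_right] at h1
    have h2 : C * ‖v‖ < C * r := by gcongr
    have h3 := hb (show f v ∈ Metric.ball 0 ρ by
      rw [mem_ball_zero_iff]
      linarith [min_le_left ρ 1])
    exact ⟨h3.1, h3.2, h1⟩
  have h1 : ∀ v, h.symm (coneMap Ψ (coneMap Ψ.symm (h v))) = h.symm (h v) := fun v => by
    rw [coneMap_coneMap fun _ => Ψ.apply_symm_apply _]
  refine ⟨fun v => coneMap Ψ.symm (h (coneMap Φ v)),
    fun v => coneMap Φ.symm (h.symm (coneMap Ψ v)), C * (C * C), r, ?_, hr0, by simp [hz],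
    by simp [hz'], fun v hv => ?_, fun v hv => ?_, fun v w hv hw => ?_, fun v w hv hw => ?_,
    fun v hv => ?_⟩
  · exact one_le_mul_of_one_le_of_one_le hC1 (one_le_mul_of_one_le_of_one_le hC1 hC1)
  · rw [coneMap_coneMap (J := Ψ.symm) fun _ => Ψ.apply_symm_apply _,
      h.left_inv (hra hA (by simp) hv).1, coneMap_coneMap fun _ => Φ.symm_apply_apply _]
  · rw [coneMap_coneMap (J := Φ.symm) fun _ => Φ.apply_symm_apply _,
      h.right_inv (hra hB (by simp) hv).2.1, coneMap_coneMap fun _ => Ψ.symm_apply_apply _]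
  · have e1 := hB'.dist_le_mul (h (coneMap Φ v)) (h (coneMap Φ w))
    have e2 := hM.dist_le_mul _ (hra hA (by simp) hv).1 _ (hra hA (by simp) hw).1
    have e3 := hA.dist_le_mul v w
    calc _ ≤ _ := e1
      _ ≤ C * (C * (C * dist v w)) := by gcongr; exact e2.trans (by gcongr)
      _ = _ := by ring
  · have e1 := hA'.dist_le_mul (h.symm (coneMap Ψ v)) (h.symm (coneMap Ψ w))
    have e2 := hM'.dist_le_mul _ (hra hB (by simp) hv).2.1 _ (hra hB (by simp) hw).2.1
    have e3 := hB.dist_le_mul v w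
    calc _ ≤ _ := e1
      _ ≤ C * (C * (C * dist v w)) := by gcongr; exact e2.trans (by gcongr)
      _ = _ := by ring
  · obtain ⟨s1, -, s2⟩ := hra hA (by simp) hv
    have s3 := hM.dist_le_mul _ s1 _ h0
    rw [hz, dist_zero_right, dist_zero_right] at s3
    have s4 : C * ‖coneMap Φ v‖ ≤ C ^ 2 * ‖v‖ := by rw [pow_two, mul_assoc]; gcongr
    have s5 : (C:ℝ) ^ 2 * ‖v‖ < C ^ 2 * r := by gcongr
    have t1 : v 3 < 1 := by linarith [height_le_norm v, min_le_right ρ 1]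
    have t2 : h (coneMap Φ v) 3 < 1 := by
      linarith [height_le_norm (h (coneMap Φ v)), min_le_right ρ 1]
    rw [← coneMap_mem_Surf_image_iff hβ hq hΦ t1, ← mem_surface_iff hβ hq fK (by simpa using t1),
      ← coneMap_mem_Surf_image_iff hβ hq hΨ (by simpa using t2),
      coneMap_coneMap fun _ => Ψ.apply_symm_apply _, ← mem_surface_iff hβ hq fL t2]
    constructor
    · intro hm
      exact (himg.subset ⟨_, ⟨hm, s1⟩, rfl⟩).1
    · intro hm
      obtain ⟨w, ⟨hw, hws⟩, e⟩ := himg.superset ⟨hm, h.map_source s1⟩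
      rwa [← h.injOn hws s1 e]

theorem framed_modelL : Framed modelL := modelL_eq ▸ framed_strands

theorem not_ambientLipschitzEquivalent (hβ : 1 < β) (hq : β < q) {K L : Set R3}
    (hK : IsDeformation modelK K) (hL : IsDeformation modelL L) :
    ¬ AmbientLipschitzEquivalent (surface q β K) (surface q β L) := fun h => by
  obtain ⟨H, H', C, r, h⟩ := exists_germIso hβ hq framed_modelK framed_modelL hK hL h
  exact not_germIso_model hβ hq h

theorem outerLipschitzEquivalent_surface (hβ : 1 < β) (hq : β < q) {K L : Set R3}
    (hK : IsDeformation modelK K) (hL : IsDeformation modelL L) :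
    OuterLipschitzEquivalent (surface q β K) (surface q β L) := by
  obtain ⟨_, _, P⟩ := outerPair_model
  obtain ⟨_, _, _, _, Q⟩ := hK.outerPair ⟨_, fun p hp => P.bdd p (Or.inl hp)⟩
  obtain ⟨_, _, _, _, S⟩ := hL.outerPair ⟨_, fun p hp => P.bdd' p (Or.inl hp)⟩
  exact (Q.symm.trans (P.trans S)).outerLipschitzEquivalent hβ hq (hK.framed framed_modelK)
    (hL.framed framed_modelL)

theorem topologicallyAmbientEquivalent_surface (hβ : 1 < β) (hq : β < q) {K L : Set R3}
    (hK : IsDeformation modelK K) (hL : IsDeformation modelL L) :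
    TopologicallyAmbientEquivalent (surface q β K) (surface q β L) := by
  have height : ∀ v ∈ Metric.ball (0 : R4) 1, v 3 < 1 := fun v hv =>
    (height_le_norm v).trans_lt (mem_ball_zero_iff.1 hv)
  exact ((hK.ballEquivalent hβ hq).symm.trans ((ballEquivalent_model hβ hq).trans
    (hL.ballEquivalent hβ hq))).topologicallyAmbientEquivalent
    (fun v hv => mem_surface_iff hβ hq (hK.framed framed_modelK) (height v hv))
    (fun v hv => mem_surface_iff hβ hq (hL.framed framed_modelL) (height v hv))

end

end SurfaceGerm

theorem theorem2 (q β : ℝ) (hβ : 1 < β) (hq : β < q) (K L : Set R3)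
    (hK : SurfaceGerm.IsDeformation SurfaceGerm.modelK K)
    (hL : SurfaceGerm.IsDeformation SurfaceGerm.modelL L) :
    SurfaceGerm.OuterLipschitzEquivalent
      (SurfaceGerm.surface q β K) (SurfaceGerm.surface q β L) ∧
    SurfaceGerm.TopologicallyAmbientEquivalent
      (SurfaceGerm.surface q β K) (SurfaceGerm.surface q β L) ∧
    ¬ SurfaceGerm.AmbientLipschitzEquivalent
      (SurfaceGerm.surface q β K) (SurfaceGerm.surface q β L) :=
  ⟨SurfaceGerm.outerLipschitzEquivalent_surface hβ hq hK hL,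
    SurfaceGerm.topologicallyAmbientEquivalent_surface hβ hq hK hL,
    SurfaceGerm.not_ambientLipschitzEquivalent hβ hq hK hL⟩
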